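/- Let $n\ge 1$ be an integer, $\delta>0$, $\nu\in\mathbb C$ with $\operatorname{Re}\nu\le n$ and $\nu\notin\{-1,-2,\dots\}$. Let $f$ be a complex-valued function, locally integrable on $(a,\infty)$, with $f(t)=O(t^{\operatorname{Re}\nu-n-\varepsilon})$ as $t\to\infty$ for some $\varepsilon>0$, and let $x-\delta>a$. For real $\alpha>-\tfrac12$ let $p_n=P_n^{(\alpha-1/2,\alpha-1/2)}$ be the Jacobi polynomial (a multiple of the Gegenbauer polynomial, if $\alpha\neq0$), with leading coefficient $k_n$, and $h_n=\int_{-1}^1p_n(u)^2(1-u^2)^{\alpha-1/2}du$. Put $$D^n_{\delta}[g](x)=\frac{k_n\,n!}{h_n\,\delta^n}\int_{-1}^1 g(x+\delta u)\,p_n(u)\,(1-u^2)^{\alpha-1/2}\,du,\qquad W^{-\mu}[f](x)=\frac1{\Gamma(\mu)}\int_x^\infty f(y)(y-x)^{\mu-1}dy\quad(\operatorname{Re}\mu>0),$$ $W^{0}=\mathrm{id}$, and define the approximate fractional Gegenbauer derivative, for $\operatorname{Re}\nu<n$ or $\nu=n$, by $W^{\nu,n}_{\delta,\alpha}[f](x)=(-1)^nD^n_\delta\big[W^{\nu-n}[f]\big](x)$.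 Let $P^\mu_\lambda$ on $(-1,1)$ and $Q^\mu_\lambda$ on $(1,\infty)$ be the associated Legendre functions $$P^\mu_\lambda(y)=\Big(\frac{1+y}{1-y}\Big)^{\mu/2}\frac{F\big(\lambda+1,-\lambda;1-\mu;\tfrac{1-y}2\big)}{\Gamma(1-\mu)},\qquad Q^\mu_\lambda(y)=\frac{e^{i\pi\mu}\sqrt\pi\,\Gamma(\lambda+\mu+1)(y^2-1)^{\mu/2}}{2^{\lambda+1}y^{\lambda+\mu+1}}\,\frac{F\big(\tfrac{\lambda+\mu}2+1,\tfrac{\lambda+\mu+1}2;\lambda+\tfrac32;y^{-2}\big)}{\Gamma(\lambda+\tfrac32)},$$ and let $\mu=\tfrac12-\alpha-n+\nu$. Consider the formula $$W^{\nu,n}_{\delta,\alpha}[f](x)=\frac{2^{n+\alpha-1/2}\,\Gamma(n+\alpha+1)}{\sqrt\pi\;\delta^\nu}\int_{-1}^1 f(x-\delta y)\,\frac{P^{\mu}_{n+\alpha-1/2}(y)}{(\sqrt{1-y^2})^{\mu}}\,dy-(-1)^n\frac{e^{i\pi(\alpha-1/2-\nu)}\,2^{n+\alpha+1/2}\,\Gamma(n+\alpha+1)\sin(\nu\pi)}{\pi\sqrt\pi\;\delta^\nu}\int_1^\infty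 f(x+\delta y)\,\frac{Q^{\mu}_{n+\alpha-1/2}(y)}{(\sqrt{y^2-1})^{\mu}}\,dy .\tag{G}$$ (i) If $\operatorname{Re}\nu<n$ and the double integral defining $W^{\nu,n}_{\delta,\alpha}[f](x)$ converges absolutely (which is the case for all such $x$ if $f$ is bounded on compact subsets of $(a,\infty)$, e.g. continuous), then both integrals in (G) converge absolutely and (G) holds. (ii) If $\operatorname{Re}\nu=n$ and $f$ is bounded on compact subsets of $(a,\infty)$, then both integrals converge absolutely and (G) holds by continuity: the right-hand side of (G) is the limit of $W^{s,n}_{\delta,\alpha}[f](x)$ as $s\to\nu$ with $\operatorname{Re}s<n$. For $\nu=n$, (G) also holds as an identity for $W^{n,n}_{\delta,\alpha}[f](x)=(-1)^nD^n_\delta[f](x)$. In particular, for $\alpha=\tfrac12$ the same statements hold for the approximate fractional Legendre derivative, with (G) in the form $$W^{\nu,n}_{\delta,1/2}[f](x)=\frac{2^n}{\sqrt\pi}\,\frac{\Gamma(n+\tfrac32)}{\delta^\nu}\int_{-1}^1 f(x-\delta y)\,\frac{P^{\nu-n}_{n}(y)}{(\sqrt{1-y^2})^{\nu-n}}\,dy-(-1)^n\frac{2^{n+1}e^{-i\pi\nu}\sin(\nu\pi)}{\pi\sqrt\pi}\,\frac{\Gamma(n+\tfrac32)}{\delta^\nu}\int_1^\infty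 f(x+\delta y)\,\frac{Q^{\nu-n}_{n}(y)}{(\sqrt{y^2-1})^{\nu-n}}\,dy .$$ -/

import Mathlib

open MeasureTheory Set Filter Topology Asymptotics

noncomputable section

/-! ### Fractional integrals and the approximate fractional orthogonal derivative -/

/-- The Weyl fractional integral `W^{-μ}[f](x) = (1/Γ(μ)) ∫_x^∞ f(y) (y - x)^{μ-1} dy` for
`0 < Re μ`, with `W^0 = id`. -/
def weylIntegral (μ : ℂ) (f : ℝ → ℂ) (x : ℝ) : ℂ :=
  if μ = 0 then f x
  else 1 / Complex.Gamma μ * ∫ y in Ioi x, f y * ((y - x : ℝ) : ℂ) ^ (μ - 1)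

/-- The approximate orthogonal derivative
`D_δ^n[g](x) = (k_n n! / h_n) δ^{-n} ∫ g(x + δ ξ) p_n(ξ) dm(ξ)`, where `p = p_n` is an orthogonal
polynomial of degree `n` for the measure `m`, `k_n` is its coefficient of degree `n` and
`h_n = ∫ p_n² dm`. -/
def orthDeriv (p : Polynomial ℝ) (m : Measure ℝ) (n : ℕ) (δ : ℝ) (g : ℝ → ℂ) (x : ℝ) : ℂ :=
  ((p.coeff n * (n.factorial : ℝ) / ∫ ξ, (p.eval ξ) ^ 2 ∂m : ℝ) : ℂ) * (1 / (δ : ℂ) ^ n) *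
    ∫ ξ, g (x + δ * ξ) * ((p.eval ξ : ℝ) : ℂ) ∂m

/-- The approximate fractional orthogonal (Weyl) derivative
`W_δ^{ν,n}[f](x) = (-1)^n D_δ^n[W^{ν-n}[f]](x)`. -/
def approxWeylDeriv (p : Polynomial ℝ) (m : Measure ℝ) (n : ℕ) (δ : ℝ) (ν : ℂ)
    (f : ℝ → ℂ) (x : ℝ) : ℂ :=
  (-1) ^ n * orthDeriv p m n δ (weylIntegral ((n : ℂ) - ν) f) x

/-- For `Re ν < n`: the double integral
`∫ p(u) ∫_{x+δu}^∞ f(y) (y - x - δu)^{n-ν-1} dy dm(u)`, to which `W_δ^{ν,n}[f](x)` is a constant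
multiple, converges absolutely (written with `y = x + δu + t`, `t > 0`). -/
def ApproxWeylConverges (p : Polynomial ℝ) (m : Measure ℝ) (n : ℕ) (δ : ℝ) (ν : ℂ)
    (f : ℝ → ℂ) (x : ℝ) : Prop :=
  Integrable (fun q : ℝ × ℝ =>
      ((p.eval q.1 : ℝ) : ℂ) * (f (x + δ * q.1 + q.2) * (q.2 : ℂ) ^ ((n : ℂ) - ν - 1)))
    (m.prod (volume.restrict (Ioi 0)))

/-! ### Jacobi and Gegenbauer weights -/

/-- The Jacobi polynomial `P_n^{(α,β)}`, in the form
`(1/n!) ∑_k C(n,k) (n+α+β+1)_k (α+k+1)_{n-k} ((X-1)/2)^k`. -/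
def jacobiPoly (n : ℕ) (α β : ℝ) : Polynomial ℝ :=
  ∑ k ∈ Finset.range (n + 1),
    Polynomial.C ((n.choose k : ℝ) / (n.factorial : ℝ) *
        (ascPochhammer ℝ k).eval (n + α + β + 1) *
        (ascPochhammer ℝ (n - k)).eval (α + k + 1)) *
      (Polynomial.C (1 / 2) * (Polynomial.X - 1)) ^ k

/-- The Jacobi orthogonality measure `(1 - u)^α (1 + u)^β du` on `(-1, 1)`. -/
def jacobiMeasure (α β : ℝ) : Measure ℝ :=
  (volume.restrict (Ioo (-1) 1)).withDensity
    fun u => ENNReal.ofReal ((1 - u) ^ α * (1 + u) ^ β)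

/-- The Gegenbauer polynomials are the Jacobi polynomials `P_n^{(α-1/2,α-1/2)}`, up to
normalization. -/
def gegenbauerPoly (n : ℕ) (α : ℝ) : Polynomial ℝ := jacobiPoly n (α - 1 / 2) (α - 1 / 2)

/-- The Gegenbauer weight `(1 - u²)^{α-1/2} du` on `(-1, 1)`. -/
def gegenbauerMeasure (α : ℝ) : Measure ℝ := jacobiMeasure (α - 1 / 2) (α - 1 / 2)

/-- The approximate fractional Gegenbauer derivative `W_{δ,α}^{ν,n}[f](x)`. -/
def approxGegenbauerDeriv (n : ℕ) (α δ : ℝ) (ν : ℂ) (f : ℝ → ℂ) (x : ℝ) : ℂ :=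
  approxWeylDeriv (gegenbauerPoly n α) (gegenbauerMeasure α) n δ ν f x

/-- Absolute convergence of the double integral defining `W_{δ,α}^{ν,n}[f](x)`. -/
def ApproxGegenbauerConverges (n : ℕ) (α δ : ℝ) (ν : ℂ) (f : ℝ → ℂ) (x : ℝ) : Prop :=
  ApproxWeylConverges (gegenbauerPoly n α) (gegenbauerMeasure α) n δ ν f x

/-- The approximate fractional Legendre derivative: the case `α = 1/2`. -/
def approxLegendreDeriv (n : ℕ) (δ : ℝ) (ν : ℂ) (f : ℝ → ℂ) (x : ℝ) : ℂ :=
  approxGegenbauerDeriv n (1 / 2) δ ν f x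

/-! ### Associated Legendre functions

`Complex.regularizedGaussHGFun a b c z` is `F(a, b; c; z) / Γ(c)`. -/

/-- The associated Legendre function of the first kind on the cut (Ferrers function)
`P^μ_l(y) = ((1+y)/(1-y))^{μ/2} F(l+1, -l; 1-μ; (1-y)/2) / Γ(1-μ)`, `-1 < y < 1`. -/
def legendreP (μ l : ℂ) (y : ℝ) : ℂ :=
  (((1 + y) / (1 - y) : ℝ) : ℂ) ^ (μ / 2) *
    Complex.regularizedGaussHGFun (l + 1) (-l) (1 - μ) (((1 - y) / 2 : ℝ) : ℂ)

/-- The associated Legendre function of the second kind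
`Q^μ_l(y) = e^{iπμ} √π Γ(l+μ+1) (y²-1)^{μ/2} / (2^{l+1} y^{l+μ+1})
  · F((l+μ)/2+1, (l+μ+1)/2; l+3/2; y^{-2}) / Γ(l+3/2)`, `1 < y`, for `l + μ ≠ -1, -2, …`. -/
def legendreQ (μ l : ℂ) (y : ℝ) : ℂ :=
  Complex.exp (Complex.I * Real.pi * μ) * (Real.sqrt Real.pi : ℂ) * Complex.Gamma (l + μ + 1) *
    ((y ^ 2 - 1 : ℝ) : ℂ) ^ (μ / 2) / ((2 : ℂ) ^ (l + 1) * (y : ℂ) ^ (l + μ + 1)) *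
    Complex.regularizedGaussHGFun ((l + μ) / 2 + 1) ((l + μ + 1) / 2) (l + 3 / 2)
      ((1 / y ^ 2 : ℝ) : ℂ)

/-! ### The kernels and the explicit formulas -/

/-- `P^μ_{n+α-1/2}(y) / (√(1-y²))^μ` with `μ = 1/2 - α - n + ν`. -/
def gegenbauerKernelP (n : ℕ) (α : ℝ) (ν : ℂ) (y : ℝ) : ℂ :=
  legendreP (1 / 2 - α - n + ν) (n + α - 1 / 2) y /
    (Real.sqrt (1 - y ^ 2) : ℂ) ^ (1 / 2 - α - n + ν)

/-- `Q^μ_{n+α-1/2}(y) / (√(y²-1))^μ` with `μ = 1/2 - α - n + ν`. -/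
def gegenbauerKernelQ (n : ℕ) (α : ℝ) (ν : ℂ) (y : ℝ) : ℂ :=
  legendreQ (1 / 2 - α - n + ν) (n + α - 1 / 2) y /
    (Real.sqrt (y ^ 2 - 1) : ℂ) ^ (1 / 2 - α - n + ν)

/-- The explicit expression for the approximate fractional Gegenbauer derivative. -/
def gegenbauerFormula (n : ℕ) (α δ : ℝ) (ν : ℂ) (f : ℝ → ℂ) (x : ℝ) : ℂ :=
  ((2 ^ ((n : ℝ) + α - 1 / 2) * Real.Gamma (n + α + 1) / Real.sqrt Real.pi : ℝ) : ℂ) *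
      (1 / (δ : ℂ) ^ ν) *
      (∫ y in Ioo (-1 : ℝ) 1, f (x - δ * y) * gegenbauerKernelP n α ν y)
    - (-1) ^ n * Complex.exp (Complex.I * Real.pi * (α - 1 / 2 - ν)) *
      ((2 ^ ((n : ℝ) + α + 1 / 2) * Real.Gamma (n + α + 1) /
        (Real.pi * Real.sqrt Real.pi) : ℝ) : ℂ) *
      Complex.sin (ν * Real.pi) * (1 / (δ : ℂ) ^ ν) *
      (∫ y in Ioi (1 : ℝ), f (x + δ * y) * gegenbauerKernelQ n α ν y)

/-- `P^{ν-n}_n(y) / (√(1-y²))^{ν-n}`. -/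
def legendreKernelP (n : ℕ) (ν : ℂ) (y : ℝ) : ℂ :=
  legendreP (ν - n) n y / (Real.sqrt (1 - y ^ 2) : ℂ) ^ (ν - n)

/-- `Q^{ν-n}_n(y) / (√(y²-1))^{ν-n}`. -/
def legendreKernelQ (n : ℕ) (ν : ℂ) (y : ℝ) : ℂ :=
  legendreQ (ν - n) n y / (Real.sqrt (y ^ 2 - 1) : ℂ) ^ (ν - n)

/-- The explicit expression for the approximate fractional Legendre derivative. -/
def legendreFormula (n : ℕ) (δ : ℝ) (ν : ℂ) (f : ℝ → ℂ) (x : ℝ) : ℂ :=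
  ((2 ^ n / Real.sqrt Real.pi * Real.Gamma (n + 3 / 2) : ℝ) : ℂ) * (1 / (δ : ℂ) ^ ν) *
      (∫ y in Ioo (-1 : ℝ) 1, f (x - δ * y) * legendreKernelP n ν y)
    - (-1) ^ n * Complex.exp (-(Complex.I * Real.pi * ν)) *
      ((2 ^ (n + 1) / (Real.pi * Real.sqrt Real.pi) * Real.Gamma (n + 3 / 2) : ℝ) : ℂ) *
      Complex.sin (ν * Real.pi) * (1 / (δ : ℂ) ^ ν) *
      (∫ y in Ioi (1 : ℝ), f (x + δ * y) * legendreKernelQ n ν y)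

/-- `f` is bounded on every compact subset of `(a, ∞)`. -/
def LocallyBoundedOnIoi (f : ℝ → ℂ) (a : ℝ) : Prop :=
  ∀ K ⊆ Ioi a, IsCompact K → ∃ C : ℝ, ∀ t ∈ K, ‖f t‖ ≤ C

end

noncomputable section

/-! Put `b = n + α - 1/2` and `s = n - ν`. The weight times the polynomial, `R_n(u) = (1 -
u²)^(α-1/2) p_n(u)`, is by the Rodrigues formula a multiple of the `n`-th derivative of `(1 -
u²)^b`; this is `rodrigues b n`. Inserting the Weyl integral into the orthogonal derivative gives a
double integral of `R_n(u) f(x + δu + τ) τ_+^(s-1)`. A shear and a rescaling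
(`integral_rodrigues_weyl`) turn it into `δ^s ∫ f(x + δv) K(v) dv`, where `K(v) = ∫ R_n(u) (v -
u)_+^(s-1) du` is `rodriguesRiesz`.

The kernel `K` has three regimes. It vanishes for `v ≤ -1`. On `(-1, 1)` one expands `R_n` in powers
of `1 + u` and integrates termwise with beta integrals; the resulting hypergeometric series is the
Ferrers function `P` at `-v` (`integral_rodrigues_mul_cpow`). For `v > 1` one integrates by parts
`n` times, which leaves `(1-s)_n / (2^n n!)` times `∫ (1 - u²)^b (v - u)^(-ν-1) du`
(`integral_sub_cpow_mul_rodrigues`); expanding in `u/v` and using the even moments of the weight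
gives the series of `Q` in `v^(-2)` (`stieltjesPower_eq`, `gegenbauerKernelQ_eq`). The reflection
formula turns `(1-s)_n / Γ(s)` into the factor with `sin(νπ)` (`ascPochhammer_div_Gamma`). The
constant `k_n n! / h_n` comes from the same integration by parts (`gegenbauer_normalization`).

On the line `Re ν = n` both integrals are limits by dominated convergence: the hypergeometric
coefficients have a majorant uniform in `ν`, and the `Q` integral is handled as a double integral.
At `ν = n` itself the sine vanishes and the kernel `P` is `R_n` up to reflection and a constant. -/

/-! ### Symmetric Jacobi polynomials: coefficients, recursion, leading term. -/

/-- The coefficient of `((X - 1) / 2) ^ k` in `P_n^{(β,β)}`. -/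
def jacobiCoeff (n : ℕ) (β : ℝ) (k : ℕ) : ℝ :=
  (n.choose k : ℝ) / (n.factorial : ℝ) * (ascPochhammer ℝ k).eval (n + β + β + 1) *
    (ascPochhammer ℝ (n - k)).eval (β + k + 1)

lemma jacobiPoly_eq_sum (n : ℕ) (β : ℝ) :
    jacobiPoly n β β = ∑ k ∈ Finset.range (n + 1),
      Polynomial.C (jacobiCoeff n β k) *
        (Polynomial.C (1 / 2) * (Polynomial.X - 1)) ^ k := rfl

lemma ascPochhammer_eval_succ_left (k : ℕ) (z : ℝ) :
    (ascPochhammer ℝ (k + 1)).eval z = z * (ascPochhammer ℝ k).eval (z + 1) := by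
  rw [ascPochhammer_succ_left]; simp

lemma jacobiCoeff_rec_zero (j : ℕ) (β : ℝ) :
    (j + 1) * jacobiCoeff (j + 1) (β - 1) 0 = β * jacobiCoeff j β 0 := by
  have h : ((j + 1).factorial : ℝ) = (j + 1) * j.factorial := by
    push_cast [Nat.factorial_succ]; ring
  have h0 : (j.factorial : ℝ) ≠ 0 := by positivity
  have h1 : (j : ℝ) + 1 ≠ 0 := by positivity
  simp only [jacobiCoeff, Nat.choose_zero_right, h, ascPochhammer_zero, Polynomial.eval_one,
    Nat.sub_zero, ascPochhammer_eval_succ_left]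
  field_simp
  norm_num

lemma jacobiCoeff_rec_succ (j k : ℕ) (hk : k ≤ j) (β : ℝ) :
    (j + 1) * jacobiCoeff (j + 1) (β - 1) (k + 1) =
      (β + (k + 1)) * jacobiCoeff j β (k + 1) + (2 * β + k) * jacobiCoeff j β k := by
  have h : ((j + 1).factorial : ℝ) = (j + 1) * j.factorial := by
    push_cast [Nat.factorial_succ]; ring
  have h0 : (j.factorial : ℝ) ≠ 0 := by positivity
  have h1 : (j : ℝ) + 1 ≠ 0 := by positivity
  have hc : ((j + 1).choose (k + 1) : ℝ) = j.choose k + j.choose (k + 1) := by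
    rw [Nat.choose_succ_succ]; push_cast; ring
  have hc' : (j.choose (k + 1) : ℝ) * (k + 1) = j.choose k * (j - k) := by
    have := Nat.choose_succ_right_eq j k
    rw [← Nat.cast_sub hk]; exact_mod_cast this
  have e1 : (ascPochhammer ℝ (k + 1)).eval ((↑(j + 1) : ℝ) + (β - 1) + (β - 1) + 1) =
      (j + 2 * β) * (ascPochhammer ℝ k).eval (j + β + β + 1) := by
    rw [ascPochhammer_eval_succ_left]
    push_cast
    rw [show (j : ℝ) + 1 + (β - 1) + (β - 1) + 1 + 1 = j + β + β + 1 by ring]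
    ring
  have e2 : (ascPochhammer ℝ (k + 1)).eval ((j : ℝ) + β + β + 1) =
      (ascPochhammer ℝ k).eval (j + β + β + 1) * (j + β + β + 1 + k) :=
    ascPochhammer_succ_eval _ _
  -- The factor `β + k + 1` extends the Pochhammer symbol of length `j - k - 1` at its lower end.
  -- For `k = j` the truncated subtraction is harmless because `j.choose (j + 1) = 0`.
  have e3 : (β + (k + 1)) * jacobiCoeff j β (k + 1) =
      (j.choose (k + 1) : ℝ) / (j.factorial : ℝ) *
        (ascPochhammer ℝ (k + 1)).eval (j + β + β + 1) *
        (ascPochhammer ℝ (j - k)).eval (β + k + 1) := by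
    rcases hk.eq_or_lt with rfl | hlt
    · simp [jacobiCoeff]
    · obtain ⟨m, hm⟩ : ∃ m, j - k = m + 1 := ⟨j - k - 1, by omega⟩
      have hm' : j - (k + 1) = m := by omega
      rw [jacobiCoeff, hm, hm', ascPochhammer_eval_succ_left m]
      push_cast
      rw [show β + (↑k + 1) + 1 = β + k + 1 + 1 by ring]
      ring
  have e4 : j + 1 - (k + 1) = j - k := by omega
  rw [e3, jacobiCoeff, jacobiCoeff, e1, e2, e4, h, hc]
  push_cast
  rw [show β - 1 + ((k : ℝ) + 1) + 1 = β + k + 1 by ring]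
  field_simp
  linear_combination -((ascPochhammer ℝ k).eval (j + β + β + 1) *
    (ascPochhammer ℝ (j - k)).eval (β + k + 1)) * hc'

/-- The lowering-type recursion behind the Rodrigues formula. -/
lemma jacobiPoly_succ (j : ℕ) (β : ℝ) :
    Polynomial.C (2 * ((j : ℝ) + 1)) * jacobiPoly (j + 1) (β - 1) (β - 1) =
      Polynomial.C (2 * β) * Polynomial.X * jacobiPoly j β β -
        (1 - Polynomial.X ^ 2) * Polynomial.derivative (jacobiPoly j β β) := by
  set Y : Polynomial ℝ := Polynomial.C (1 / 2) * (Polynomial.X - 1) with hY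
  have hX : (Polynomial.X : Polynomial ℝ) = 1 + 2 * Y := by
    have : (2 : Polynomial ℝ) * Polynomial.C (1 / 2) = 1 := by
      rw [show (2 : Polynomial ℝ) = Polynomial.C 2 from rfl, ← Polynomial.C_mul]; norm_num
    rw [hY, ← mul_assoc, this]; ring
  have hdY : Polynomial.derivative Y = Polynomial.C (1 / 2) := by simp [hY]
  have hC2 : (4 : Polynomial ℝ) * Polynomial.C (1 / 2) = 2 := by
    rw [show (4 : Polynomial ℝ) = Polynomial.C 4 from rfl, ← Polynomial.C_mul]; norm_num; rfl
  -- In the variable `Y = (X - 1)/2` one has `X = 1 + 2Y` and `1 - X² = -4Y(1 + Y)`, so the operator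
  -- sends `Y^k` to a combination of `Y^k` and `Y^(k+1)` only. The recursion then reduces to
  -- comparing coefficients.
  have hterm : ∀ k : ℕ, ∀ a : ℝ, Polynomial.C (2 * β) * Polynomial.X * (Polynomial.C a * Y ^ k) -
      (1 - Polynomial.X ^ 2) * Polynomial.derivative (Polynomial.C a * Y ^ k) =
      Polynomial.C (2 * ((β + k) * a)) * Y ^ k +
        Polynomial.C (2 * ((2 * β + k) * a)) * Y ^ (k + 1) := by
    intro k a
    have : (1 - (Polynomial.X : Polynomial ℝ) ^ 2) = -(4 * Y * (1 + Y)) := by rw [hX]; ring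
    rw [this, Polynomial.derivative_C_mul, Polynomial.derivative_pow, hdY]
    rcases k with _ | k
    · simp only [Nat.cast_zero, Polynomial.C_0, pow_zero, map_mul, map_add, hX]
      simp only [map_ofNat]; ring
    · simp only [Nat.add_sub_cancel, map_mul, map_add, hX, map_natCast, map_ofNat]
      linear_combination (Polynomial.C a * (↑(k + 1) : Polynomial ℝ) * Y ^ (k + 1) * (1 + Y)) * hC2
  rw [jacobiPoly_eq_sum, jacobiPoly_eq_sum, Polynomial.derivative_sum, Finset.mul_sum,
    Finset.mul_sum, Finset.mul_sum, ← Finset.sum_sub_distrib]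
  simp_rw [← hY, hterm]
  rw [Finset.sum_add_distrib, Finset.sum_range_succ' _ (j + 1)]
  -- The added term `k = j + 1` is zero because `j.choose (j + 1) = 0`.
  have hlast : ∑ k ∈ Finset.range (j + 1), Polynomial.C (2 * ((β + k) * jacobiCoeff j β k)) * Y ^ k
      = ∑ k ∈ Finset.range (j + 1 + 1),
        Polynomial.C (2 * ((β + k) * jacobiCoeff j β k)) * Y ^ k := by
    rw [Finset.sum_range_succ _ (j + 1)]
    simp [jacobiCoeff]
  rw [hlast, Finset.sum_range_succ' _ (j + 1), add_right_comm, ← Finset.sum_add_distrib]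
  congr 1
  · refine Finset.sum_congr rfl fun k hk => ?_
    have := jacobiCoeff_rec_succ j k (by simpa [Nat.lt_succ_iff] using hk) β
    rw [← mul_assoc, ← Polynomial.C_mul, ← add_mul, ← Polynomial.C_add]
    congr 2
    push_cast
    linear_combination 2 * this
  · have := jacobiCoeff_rec_zero j β
    rw [← mul_assoc, ← Polynomial.C_mul]
    congr 2
    push_cast
    linear_combination 2 * this

/-- The Jacobi polynomial has degree at most `n`. -/
lemma natDegree_jacobiPoly_le (n : ℕ) (β : ℝ) : (jacobiPoly n β β).natDegree ≤ n := by
  rw [jacobiPoly_eq_sum]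
  refine Polynomial.natDegree_sum_le_of_forall_le _ _ fun k hk => ?_
  have hk' : k ≤ n := by simpa [Nat.lt_succ_iff] using hk
  refine (Polynomial.natDegree_C_mul_le _ _).trans ((Polynomial.natDegree_pow_le).trans ?_)
  calc k * _ ≤ k * 1 := by
        gcongr
        refine (Polynomial.natDegree_C_mul_le _ _).trans ?_
        exact (Polynomial.natDegree_X_sub_C (1 : ℝ)).le
    _ ≤ n := by omega

lemma coeff_jacobiPoly_self (n : ℕ) (β : ℝ) :
    (jacobiPoly n β β).coeff n = jacobiCoeff n β n * (1 / 2) ^ n := by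
  rw [jacobiPoly_eq_sum, Polynomial.finsetSum_coeff, Finset.sum_range_succ,
    Finset.sum_eq_zero, zero_add]
  · rw [Polynomial.coeff_C_mul, mul_pow, ← Polynomial.C_pow, Polynomial.coeff_C_mul]
    have : ((Polynomial.X - 1 : Polynomial ℝ) ^ n).coeff n = 1 := by
      have h := (Polynomial.monic_X_sub_C (1 : ℝ)).pow n
      have h2 : ((Polynomial.X - Polynomial.C (1 : ℝ)) ^ n).natDegree = n := by
        rw [Polynomial.natDegree_pow, Polynomial.natDegree_X_sub_C, mul_one]
      have h3 := h.coeff_natDegree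
      rw [h2] at h3
      simpa using h3
    rw [this, mul_one]
  · intro k hk
    have hk' : k < n := by simpa using hk
    rw [Polynomial.coeff_C_mul, Polynomial.coeff_eq_zero_of_natDegree_lt, mul_zero]
    refine (Polynomial.natDegree_pow_le).trans_lt ?_
    calc k * _ ≤ k * 1 := by
          gcongr
          refine (Polynomial.natDegree_C_mul_le _ _).trans ?_
          exact (Polynomial.natDegree_X_sub_C (1 : ℝ)).le
      _ < n := by omega

/-- Since `n + 2β + 1 > n - 1 ≥ 0`, all factors of the Pochhammer symbol are positive. -/
lemma coeff_jacobiPoly_self_ne_zero {n : ℕ} (hn : 1 ≤ n) {β : ℝ} (hβ : -1 < β) :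
    (jacobiPoly n β β).coeff n ≠ 0 := by
  rw [coeff_jacobiPoly_self, jacobiCoeff]
  have hn' : (1 : ℝ) ≤ n := by exact_mod_cast hn
  have := ascPochhammer_pos n ((n : ℝ) + β + β + 1) (by linarith)
  have h0 : (n.factorial : ℝ) ≠ 0 := by positivity
  simp [this.ne', h0]

/-! ### Rodrigues functions: differentiation and integration by parts. -/

/-- The weighted Jacobi polynomial `(1 - u²)^(b-j) P_j^{(b-j,b-j)}(u)`. By the Rodrigues formula,
`(-2)^j j!` times it is the `j`-th derivative of `(1 - u²)^b`. -/
def rodrigues (b : ℝ) (j : ℕ) (u : ℝ) : ℝ :=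
  (1 - u) ^ (b - j) * (1 + u) ^ (b - j) * (jacobiPoly j (b - j) (b - j)).eval u

lemma jacobiPoly_zero (β : ℝ) : jacobiPoly 0 β β = 1 := by
  simp [jacobiPoly]

lemma rodrigues_zero (b u : ℝ) : rodrigues b 0 u = (1 - u) ^ b * (1 + u) ^ b := by
  simp [rodrigues, jacobiPoly_zero]

lemma jacobiPoly_succ_eval (j : ℕ) (β u : ℝ) :
    2 * ((j : ℝ) + 1) * (jacobiPoly (j + 1) (β - 1) (β - 1)).eval u =
      2 * β * u * (jacobiPoly j β β).eval u -
        (1 - u ^ 2) * (Polynomial.derivative (jacobiPoly j β β)).eval u := by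
  have := congrArg (Polynomial.eval u) (jacobiPoly_succ j β)
  simpa using this

lemma jacobiPoly_one_eval (β u : ℝ) : (jacobiPoly 1 β β).eval u = (β + 1) * u := by
  have := jacobiPoly_succ_eval 0 (β + 1) u
  simp only [jacobiPoly_zero, add_sub_cancel_right] at this
  norm_num at this
  linarith

/-- The derivative form of the Rodrigues formula. -/
lemma hasDerivAt_rodrigues (b : ℝ) (j : ℕ) {u : ℝ} (hu : u ∈ Ioo (-1 : ℝ) 1) :
    HasDerivAt (rodrigues b j) (-(2 * (j + 1)) * rodrigues b (j + 1) u) u := by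
  have h1 : 0 < 1 - u := by linarith [hu.2]
  have h2 : 0 < 1 + u := by linarith [hu.1]
  have d1 : HasDerivAt (fun u : ℝ => (1 - u) ^ (b - j))
      ((-1) * (b - j) * (1 - u) ^ (b - j - 1)) u :=
    ((hasDerivAt_id u).const_sub 1).rpow_const (Or.inl h1.ne')
  have d2 : HasDerivAt (fun u : ℝ => (1 + u) ^ (b - j)) (1 * (b - j) * (1 + u) ^ (b - j - 1)) u :=
    ((hasDerivAt_id u).const_add 1).rpow_const (Or.inl h2.ne')
  refine ((d1.mul d2).mul ((jacobiPoly j (b - j) (b - j)).hasDerivAt u)).congr_deriv ?_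
  have e1 : (1 - u) ^ (b - j) = (1 - u) ^ (b - j - 1) * (1 - u) := by
    rw [← Real.rpow_add_one h1.ne']; ring_nf
  have e2 : (1 + u) ^ (b - j) = (1 + u) ^ (b - j - 1) * (1 + u) := by
    rw [← Real.rpow_add_one h2.ne']; ring_nf
  have e3 : b - ((j + 1 : ℕ) : ℝ) = b - j - 1 := by push_cast; ring
  have e4 := jacobiPoly_succ_eval j (b - j) u
  simp only [Pi.mul_apply]
  rw [rodrigues, e3, e1, e2]
  linear_combination (1 - u) ^ (b - j - 1) * (1 + u) ^ (b - j - 1) * e4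

/-- The Jacobi weight is integrable. -/
lemma intervalIntegrable_jacobi_weight {c d : ℝ} (hc : -1 < c) (hd : -1 < d) :
    IntervalIntegrable (fun u : ℝ => (1 - u) ^ c * (1 + u) ^ d) volume (-1) 1 := by
  have h1 : IntervalIntegrable (fun u : ℝ => (1 + u) ^ d) volume (-1) 0 := by
    have := (intervalIntegral.intervalIntegrable_rpow' (a := 0) (b := 1) hd).comp_add_left 1
    norm_num at this
    exact this
  have h2 : IntervalIntegrable (fun u : ℝ => (1 - u) ^ c) volume 0 1 := by
    have := ((intervalIntegral.intervalIntegrable_rpow' (a := 0) (b := 1) hc).comp_sub_left 1).symm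
    norm_num at this
    exact this
  -- After splitting at `0`, each half contains only one singular endpoint and the other factor is
  -- continuous there.
  refine IntervalIntegrable.trans (b := 0) (h1.continuousOn_mul ?_) (h2.mul_continuousOn ?_)
  · rw [uIcc_of_le (by norm_num)]
    intro u hu
    exact (ContinuousAt.rpow_const (by fun_prop) (Or.inl (by linarith [hu.2]))).continuousWithinAt
  · rw [uIcc_of_le (by norm_num)]
    intro u hu
    exact (ContinuousAt.rpow_const (by fun_prop) (Or.inl (by linarith [hu.1]))).continuousWithinAt

lemma intervalIntegrable_rodrigues {b : ℝ} {j : ℕ} (h : j - 1 < b) :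
    IntervalIntegrable (rodrigues b j) volume (-1) 1 :=
  (intervalIntegrable_jacobi_weight (c := b - j) (d := b - j) (by linarith)
    (by linarith)).mul_continuousOn (Polynomial.continuous _).continuousOn

lemma intervalIntegrable_ofReal_rodrigues {b : ℝ} {j : ℕ} (h : j - 1 < b) :
    IntervalIntegrable (fun u => (rodrigues b j u : ℂ)) volume (-1) 1 :=
  ⟨(intervalIntegrable_rodrigues h).1.ofReal, (intervalIntegrable_rodrigues h).2.ofReal⟩

lemma intervalIntegrable_mul_rodrigues {b : ℝ} {j : ℕ} (h : j - 1 < b) {g : ℝ → ℂ}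
    (hg : ContinuousOn g (Icc (-1) 1)) :
    IntervalIntegrable (fun u => g u * (rodrigues b j u : ℂ)) volume (-1) 1 := by
  refine (intervalIntegrable_ofReal_rodrigues h).continuousOn_mul ?_
  rwa [uIcc_of_le (by norm_num)]

lemma continuous_rodrigues {b : ℝ} {j : ℕ} (h : j ≤ b) : Continuous (rodrigues b j) := by
  unfold rodrigues
  have : ∀ x : ℝ, x ≠ 0 ∨ 0 ≤ b - j := fun x => Or.inr (by linarith)
  refine Continuous.mul (Continuous.mul ?_ ?_) (Polynomial.continuous _)
  · exact Continuous.rpow_const (by fun_prop) fun x => Or.inr (by linarith)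
  · exact Continuous.rpow_const (by fun_prop) fun x => Or.inr (by linarith)

/-- Integration by parts against the Rodrigues functions. -/
lemma integral_mul_rodrigues_succ {b : ℝ} {j : ℕ} (h : j < b) {g g' : ℝ → ℂ}
    (hg : ContinuousOn g (Icc (-1) 1)) (hg' : ContinuousOn g' (Icc (-1) 1))
    (hd : ∀ u ∈ Ioo (-1 : ℝ) 1, HasDerivAt g (g' u) u) :
    ∫ u in (-1 : ℝ)..1, g u * (rodrigues b (j + 1) u : ℂ) =
      1 / (2 * (j + 1)) * ∫ u in (-1 : ℝ)..1, g' u * (rodrigues b j u : ℂ) := by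
  have hle : (-1 : ℝ) ≤ 1 := by norm_num
  have hj : ((j + 1 : ℕ) : ℝ) - 1 < b := by push_cast; linarith
  have hint := intervalIntegrable_ofReal_rodrigues hj
  have key := intervalIntegral.integral_mul_deriv_eq_deriv_mul_of_hasDerivAt
    (a := (-1 : ℝ)) (b := 1) (u := g) (u' := g')
    (v := fun u => (rodrigues b j u : ℂ))
    (v' := fun u => ((-(2 * (j + 1)) : ℝ) : ℂ) * (rodrigues b (j + 1) u : ℂ))
    (by rwa [uIcc_of_le hle])
    (Complex.continuous_ofReal.comp (continuous_rodrigues h.le)).continuousOn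
    (by simpa [min_eq_left hle, max_eq_right hle] using fun u h1 h2 => hd u ⟨h1, h2⟩)
    (by
      intro u hu
      rw [min_eq_left hle, max_eq_right hle] at hu
      have := (hasDerivAt_rodrigues b j hu).ofReal_comp
      rwa [Complex.ofReal_mul] at this)
    (by
      refine ContinuousOn.intervalIntegrable ?_
      rwa [uIcc_of_le hle])
    (hint.const_mul _)
  -- As `j < b`, the Rodrigues function of index `j` vanishes at both endpoints, so there are no
  -- boundary terms. The function of index `j + 1` may be singular there, but is integrable.
  have hz : b - j ≠ 0 := by linarith
  have z1 : rodrigues b j 1 = 0 := by simp [rodrigues, Real.zero_rpow hz]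
  have z2 : rodrigues b j (-1) = 0 := by simp [rodrigues, Real.zero_rpow hz]
  simp only [z1, z2, Complex.ofReal_zero, mul_zero, sub_self, zero_sub] at key
  have hne : (2 * ((j : ℂ) + 1)) ≠ 0 := by
    have : ((j : ℂ) + 1) ≠ 0 := by exact_mod_cast Nat.succ_ne_zero j
    simpa using this
  have e : ∫ u in (-1 : ℝ)..1, g u * (((-(2 * (j + 1)) : ℝ) : ℂ) * (rodrigues b (j + 1) u : ℂ)) =
      -(2 * (j + 1)) * ∫ u in (-1 : ℝ)..1, g u * (rodrigues b (j + 1) u : ℂ) := by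
    rw [← intervalIntegral.integral_const_mul]
    congr 1; ext u; push_cast; ring
  rw [e] at key
  field_simp
  linear_combination -key

lemma integral_mul_rodrigues (j : ℕ) : ∀ {b : ℝ} (g : ℕ → ℝ → ℂ), (j : ℝ) - 1 < b →
    (∀ i ≤ j, ContinuousOn (g i) (Icc (-1) 1)) →
    (∀ i < j, ∀ u ∈ Ioo (-1 : ℝ) 1, HasDerivAt (g i) (g (i + 1) u) u) →
    ∫ u in (-1 : ℝ)..1, g 0 u * (rodrigues b j u : ℂ) =
      1 / (2 ^ j * j.factorial) * ∫ u in (-1 : ℝ)..1, g j u * (rodrigues b 0 u : ℂ) := by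
  induction j with
  | zero => intro b g _ _ _; simp
  | succ j ih =>
    intro b g hb hc hd
    rw [integral_mul_rodrigues_succ (by push_cast at hb; linarith) (hc 0 (by omega))
      (hc 1 (by omega)) (hd 0 (by omega)),
      ih (fun i => g (i + 1)) (by push_cast at hb; linarith) (fun i hi => hc (i + 1) (by omega))
      (fun i hi => hd (i + 1) (by omega)), ← mul_assoc, Nat.factorial_succ]
    congr 1
    have : (j.factorial : ℂ) ≠ 0 := by exact_mod_cast j.factorial_ne_zero
    have : ((j : ℂ) + 1) ≠ 0 := by exact_mod_cast Nat.succ_ne_zero j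
    push_cast
    field_simp
    ring

/-! ### Moments of the weight `(1 - u²)^b`. -/

/-- `∫ (1 - u²)^b du = √π Γ(b+1) / Γ(b+3/2)`. -/
lemma integral_jacobi_weight {b : ℝ} (hb : -1 < b) :
    ∫ u in (-1 : ℝ)..1, (1 - u) ^ b * (1 + u) ^ b =
      Real.sqrt Real.pi * Real.Gamma (b + 1) / Real.Gamma (b + 3 / 2) := by
  have h := Complex.betaIntegral_scaled ((b : ℂ) + 1) (b + 1) (a := 2) (by norm_num)
  rw [Complex.betaIntegral_eq_Gamma_mul_div _ _ (by simpa using by linarith)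
    (by simpa using by linarith)] at h
  have e : ∫ x in (0 : ℝ)..2, (x : ℂ) ^ ((b : ℂ) + 1 - 1) * (((2 : ℝ) : ℂ) - x) ^ ((b : ℂ) + 1 - 1)
      = ((∫ u in (-1 : ℝ)..1, (1 - u) ^ b * (1 + u) ^ b : ℝ) : ℂ) := by
    rw [← intervalIntegral.integral_ofReal]
    have := intervalIntegral.integral_comp_add_left (a := -1) (b := 1)
      (fun x : ℝ => (x : ℂ) ^ ((b : ℂ) + 1 - 1) * (((2 : ℝ) : ℂ) - x) ^ ((b : ℂ) + 1 - 1)) 1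
    norm_num at this
    norm_num
    rw [← this]
    refine intervalIntegral.integral_congr fun u hu => ?_
    rw [uIcc_of_le (by norm_num)] at hu
    rw [show (2 : ℂ) - (1 + u) = ((1 - u : ℝ) : ℂ) by push_cast; ring,
      show (1 : ℂ) + u = ((1 + u : ℝ) : ℂ) by push_cast; ring,
      ← Complex.ofReal_cpow (by linarith [hu.1]), ← Complex.ofReal_cpow (by linarith [hu.2])]
    ring
  rw [e] at h
  have h2 : ∫ u in (-1 : ℝ)..1, (1 - u) ^ b * (1 + u) ^ b =
      2 ^ (2 * b + 1) * (Real.Gamma (b + 1) * Real.Gamma (b + 1) / Real.Gamma (2 * b + 2)) := by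
    apply Complex.ofReal_injective
    rw [h]
    push_cast
    rw [← Complex.Gamma_ofReal, ← Complex.Gamma_ofReal, Complex.ofReal_cpow (by norm_num)]
    push_cast
    rw [show (b : ℂ) + 1 + (b + 1) = 2 * b + 2 by ring,
      show (2 * (b : ℂ) + 2 - 1) = 2 * b + 1 by ring]
  -- The duplication formula at `b + 1` converts the beta value `Γ(b+1)² / Γ(2b+2)` into `Γ(b+1) /
  -- Γ(b+3/2)`, up to `√π` and a power of `2`.
  have hd := Real.Gamma_mul_Gamma_add_half (b + 1)
  have g1 : Real.Gamma (b + 1) ≠ 0 := (Real.Gamma_pos_of_pos (by linarith)).ne'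
  have g2 : Real.Gamma (b + 3 / 2) ≠ 0 := (Real.Gamma_pos_of_pos (by linarith)).ne'
  have g3 : Real.Gamma (2 * b + 2) ≠ 0 := (Real.Gamma_pos_of_pos (by linarith)).ne'
  rw [show b + 1 + 1 / 2 = b + 3 / 2 by ring, show 2 * (b + 1) = 2 * b + 2 by ring] at hd
  have h4 : (2 : ℝ) ^ (2 * b + 1) * 2 ^ (1 - (2 * b + 2)) = 1 := by
    rw [← Real.rpow_add (by norm_num)]; ring_nf; simp
  rw [h2]
  generalize Real.Gamma (b + 1) = G1 at *
  generalize Real.Gamma (b + 3 / 2) = G2 at *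
  generalize Real.Gamma (2 * b + 2) = G3 at *
  rw [← mul_div_assoc, div_eq_div_iff g3 g2]
  linear_combination (2 ^ (2 * b + 1)) * G1 * hd + G1 * G3 * √Real.pi * h4

lemma integral_pow_odd_mul_weight (b : ℝ) (m : ℕ) :
    ∫ u in (-1 : ℝ)..1, (u : ℂ) ^ (2 * m + 1) * (rodrigues b 0 u : ℂ) = 0 := by
  have h := intervalIntegral.integral_comp_neg (a := -1) (b := 1)
    (fun u : ℝ => (u : ℂ) ^ (2 * m + 1) * (rodrigues b 0 u : ℂ))
  have e : ∀ u : ℝ, ((-u : ℝ) : ℂ) ^ (2 * m + 1) * (rodrigues b 0 (-u) : ℂ) =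
      -((u : ℂ) ^ (2 * m + 1) * (rodrigues b 0 u : ℂ)) := by
    intro u
    rw [rodrigues_zero, rodrigues_zero, Complex.ofReal_neg, Odd.neg_pow ⟨m, rfl⟩]
    simp only [sub_neg_eq_add, ← sub_eq_add_neg]
    push_cast; ring
  simp only [e, intervalIntegral.integral_neg, neg_neg] at h
  exact self_eq_neg.mp h.symm

/-- The Rodrigues function of index `1` for the exponent `b + 1` is `(b + 1) u (1 - u²)^b`. One
integration by parts against `u^(m+1)`, followed by `(1 - u²)^(b+1) = (1 - u²)^b (1 - u²)`, links
two moments of equal parity. -/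
lemma integral_pow_add_two_mul_weight {b : ℝ} (hb : -1 < b) (m : ℕ) :
    (2 * b + m + 3) * ∫ u in (-1 : ℝ)..1, (u : ℂ) ^ (m + 2) * (rodrigues b 0 u : ℂ) =
      (m + 1) * ∫ u in (-1 : ℝ)..1, (u : ℂ) ^ m * (rodrigues b 0 u : ℂ) := by
  have h := integral_mul_rodrigues_succ (b := b + 1) (j := 0) (by simpa using by linarith)
    (g := fun u : ℝ => (u : ℂ) ^ (m + 1)) (g' := fun u : ℝ => (m + 1) * (u : ℂ) ^ m)
    (by fun_prop) (by fun_prop)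
    (fun u _ => by
      have h1 : HasDerivAt (fun v : ℝ => (v : ℂ)) 1 u := Complex.ofRealCLM.hasDerivAt
      simpa using h1.fun_pow (m + 1))
  have i1 := intervalIntegrable_mul_rodrigues (b := b) (j := 0) (by simpa using hb)
    (g := fun u : ℝ => (u : ℂ) ^ m) (by fun_prop)
  have i2 := intervalIntegrable_mul_rodrigues (b := b) (j := 0) (by simpa using hb)
    (g := fun u : ℝ => (u : ℂ) ^ (m + 2)) (by fun_prop)
  have e1 : ∀ u : ℝ, (u : ℂ) ^ (m + 1) * (rodrigues (b + 1) (0 + 1) u : ℂ) =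
      (b + 1) * ((u : ℂ) ^ (m + 2) * (rodrigues b 0 u : ℂ)) := by
    intro u
    rw [rodrigues_zero, rodrigues]
    simp only [zero_add, Nat.cast_one, add_sub_cancel_right, jacobiPoly_one_eval]
    push_cast; ring
  have e2 : ∫ u in (-1 : ℝ)..1, ((m + 1) * (u : ℂ) ^ m) * (rodrigues (b + 1) 0 u : ℂ) =
      (m + 1) * ((∫ u in (-1 : ℝ)..1, (u : ℂ) ^ m * (rodrigues b 0 u : ℂ)) -
        ∫ u in (-1 : ℝ)..1, (u : ℂ) ^ (m + 2) * (rodrigues b 0 u : ℂ)) := by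
    rw [← intervalIntegral.integral_sub i1 i2, ← intervalIntegral.integral_const_mul]
    refine intervalIntegral.integral_congr fun u hu => ?_
    rw [uIcc_of_le (by norm_num)] at hu
    simp only [rodrigues_zero]
    -- At the endpoint the identity survives even when `b < 0`: the left side is `0` because `b + 1
    -- > 0`, the right side because of the factor `1 - u`.
    have h1 : (1 - u) ^ (b + 1) = (1 - u) ^ b * (1 - u) := by
      rcases (by linarith [hu.2] : 0 ≤ 1 - u).eq_or_lt with h | h
      · rw [← h, Real.zero_rpow (by linarith)]; ring
      · exact Real.rpow_add_one h.ne' _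
    have h2 : (1 + u) ^ (b + 1) = (1 + u) ^ b * (1 + u) := by
      rcases (by linarith [hu.1] : 0 ≤ 1 + u).eq_or_lt with h | h
      · rw [← h, Real.zero_rpow (by linarith)]; ring
      · exact Real.rpow_add_one h.ne' _
    rw [h1, h2]
    push_cast; ring
  simp only [e1, e2, intervalIntegral.integral_const_mul] at h
  norm_num at h
  linear_combination 2 * h

/-- The even moments of the weight `(1 - u²)^b`. -/
lemma integral_pow_even_mul_weight {b : ℝ} (hb : -1 < b) (m : ℕ) :
    ∫ u in (-1 : ℝ)..1, (u : ℂ) ^ (2 * m) * (rodrigues b 0 u : ℂ) =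
      (2 * m).factorial / (4 ^ m * m.factorial) / (ascPochhammer ℂ m).eval ((b : ℂ) + 3 / 2) *
        ∫ u in (-1 : ℝ)..1, (rodrigues b 0 u : ℂ) := by
  induction m with
  | zero => simp
  | succ m ih =>
    have h := integral_pow_add_two_mul_weight hb (2 * m)
    rw [ih] at h
    have hne : (2 * (b : ℂ) + (2 * m : ℕ) + 3) ≠ 0 := by
      have : (2 * b + (2 * m : ℕ) + 3 : ℝ) ≠ 0 := by
        have : (0 : ℝ) ≤ (2 * m : ℕ) := by positivity
        linarith
      exact_mod_cast this
    have hp : (ascPochhammer ℂ (m + 1)).eval ((b : ℂ) + 3 / 2) =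
        (ascPochhammer ℂ m).eval ((b : ℂ) + 3 / 2) * ((b : ℂ) + 3 / 2 + m) :=
      ascPochhammer_succ_eval _ _
    have hne2 : ((b : ℂ) + 3 / 2 + m) ≠ 0 := by
      intro h0; apply hne; push_cast; linear_combination 2 * h0
    have hne3 : (ascPochhammer ℂ m).eval ((b : ℂ) + 3 / 2) ≠ 0 := by
      have := ascPochhammer_pos m (b + 3 / 2) (by linarith)
      have h3 : (ascPochhammer ℂ m).eval ((b : ℂ) + 3 / 2) =
          (((ascPochhammer ℝ m).eval (b + 3 / 2) : ℝ) : ℂ) := by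
        rw [← ascPochhammer_map Complex.ofRealHom]
        have := Polynomial.eval_map_apply (f := Complex.ofRealHom) (p := ascPochhammer ℝ m)
          (x := b + 3 / 2)
        simpa using this
      rw [h3]; exact_mod_cast this.ne'
    have hf : ((2 * (m + 1)).factorial : ℂ) = (2 * m + 2) * (2 * m + 1) * (2 * m).factorial := by
      rw [show 2 * (m + 1) = 2 * m + 1 + 1 by ring, Nat.factorial_succ, Nat.factorial_succ]
      push_cast; ring
    have hf2 : ((m + 1).factorial : ℂ) = (m + 1) * m.factorial := by
      rw [Nat.factorial_succ]; push_cast; ring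
    have hm1 : ((m : ℂ) + 1) ≠ 0 := by exact_mod_cast Nat.succ_ne_zero m
    have hm2 : (m.factorial : ℂ) ≠ 0 := by exact_mod_cast m.factorial_ne_zero
    rw [show 2 * (m + 1) = 2 * m + 2 by ring] at hf ⊢
    apply mul_left_cancel₀ hne
    rw [h, hp, hf, hf2]
    push_cast
    have hne2' : (2 * (b : ℂ) + 3 + 2 * m) ≠ 0 := by
      intro h0; apply hne; push_cast; linear_combination h0
    field_simp
    ring

/-! ### Expansion of the Rodrigues functions in powers of `1 + u`. -/

/-- A power series may be differentiated termwise. -/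
lemma hasDerivAt_of_hasSum_pow {a : ℕ → ℝ} {A : ℝ → ℝ} {r : ℝ}
    (h : ∀ t, |t| < r → HasSum (fun k => a k * t ^ k) (A t)) {t : ℝ} (ht : |t| < r) :
    ∃ A', HasDerivAt A A' t ∧ HasSum (fun k : ℕ => k * a k * t ^ k) (t * A') := by
  -- Two intermediate radii: the terms are bounded at `ρ'`, hence on the ball of radius `ρ` the
  -- differentiated terms are dominated by a multiple of `k (ρ/ρ')^k`.
  obtain ⟨ρ, hρ, hρr⟩ := exists_between ht
  obtain ⟨ρ', hρ', hρr'⟩ := exists_between hρr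
  have hρ0 : 0 < ρ := (abs_nonneg t).trans_lt hρ
  have hρ0' : 0 < ρ' := hρ0.trans hρ'
  obtain ⟨C, hC⟩ : ∃ C, ∀ k, |a k * ρ' ^ k| ≤ C := by
    have hs := (h ρ' (by rwa [abs_of_pos hρ0'])).summable.tendsto_atTop_zero
    have hb : BddAbove (range fun k => |a k * ρ' ^ k|) := hs.abs.bddAbove_range
    obtain ⟨C, hC⟩ := hb
    exact ⟨C, fun k => hC (mem_range_self k)⟩
  have hq : ‖ρ / ρ'‖ < 1 := by
    rw [Real.norm_eq_abs, abs_of_pos (by positivity), div_lt_one hρ0']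
    exact hρ'
  have hu : Summable fun k : ℕ => (C / ρ) * ((k : ℝ) ^ 1 * (ρ / ρ') ^ k) :=
    Summable.mul_left _ (summable_pow_mul_geometric_of_norm_lt_one 1 hq)
  have hb : ∀ (k : ℕ) (y : ℝ), y ∈ Metric.ball (0 : ℝ) ρ →
      ‖a k * (k * y ^ (k - 1))‖ ≤ (C / ρ) * ((k : ℝ) ^ 1 * (ρ / ρ') ^ k) := by
    intro k y hy
    rw [mem_ball_zero_iff, Real.norm_eq_abs] at hy
    rcases k with _ | k
    · simp
    · have h1 : |y| ^ k ≤ ρ ^ k := pow_le_pow_left₀ (abs_nonneg _) hy.le _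
      have h2 : |a (k + 1)| * ρ' ^ (k + 1) ≤ C := by
        have := hC (k + 1)
        rwa [abs_mul, abs_of_pos (pow_pos hρ0' _)] at this
      rw [Nat.add_sub_cancel, Real.norm_eq_abs, abs_mul, abs_mul, abs_pow, Nat.abs_cast]
      calc |a (k + 1)| * (((k + 1 : ℕ) : ℝ) * |y| ^ k)
          ≤ |a (k + 1)| * (((k + 1 : ℕ) : ℝ) * ρ ^ k) := by gcongr
        _ = (|a (k + 1)| * ρ' ^ (k + 1)) / ρ * (((k + 1 : ℕ) : ℝ) ^ 1 * (ρ / ρ') ^ (k + 1)) := by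
            rw [div_pow]; field_simp; ring
        _ ≤ _ := by gcongr
  have htb : t ∈ Metric.ball (0 : ℝ) ρ := by rwa [mem_ball_zero_iff, Real.norm_eq_abs]
  have hder := hasDerivAt_tsum_of_isPreconnected (g := fun k y => a k * y ^ k)
    (g' := fun k y => a k * (k * y ^ (k - 1))) hu Metric.isOpen_ball
    (convex_ball (0 : ℝ) ρ).isPreconnected
    (fun k y _ => (hasDerivAt_pow k y).const_mul (a k)) hb htb (h t ht).summable htb
  refine ⟨_, hder.congr_of_eventuallyEq ?_, ?_⟩
  · filter_upwards [Metric.isOpen_ball.mem_nhds htb] with y hy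
    rw [mem_ball_zero_iff, Real.norm_eq_abs] at hy
    exact (h y (hy.trans hρr)).tsum_eq.symm
  · have hs : Summable fun k => a k * (k * t ^ (k - 1)) :=
      .of_norm_bounded hu fun k => hb k t htb
    refine (hs.hasSum.mul_left t).congr_fun fun k => ?_
    rcases k with _ | k
    · simp
    · rw [Nat.add_sub_cancel, pow_succ]; ring

lemma hasSum_one_sub_rpow (b : ℝ) {x : ℝ} (hx : |x| < 1) :
    HasSum (fun k : ℕ => (ascPochhammer ℝ k).eval (-b) / k.factorial * x ^ k) ((1 - x) ^ b) := by
  have h := (Real.one_div_one_sub_rpow_hasFPowerSeriesOnBall_zero (-b)).hasSum (y := x)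
    (by simpa [← ofReal_norm] using hx)
  have h1 : 0 < 1 - x := by linarith [(abs_lt.mp hx).2]
  simp only [zero_add, FormalMultilinearSeries.ofScalars_apply_eq, smul_eq_mul,
    Real.rpow_neg h1.le, one_div, inv_inv] at h
  refine h.congr_fun fun k => ?_
  congr 1
  rw [Ring.choose]
  have := Ring.factorial_nsmul_multichoose_eq_ascPochhammer (-b) k
  rw [Polynomial.ascPochhammer_smeval_eq_eval, nsmul_eq_mul] at this
  rw [div_eq_iff (by positivity), ← this, mul_comm]
  congr 2
  ring

/-- The coefficients of the expansion of the `j`-th derivative of `(1 - u²)^b` at `u = -1`. -/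
def rodriguesCoeff (b : ℝ) (j k : ℕ) : ℝ :=
  2 ^ b * ((ascPochhammer ℝ k).eval (-b) / k.factorial * (1 / 2) ^ k) *
    ∏ i ∈ Finset.range j, (b - i + k)

/-- With `A_j` the sum, `t^(b-j) A_j(t)` is the `j`-th derivative of `t^b (2 - t)^b`, so `A_(j+1) =
(b - j) A_j + t A_j'`. On `t^k` this operator is multiplication by `b - j + k`, which is the new
factor of the product in `rodriguesCoeff`. -/
lemma hasSum_rodriguesCoeff (b : ℝ) (j : ℕ) : ∀ t : ℝ, |t| < 2 →
    HasSum (fun k => rodriguesCoeff b j k * t ^ k)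
      ((-2) ^ j * j.factorial * ((2 - t) ^ (b - j) * (jacobiPoly j (b - j) (b - j)).eval (t - 1))) := by
  induction j with
  | zero =>
    intro t ht
    have h1 : |t / 2| < 1 := by rw [abs_div, abs_two]; linarith
    have h := (hasSum_one_sub_rpow b h1).mul_left (2 ^ b)
    have h2 : (2 : ℝ) ^ b * (1 - t / 2) ^ b = (2 - t) ^ b := by
      rw [← Real.mul_rpow (by norm_num) (by linarith [(abs_lt.mp h1).2])]; ring_nf
    rw [h2] at h
    simp only [pow_zero, Nat.factorial_zero, Nat.cast_one, mul_one, one_mul, Nat.cast_zero,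
      sub_zero, jacobiPoly_zero, Polynomial.eval_one]
    refine h.congr_fun fun k => ?_
    simp [rodriguesCoeff, div_eq_mul_inv, mul_pow]
    ring
  | succ j ih =>
    intro t ht
    obtain ⟨A', hA', hS⟩ := hasDerivAt_of_hasSum_pow ih ht
    have h1 : 0 < 2 - t := by linarith [(abs_lt.mp ht).2]
    have d1 : HasDerivAt (fun u : ℝ => (2 - u) ^ (b - j))
        ((-1) * (b - j) * (2 - t) ^ (b - j - 1)) t :=
      ((hasDerivAt_id t).const_sub 2).rpow_const (Or.inl h1.ne')
    have d2 : HasDerivAt (fun u : ℝ => (jacobiPoly j (b - j) (b - j)).eval (u - 1)) _ t :=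
      HasDerivAt.comp_sub_const t 1 ((jacobiPoly j (b - j) (b - j)).hasDerivAt (t - 1))
    have hA : A' = _ := hA'.unique ((d1.fun_mul d2).const_mul ((-2) ^ j * (j.factorial : ℝ)))
    have key := ((ih t ht).mul_left (b - j)).add hS
    have e1 : (2 - t) ^ (b - j) = (2 - t) ^ (b - j - 1) * (2 - t) := by
      rw [← Real.rpow_add_one h1.ne']; ring_nf
    have e3 : b - ((j + 1 : ℕ) : ℝ) = b - j - 1 := by push_cast; ring
    have e4 := jacobiPoly_succ_eval j (b - j) (t - 1)
    rw [e3]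
    have hval : (-2) ^ (j + 1) * ((j + 1).factorial : ℝ) * ((2 - t) ^ (b - j - 1) *
        (jacobiPoly (j + 1) (b - j - 1) (b - j - 1)).eval (t - 1)) =
        (b - j) * ((-2) ^ j * j.factorial *
          ((2 - t) ^ (b - j) * (jacobiPoly j (b - j) (b - j)).eval (t - 1))) + t * A' := by
      rw [hA, e1, Nat.factorial_succ]
      push_cast
      rw [pow_succ]
      linear_combination -((-2) ^ j * (j.factorial : ℝ) * (2 - t) ^ (b - j - 1)) * e4
    rw [hval]
    refine key.congr_fun fun k => ?_
    rw [rodriguesCoeff, rodriguesCoeff, Finset.prod_range_succ]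
    ring

lemma prod_mul_Gamma (z : ℝ) : ∀ j : ℕ, j - 1 < z →
    (∏ i ∈ Finset.range j, (z - i)) * Real.Gamma (z - j + 1) = Real.Gamma (z + 1)
  | 0, _ => by simp
  | j + 1, h => by
    push_cast at h
    have h1 : z - j ≠ 0 := by linarith
    rw [Finset.prod_range_succ, ← prod_mul_Gamma z j (by linarith), Real.Gamma_add_one h1]
    push_cast
    rw [show z - (j + 1) + 1 = z - j by ring]
    ring

/-- The Rodrigues formula as a generalized power series at `-1`. -/
lemma hasSum_rodrigues (b : ℝ) (j : ℕ) {t : ℝ} (ht0 : 0 < t) (ht : t < 2) :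
    HasSum (fun k => 1 / ((-2) ^ j * j.factorial) * (rodriguesCoeff b j k * t ^ (b - j + k)))
      (rodrigues b j (t - 1)) := by
  have h := ((hasSum_rodriguesCoeff b j t (by rwa [abs_of_pos ht0])).mul_left (t ^ (b - j))).mul_left
    (1 / ((-2) ^ j * (j.factorial : ℝ)))
  have h0 : (j.factorial : ℝ) ≠ 0 := by positivity
  have h2 : ((-2 : ℝ)) ^ j ≠ 0 := by positivity
  have hval : rodrigues b j (t - 1) = 1 / ((-2) ^ j * (j.factorial : ℝ)) * (t ^ (b - j) *
      ((-2) ^ j * j.factorial * ((2 - t) ^ (b - j) *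
        (jacobiPoly j (b - j) (b - j)).eval (t - 1)))) := by
    rw [rodrigues, show 1 - (t - 1) = 2 - t by ring, show 1 + (t - 1) = t by ring]
    generalize (2 - t) ^ (b - j) = X
    generalize t ^ (b - j) = Y
    field_simp
  rw [hval]
  refine h.congr_fun fun k => ?_
  rw [Real.rpow_add_natCast ht0.ne']
  ring

/-- The product in `rodriguesCoeff` is `Γ(b+k+1) / Γ(b-j+k+1)`. Its denominator cancels the gamma
factor produced by the beta integral of `t^(b-j+k)`, and what remains is the numerator of `F(b+1,
-b; ·; t/2)`. -/
lemma rodriguesCoeff_mul_Gamma {b : ℝ} {j : ℕ} (h : j - 1 < b) (k : ℕ) :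
    rodriguesCoeff b j k * Real.Gamma (b - j + k + 1) =
      2 ^ b * Real.Gamma (b + 1) * ((ascPochhammer ℝ k).eval (b + 1) *
        (ascPochhammer ℝ k).eval (-b) / k.factorial * (1 / 2) ^ k) := by
  have hk0 : (0 : ℝ) ≤ k := by positivity
  have h1 := prod_mul_Gamma (b + k) j (by linarith)
  have hp : ∏ i ∈ Finset.range j, (b + k - i) = ∏ i ∈ Finset.range j, (b - i + k) :=
    Finset.prod_congr rfl fun i _ => by ring
  by_cases hj : j = 0 ∧ b + 1 ≤ 0
  · obtain ⟨rfl, hb⟩ := hj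
    norm_num at h; linarith
  have hb : 0 < b + 1 := by
    rcases j with _ | j
    · norm_num at h; linarith
    · push_cast at h; have : (0 : ℝ) ≤ j := by positivity
      linarith
  have h2 : Real.Gamma (b + k + 1) = Real.Gamma (b + 1) * (ascPochhammer ℝ k).eval (b + 1) := by
    clear h1 hp hk0
    induction k with
    | zero => simp
    | succ k ih =>
      rw [ascPochhammer_succ_eval, ← mul_assoc, ← ih, mul_comm,
        show b + ((k + 1 : ℕ) : ℝ) + 1 = (b + k + 1) + 1 by push_cast; ring, Real.Gamma_add_one]
      · ring
      · have : (0 : ℝ) ≤ k := by positivity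
        linarith
  rw [rodriguesCoeff, show b - j + k + 1 = b + k - j + 1 by ring, ← hp, mul_assoc, h1, h2]
  ring

/-! ### The kernel on `(-1, 1)` as a fractional integral. -/

/-- The defining series of `F(a, b; c; z) / Γ(c)`. -/
lemma hasSum_regularizedGaussHGFun (a b c : ℂ) {z : ℂ} (hz : ‖z‖ < 1) :
    HasSum (fun k : ℕ => (ascPochhammer ℂ k).eval a * (ascPochhammer ℂ k).eval b /
      (k.factorial * Complex.Gamma (c + k)) * z ^ k) (Complex.regularizedGaussHGFun a b c z) := by
  have hz' : z ∈ Metric.eball (0 : ℂ) (Complex.regularizedGaussHGFunSeries a b c).radius := by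
    refine lt_of_lt_of_le ?_ (Complex.radius_regularizedGaussHGFunSeries_ge_one a b c)
    rw [edist_zero_right, ← ofReal_norm, ← ENNReal.ofReal_one]
    exact (ENNReal.ofReal_lt_ofReal_iff one_pos).mpr hz
  have h := FormalMultilinearSeries.hasSum _ hz'
  rw [Complex.regularizedGaussHGFun]
  refine h.congr_fun fun k => ?_
  rw [FormalMultilinearSeries.apply_eq_pow_smul_coeff,
    Complex.coeff_regularizedGaussHGFunSeries, smul_eq_mul, mul_comm]

lemma ofReal_ascPochhammer_eval (k : ℕ) (z : ℝ) :
    (((ascPochhammer ℝ k).eval z : ℝ) : ℂ) = (ascPochhammer ℂ k).eval (z : ℂ) := by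
  rw [← ascPochhammer_map Complex.ofRealHom]
  have := Polynomial.eval_map_apply (f := Complex.ofRealHom) (p := ascPochhammer ℝ k) (x := z)
  simpa using this.symm

/-- The kernel on `(-1, 1)` in terms of the hypergeometric function. -/
lemma gegenbauerKernelP_eq (n : ℕ) (α : ℝ) (ν : ℂ) {y : ℝ} (hy : y ∈ Ioo (-1 : ℝ) 1) :
    gegenbauerKernelP n α ν y = ((1 - y : ℝ) : ℂ) ^ ((n + α - 1 / 2 : ℝ) - ν) *
      Complex.regularizedGaussHGFun ((n + α - 1 / 2 : ℝ) + 1) (-(n + α - 1 / 2 : ℝ))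
        ((n + α - 1 / 2 : ℝ) + 1 - ν) (((1 - y) / 2 : ℝ) : ℂ) := by
  have h1 : 0 < 1 - y := by linarith [hy.2]
  have h2 : 0 < 1 + y := by linarith [hy.1]
  rw [gegenbauerKernelP, legendreP, mul_div_right_comm]
  have hμ : (1 / 2 - α - n + ν : ℂ) = -(((n + α - 1 / 2 : ℝ) : ℂ) - ν) := by push_cast; ring
  congr 1
  · rw [hμ]
    -- This `μ` is the negative of the order of the Legendre function. The powers of `1 + y` cancel
    -- and those of `1 - y` combine to `(1 - y)^μ`.
    set μ := (((n + α - 1 / 2 : ℝ) : ℂ) - ν)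
    have hs : (Real.sqrt (1 - y ^ 2) : ℂ) ^ (-μ) =
        ((1 - y : ℝ) : ℂ) ^ (-μ / 2) * ((1 + y : ℝ) : ℂ) ^ (-μ / 2) := by
      have hp : 0 < 1 - y ^ 2 := by nlinarith
      have hr := Real.sqrt_pos.mpr hp
      rw [← Complex.mul_cpow_ofReal_nonneg h1.le h2.le, ← Complex.ofReal_mul,
        show (1 - y) * (1 + y) = √(1 - y ^ 2) * √(1 - y ^ 2) by
          rw [Real.mul_self_sqrt hp.le]; ring,
        Complex.ofReal_mul, Complex.mul_cpow_ofReal_nonneg hr.le hr.le,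
        ← Complex.cpow_add _ _ (by exact_mod_cast hr.ne')]
      congr 1; ring
    have hd : (((1 + y) / (1 - y) : ℝ) : ℂ) ^ (-μ / 2) =
        ((1 + y : ℝ) : ℂ) ^ (-μ / 2) / ((1 - y : ℝ) : ℂ) ^ (-μ / 2) := by
      rw [Complex.ofReal_div, Complex.div_cpow_ofReal_nonneg h2.le h1.le]
    have n1 : ((1 - y : ℝ) : ℂ) ≠ 0 := by exact_mod_cast h1.ne'
    have n2 : ((1 + y : ℝ) : ℂ) ^ (-μ / 2) ≠ 0 := by
      rw [Complex.cpow_ne_zero_iff]; left; exact_mod_cast h2.ne'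
    have n3 : ((1 - y : ℝ) : ℂ) ^ (-μ / 2) ≠ 0 := by
      rw [Complex.cpow_ne_zero_iff]; left; exact n1
    rw [hs, hd]
    have : ((1 - y : ℝ) : ℂ) ^ μ * ((1 - y : ℝ) : ℂ) ^ (-μ / 2) * ((1 - y : ℝ) : ℂ) ^ (-μ / 2) = 1 := by
      rw [← Complex.cpow_add _ _ n1, ← Complex.cpow_add _ _ n1]
      ring_nf
      simp
    generalize ((1 - y : ℝ) : ℂ) ^ (-μ / 2) = X at *
    generalize ((1 + y : ℝ) : ℂ) ^ (-μ / 2) = Y at *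
    field_simp
    linear_combination -this
  · congr 1 <;> push_cast <;> ring

/-- On `[0, t/2]` only the first factor can be singular; the reflection `τ ↦ t - τ` exchanges the
two factors and covers the other half. -/
lemma intervalIntegrable_cpow_mul_sub_cpow {p q : ℂ} (hp : 0 < p.re) (hq : 0 < q.re) {t : ℝ}
    (ht : 0 < t) :
    IntervalIntegrable (fun τ : ℝ => (τ : ℂ) ^ (p - 1) * ((t : ℂ) - τ) ^ (q - 1)) volume 0 t := by
  have key : ∀ {p q : ℂ}, 0 < p.re → IntervalIntegrable
      (fun τ : ℝ => (τ : ℂ) ^ (p - 1) * ((t : ℂ) - τ) ^ (q - 1)) volume 0 (t / 2) := by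
    intro p q hp
    refine (intervalIntegral.intervalIntegrable_cpow' (by simpa using hp)).mul_continuousOn ?_
    rw [uIcc_of_le (by positivity)]
    intro τ hτ
    refine ContinuousAt.continuousWithinAt (ContinuousAt.cpow (by fun_prop) (by fun_prop) ?_)
    rw [← Complex.ofReal_sub]
    exact Complex.ofReal_mem_slitPlane.2 (by linarith [hτ.2])
  refine (key hp).trans ?_
  have h2 := ((key (q := p) hq).comp_sub_left t).symm
  rw [sub_zero, show t - t / 2 = t / 2 by ring] at h2
  refine h2.congr (fun τ _ => ?_)
  rw [mul_comm]
  push_cast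
  ring_nf

/-- The fractional integral from `-1` of the weighted Jacobi polynomial. -/
lemma integral_rodrigues_mul_cpow {n : ℕ} {α : ℝ} (hα : -1 / 2 < α) {s : ℂ} (hs : 0 < s.re)
    {v : ℝ} (hv : v ∈ Ioo (-1 : ℝ) 1) :
    ∫ u in (-1 : ℝ)..v, (rodrigues (n + α - 1 / 2) n u : ℂ) * ((v - u : ℝ) : ℂ) ^ (s - 1) =
      Complex.Gamma s * ((1 / ((-2) ^ n * n.factorial) * 2 ^ (n + α - 1 / 2) *
        Real.Gamma (n + α + 1 / 2) : ℝ) : ℂ) * gegenbauerKernelP n α (n - s) (-v) := by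
  set b : ℝ := n + α - 1 / 2 with hb
  obtain ⟨t, rfl⟩ : ∃ t, v = t - 1 := ⟨v + 1, by ring⟩
  have ht0 : 0 < t := by linarith [hv.1]
  have ht2 : t < 2 := by linarith [hv.2]
  have hbn : b - n + 1 = α + 1 / 2 := by rw [hb]; ring
  set C : ℕ → ℝ := fun k => 1 / ((-2) ^ n * n.factorial) * rodriguesCoeff b n k with hC
  have e1 : ∫ u in (-1 : ℝ)..(t - 1), (rodrigues b n u : ℂ) * ((t - 1 - u : ℝ) : ℂ) ^ (s - 1) =
      ∫ τ in (0 : ℝ)..t, (rodrigues b n (τ - 1) : ℂ) * ((t : ℂ) - τ) ^ (s - 1) := by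
    have := intervalIntegral.integral_comp_sub_right (a := 0) (b := t)
      (fun u : ℝ => (rodrigues b n u : ℂ) * ((t - 1 - u : ℝ) : ℂ) ^ (s - 1)) 1
    rw [zero_sub] at this
    rw [← this]
    refine intervalIntegral.integral_congr fun τ _ => ?_
    congr 2
    push_cast; ring
  set F : ℕ → ℝ → ℂ := fun k τ =>
    (C k : ℂ) * ((τ : ℂ) ^ ((b - n + k + 1 : ℝ) - 1 : ℂ) * ((t : ℂ) - τ) ^ (s - 1)) with hF
  have hre : ∀ k : ℕ, 0 < ((b - n + k + 1 : ℝ) : ℂ).re := by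
    intro k
    have : (0 : ℝ) ≤ k := by positivity
    rw [Complex.ofReal_re]; linarith
  have hFi : ∀ k, IntervalIntegrable (F k) volume 0 t := fun k =>
    (intervalIntegrable_cpow_mul_sub_cpow (hre k) hs ht0).const_mul _
  -- Bounding `τ^k` by `t^k` leaves one integrable function independent of `k`. The remaining series
  -- converges because `t < 2`, that is `v < 1`, lies inside the radius of convergence; this permits
  -- termwise integration.
  have hFn : ∀ k, ∀ τ ∈ Ioc (0 : ℝ) t,
      ‖F k τ‖ ≤ (|C k| * t ^ k) * ‖(τ : ℂ) ^ ((b - n + 1 : ℝ) - 1 : ℂ) * ((t : ℂ) - τ) ^ (s - 1)‖ := by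
    intro k τ hτ
    have : (τ : ℂ) ^ ((b - n + k + 1 : ℝ) - 1 : ℂ) =
        (τ : ℂ) ^ ((b - n + 1 : ℝ) - 1 : ℂ) * ((τ ^ k : ℝ) : ℂ) := by
      have hτ' : (τ : ℂ) ≠ 0 := by exact_mod_cast hτ.1.ne'
      rw [Complex.ofReal_pow, ← Complex.cpow_natCast (τ : ℂ) k, ← Complex.cpow_add _ _ hτ']
      congr 1; push_cast; ring
    simp only [hF]
    rw [this]
    simp only [norm_mul, Complex.norm_real, Real.norm_eq_abs, abs_pow, abs_of_pos hτ.1]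
    have h3 : τ ^ k ≤ t ^ k := pow_le_pow_left₀ hτ.1.le hτ.2 _
    calc _ = |C k| * τ ^ k * (‖(τ : ℂ) ^ ((b - n + 1 : ℝ) - 1 : ℂ)‖ * ‖((t : ℂ) - τ) ^ (s - 1)‖) := by
          ring
      _ ≤ _ := by gcongr
  have hint0 : IntervalIntegrable (fun τ : ℝ => (τ : ℂ) ^ ((b - n + 1 : ℝ) - 1 : ℂ) *
      ((t : ℂ) - τ) ^ (s - 1)) volume 0 t :=
    intervalIntegrable_cpow_mul_sub_cpow (by simpa using hre 0) hs ht0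
  have hsumC : Summable fun k => |C k| * t ^ k := by
    have h := ((hasSum_rodriguesCoeff b n t (by rwa [abs_of_pos ht0])).mul_left
      (1 / ((-2 : ℝ) ^ n * n.factorial))).summable.abs
    refine h.congr fun k => ?_
    simp only [hC]
    rw [← mul_assoc, abs_mul, abs_of_pos (pow_pos ht0 k)]
  have hsum : Summable fun k => ∫ τ in Ioc (0 : ℝ) t, ‖F k τ‖ := by
    refine Summable.of_nonneg_of_le (fun k => integral_nonneg fun _ => norm_nonneg _) (fun k => ?_)
      (hsumC.mul_right (∫ τ in Ioc (0 : ℝ) t,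
        ‖(τ : ℂ) ^ ((b - n + 1 : ℝ) - 1 : ℂ) * ((t : ℂ) - τ) ^ (s - 1)‖))
    rw [← integral_const_mul]
    exact setIntegral_mono_on (hFi k).1.norm (hint0.1.norm.const_mul _) measurableSet_Ioc (hFn k)
  have hmain := hasSum_integral_of_summable_integral_norm (μ := volume.restrict (Ioc (0 : ℝ) t))
    (fun k => (hFi k).1) hsum
  have e2 : ∫ τ in Ioc (0 : ℝ) t, ∑' k, F k τ =
      ∫ τ in (0 : ℝ)..t, (rodrigues b n (τ - 1) : ℂ) * ((t : ℂ) - τ) ^ (s - 1) := by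
    rw [intervalIntegral.integral_of_le ht0.le]
    refine setIntegral_congr_fun measurableSet_Ioc fun τ hτ => ?_
    have h := (Complex.hasSum_ofReal.mpr (hasSum_rodrigues b n hτ.1 (hτ.2.trans_lt ht2))).mul_right
      (((t : ℂ) - τ) ^ (s - 1))
    rw [← h.tsum_eq]
    refine tsum_congr fun k => ?_
    simp only [hF, hC]
    have : (τ : ℂ) ^ ((b - n + k + 1 : ℝ) - 1 : ℂ) = ((τ ^ (b - n + k) : ℝ) : ℂ) := by
      rw [Complex.ofReal_cpow hτ.1.le]; congr 1; push_cast; ring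
    rw [this]; push_cast; ring
  rw [e2] at hmain
  rw [e1]
  refine hmain.unique ?_
  have hy : -(t - 1) ∈ Ioo (-1 : ℝ) 1 := ⟨by linarith, by linarith⟩
  have hz : ‖(((1 - -(t - 1)) / 2 : ℝ) : ℂ)‖ < 1 := by
    rw [Complex.norm_real, Real.norm_eq_abs, abs_of_pos (by linarith)]; linarith
  rw [gegenbauerKernelP_eq n α _ hy, ← hb, ← mul_assoc]
  refine ((hasSum_regularizedGaussHGFun _ _ _ hz).mul_left _).congr_fun fun k => ?_
  have htc : (t : ℂ) ≠ 0 := by exact_mod_cast ht0.ne'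
  have hcoef := congrArg (fun r : ℝ => (r : ℂ))
    (rodriguesCoeff_mul_Gamma (b := b) (j := n) (by linarith) k)
  simp only [Complex.ofReal_mul, Complex.ofReal_div, ofReal_ascPochhammer_eval] at hcoef
  rw [← intervalIntegral.integral_of_le ht0.le, hF]
  simp only
  rw [intervalIntegral.integral_const_mul, Complex.betaIntegral_scaled _ _ ht0,
    Complex.betaIntegral_eq_Gamma_mul_div _ _ (hre k) hs, Complex.Gamma_ofReal,
    show 1 - -(t - 1) = t by ring]
  -- The `k`-th beta integral is `t^(b-n+k+s) Γ(b-n+k+1) Γ(s) / Γ(b-n+k+1+s)`. Its denominator is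
  -- the factor `Γ(c + k)` of the regularized series with `c = b + 1 - ν`, where `ν = n - s`.
  have hpow : (t : ℂ) ^ (((b - n + k + 1 : ℝ) : ℂ) + s - 1) =
      (t : ℂ) ^ ((b : ℂ) - (n - s)) * (t : ℂ) ^ k := by
    rw [← Complex.cpow_natCast (t : ℂ) k, ← Complex.cpow_add _ _ htc]; congr 1; push_cast; ring
  have hG : Complex.Gamma (((b - n + k + 1 : ℝ) : ℂ) + s) =
      Complex.Gamma ((b : ℂ) + 1 - (n - s) + k) := by congr 1; push_cast; ring
  rw [hpow, hG]
  have hbb : (n : ℝ) + α + 1 / 2 = b + 1 := by rw [hb]; ring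
  rw [hbb]
  simp only [hC]
  push_cast at hcoef ⊢
  generalize Complex.Gamma ((b : ℂ) + 1 - (n - s) + k) = G1 at *
  generalize Complex.Gamma s = G2 at *
  generalize (t : ℂ) ^ ((b : ℂ) - (n - s)) = T at *
  rw [div_pow]
  rw [div_pow] at hcoef
  simp only [div_eq_mul_inv, mul_inv, one_mul] at hcoef ⊢
  linear_combination ((-2 : ℂ) ^ n)⁻¹ * ((n.factorial : ℂ))⁻¹ * T * t ^ k * G2 * G1⁻¹ * hcoef

/-- At `ν = n` the kernel on `(-1, 1)` is the weighted Jacobi polynomial itself. -/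
lemma rodrigues_eq_gegenbauerKernelP {n : ℕ} {α : ℝ} (hα : -1 / 2 < α)
    {v : ℝ} (hv : v ∈ Ioo (-1 : ℝ) 1) :
    (rodrigues (n + α - 1 / 2) n v : ℂ) =
      ((1 / ((-2) ^ n * n.factorial) * 2 ^ (n + α - 1 / 2) *
        Real.Gamma (n + α + 1 / 2) : ℝ) : ℂ) * gegenbauerKernelP n α n (-v) := by
  set b : ℝ := n + α - 1 / 2 with hb
  obtain ⟨t, rfl⟩ : ∃ t, v = t - 1 := ⟨v + 1, by ring⟩
  have ht0 : 0 < t := by linarith [hv.1]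
  have ht2 : t < 2 := by linarith [hv.2]
  have hbn : b - n + 1 = α + 1 / 2 := by rw [hb]; ring
  have hy : -(t - 1) ∈ Ioo (-1 : ℝ) 1 := ⟨by linarith, by linarith⟩
  have hz : ‖(((1 - -(t - 1)) / 2 : ℝ) : ℂ)‖ < 1 := by
    rw [Complex.norm_real, Real.norm_eq_abs, abs_of_pos (by linarith)]; linarith
  have hbb : (n : ℝ) + α + 1 / 2 = b + 1 := by rw [hb]; ring
  rw [gegenbauerKernelP_eq n α _ hy, ← hb, ← mul_assoc, hbb]
  refine (Complex.hasSum_ofReal.mpr (hasSum_rodrigues b n ht0 ht2)).unique ?_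
  refine ((hasSum_regularizedGaussHGFun _ _ _ hz).mul_left _).congr_fun fun k => ?_
  have hcoef := congrArg (fun r : ℝ => (r : ℂ))
    (rodriguesCoeff_mul_Gamma (b := b) (j := n) (by linarith) k)
  simp only [Complex.ofReal_mul, Complex.ofReal_div, ofReal_ascPochhammer_eval] at hcoef
  have htc : (t : ℂ) ≠ 0 := by exact_mod_cast ht0.ne'
  have hpow : ((t ^ (b - n + k) : ℝ) : ℂ) = (t : ℂ) ^ ((b : ℂ) - n) * (t : ℂ) ^ k := by
    rw [← Complex.cpow_natCast (t : ℂ) k, ← Complex.cpow_add _ _ htc, Complex.ofReal_cpow ht0.le]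
    congr 1; push_cast; ring
  have hG : Complex.Gamma ((b : ℂ) + 1 - n + k) = ((Real.Gamma (b - n + k + 1) : ℝ) : ℂ) := by
    rw [← Complex.Gamma_ofReal]; congr 1; push_cast; ring
  have hG0 : ((Real.Gamma (b - n + k + 1) : ℝ) : ℂ) ≠ 0 := by
    have : (0 : ℝ) ≤ k := by positivity
    exact_mod_cast (Real.Gamma_pos_of_pos (by linarith)).ne'
  rw [Complex.ofReal_mul, Complex.ofReal_mul, hpow, hG, show 1 - -(t - 1) = t by ring]
  push_cast at hcoef hG0 ⊢
  generalize ((Real.Gamma (b - n + k + 1) : ℝ) : ℂ) = G1 at *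
  generalize (t : ℂ) ^ ((b : ℂ) - n) = T at *
  have h1 := congrArg (fun r => r * G1⁻¹) hcoef
  simp only [mul_assoc, mul_inv_cancel₀ hG0, mul_one] at h1
  rw [h1, div_pow]
  rw [div_pow]
  simp only [div_eq_mul_inv, mul_inv, one_mul]
  ring

/-! ### Integration against the Gegenbauer measure and the constant `k_n n! / h_n`. -/

lemma measurable_jacobi_density (α β : ℝ) :
    Measurable fun u : ℝ => ENNReal.ofReal ((1 - u) ^ α * (1 + u) ^ β) := by
  fun_prop

lemma integral_jacobiMeasure {E : Type*} [NormedAddCommGroup E] [NormedSpace ℝ E] (α β : ℝ)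
    (F : ℝ → E) : ∫ u, F u ∂(jacobiMeasure α β) =
      ∫ u in (-1 : ℝ)..1, ((1 - u) ^ α * (1 + u) ^ β) • F u := by
  rw [jacobiMeasure, integral_withDensity_eq_integral_toReal_smul (measurable_jacobi_density α β)
    (by simp), intervalIntegral.integral_of_le (by norm_num), integral_Ioc_eq_integral_Ioo]
  refine setIntegral_congr_fun measurableSet_Ioo fun u hu => ?_
  have h1 : 0 < 1 - u := by linarith [hu.2]
  have h2 : 0 < 1 + u := by linarith [hu.1]
  rw [ENNReal.toReal_ofReal (by positivity)]

lemma weight_mul_gegenbauerPoly (n : ℕ) (α u : ℝ) :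
    ((1 - u) ^ (α - 1 / 2) * (1 + u) ^ (α - 1 / 2)) * (gegenbauerPoly n α).eval u =
      rodrigues (n + α - 1 / 2) n u := by
  rw [rodrigues, gegenbauerPoly, show (n : ℝ) + α - 1 / 2 - n = α - 1 / 2 by ring]

lemma integral_gegenbauerMeasure (n : ℕ) (α : ℝ) (F : ℝ → ℂ) :
    ∫ u, F u * (((gegenbauerPoly n α).eval u : ℝ) : ℂ) ∂(gegenbauerMeasure α) =
      ∫ u in (-1 : ℝ)..1, F u * (rodrigues (n + α - 1 / 2) n u : ℂ) := by
  rw [gegenbauerMeasure, integral_jacobiMeasure]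
  congr 1
  ext u
  rw [← weight_mul_gegenbauerPoly, Complex.real_smul]
  push_cast; ring

/-- The normalizing constant `k_n n! / h_n`. -/
lemma gegenbauer_normalization {n : ℕ} (hn : 1 ≤ n) {α : ℝ} (hα : -1 / 2 < α) :
    (gegenbauerPoly n α).coeff n * (n.factorial : ℝ) /
        ∫ ξ, ((gegenbauerPoly n α).eval ξ) ^ 2 ∂(gegenbauerMeasure α) =
      n.factorial * 2 ^ n * Real.Gamma (n + α + 1) /
        (Real.sqrt Real.pi * Real.Gamma (n + α + 1 / 2)) := by
  set b : ℝ := n + α - 1 / 2 with hb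
  set p := gegenbauerPoly n α with hp
  have hn1 : (1 : ℝ) ≤ n := by exact_mod_cast hn
  have hk : p.coeff n ≠ 0 := coeff_jacobiPoly_self_ne_zero hn (by linarith)
  have hdeg : p.natDegree ≤ n := natDegree_jacobiPoly_le n _
  -- Integrating by parts `n` times in `∫ p_n · R_n` puts all derivatives on `p_n`, whose `n`-th
  -- derivative is the constant `n! k_n`. Hence `h_n` is `k_n / 2^n` times the integral of `(1 -
  -- u²)^b`, and `k_n` cancels from the quotient; only `k_n ≠ 0` matters.
  have hder : ∀ u : ℝ, (Polynomial.derivative^[n] p).eval u = n.factorial * p.coeff n := by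
    intro u
    have h0 : (Polynomial.derivative^[n] p).natDegree = 0 := by
      have := Polynomial.natDegree_iterate_derivative p n
      omega
    rw [Polynomial.eq_C_of_natDegree_eq_zero h0, Polynomial.eval_C,
      Polynomial.coeff_iterate_derivative, zero_add, Nat.descFactorial_self, nsmul_eq_mul]
  have h1 : ((∫ ξ, (p.eval ξ) ^ 2 ∂(gegenbauerMeasure α) : ℝ) : ℂ) =
      ((p.coeff n / 2 ^ n * ∫ u in (-1 : ℝ)..1, (1 - u) ^ b * (1 + u) ^ b : ℝ) : ℂ) := by
    have h2 := integral_mul_rodrigues n (b := b)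
      (fun i u => (((Polynomial.derivative^[i] p).eval u : ℝ) : ℂ)) (by linarith)
      (fun i _ => (Complex.continuous_ofReal.comp (Polynomial.continuous _)).continuousOn)
      (fun i _ u _ => by
        rw [Function.iterate_succ_apply']
        exact (Polynomial.hasDerivAt _ u).ofReal_comp)
    have h3 := integral_gegenbauerMeasure n α (fun u => ((p.eval u : ℝ) : ℂ))
    rw [← integral_complex_ofReal]
    rw [← hp] at h3
    simp only [sq, Complex.ofReal_mul (Polynomial.eval _ _)]
    rw [h3]
    simp only [Function.iterate_zero, id_eq] at h2
    rw [h2]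
    simp only [hder]
    rw [intervalIntegral.integral_const_mul, intervalIntegral.integral_ofReal]
    simp only [rodrigues_zero]
    have h0 : (n.factorial : ℂ) ≠ 0 := by exact_mod_cast n.factorial_ne_zero
    push_cast
    field_simp
  rw [Complex.ofReal_injective h1, integral_jacobi_weight (by linarith),
    show b + 1 = n + α + 1 / 2 by rw [hb]; ring, show b + 3 / 2 = n + α + 1 by rw [hb]; ring]
  have g1 : Real.Gamma (n + α + 1 / 2) ≠ 0 := (Real.Gamma_pos_of_pos (by linarith)).ne'
  have g2 : Real.Gamma (n + α + 1) ≠ 0 := (Real.Gamma_pos_of_pos (by linarith)).ne'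
  have g3 : √Real.pi ≠ 0 := (Real.sqrt_pos.mpr Real.pi_pos).ne'
  generalize Real.Gamma (n + α + 1 / 2) = G1 at *
  generalize Real.Gamma (n + α + 1) = G2 at *
  field_simp

/-! ### The kernel on `(1, ∞)` -/

/-- `∫ (1 - u²)^b (v - u)^{-ν-1} du`. -/
def stieltjesPower (b : ℝ) (ν : ℂ) (v : ℝ) : ℂ :=
  ∫ u in (-1 : ℝ)..1, ((v - u : ℝ) : ℂ) ^ (-ν - 1) * (rodrigues b 0 u : ℂ)

lemma hasDerivAt_sub_cpow (c : ℂ) {v u : ℝ} (h : u < v) :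
    HasDerivAt (fun u : ℝ => ((v - u : ℝ) : ℂ) ^ c) (-c * ((v - u : ℝ) : ℂ) ^ (c - 1)) u := by
  have h1 : HasDerivAt (fun u : ℝ => ((v - u : ℝ) : ℂ)) ((-1 : ℝ) : ℂ) u :=
    ((hasDerivAt_id u).const_sub v).ofReal_comp
  have h2 := (hasDerivAt_id ((v - u : ℝ) : ℂ)).cpow_const (c := c)
    (Complex.ofReal_mem_slitPlane.2 (by linarith : 0 < v - u))
  have := h2.comp u h1
  simpa [Function.comp_def, mul_comm] using this

/-- The `i`-th derivative of `(v - u)^(s-1)` in `u` is `(1-s)_i (v - u)^(s-1-i)`, which is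
continuous on `[-1, 1]` because `v > 1`. So all `n` derivatives can be moved off the Rodrigues
function. -/
lemma integral_sub_cpow_mul_rodrigues {n : ℕ} {b : ℝ} (hb : n - 1 < b) (s : ℂ) {v : ℝ}
    (hv : 1 < v) :
    ∫ u in (-1 : ℝ)..1, ((v - u : ℝ) : ℂ) ^ (s - 1) * (rodrigues b n u : ℂ) =
      (ascPochhammer ℂ n).eval (1 - s) / (2 ^ n * n.factorial) * stieltjesPower b (n - s) v := by
  have h := integral_mul_rodrigues n (b := b)
    (fun i u => (ascPochhammer ℂ i).eval (1 - s) * ((v - u : ℝ) : ℂ) ^ (s - 1 - i)) hb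
    (fun i _ u hu => by
      refine (ContinuousAt.mul continuousAt_const
        (hasDerivAt_sub_cpow _ ?_).continuousAt).continuousWithinAt
      linarith [hu.2])
    (fun i _ u hu => by
      refine ((hasDerivAt_sub_cpow (s - 1 - i) (hu.2.trans hv)).const_mul _).congr_deriv ?_
      rw [ascPochhammer_succ_eval]
      push_cast
      rw [show s - 1 - (i : ℂ) - 1 = s - 1 - (i + 1) by ring]
      ring)
  simp only [ascPochhammer_zero, Polynomial.eval_one, Nat.cast_zero, sub_zero, one_mul] at h
  rw [h, stieltjesPower]
  simp only [mul_assoc]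
  rw [intervalIntegral.integral_const_mul, show -((n : ℂ) - s) - 1 = s - 1 - n by ring]
  ring

lemma hasSum_one_sub_cpow_neg (a : ℂ) {x : ℂ} (hx : ‖x‖ < 1) :
    HasSum (fun k : ℕ => (ascPochhammer ℂ k).eval a / k.factorial * x ^ k) ((1 - x) ^ (-a)) := by
  have h := (Complex.one_div_one_sub_cpow_hasFPowerSeriesOnBall_zero a).hasSum (y := x)
    (by
      rw [mem_eball_zero_iff, ← ofReal_norm, ← ENNReal.ofReal_one]
      exact (ENNReal.ofReal_lt_ofReal_iff one_pos).mpr hx)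
  simp only [zero_add, FormalMultilinearSeries.ofScalars_apply_eq, smul_eq_mul, one_div,
    ← Complex.cpow_neg] at h
  refine h.congr_fun fun k => ?_
  congr 1
  rw [Ring.choose]
  have := Ring.factorial_nsmul_multichoose_eq_ascPochhammer a k
  rw [Polynomial.ascPochhammer_smeval_eq_eval, nsmul_eq_mul] at this
  rw [div_eq_iff (by exact_mod_cast k.factorial_ne_zero), ← this, mul_comm]
  congr 2
  ring

lemma ascPochhammer_eval_two_mul (m : ℕ) (z : ℂ) :
    (ascPochhammer ℂ (2 * m)).eval z =
      4 ^ m * (ascPochhammer ℂ m).eval (z / 2) * (ascPochhammer ℂ m).eval ((z + 1) / 2) := by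
  induction m with
  | zero => simp
  | succ m ih =>
    rw [show 2 * (m + 1) = 2 * m + 1 + 1 by ring, ascPochhammer_succ_eval, ascPochhammer_succ_eval,
      ih, ascPochhammer_succ_eval, ascPochhammer_succ_eval]
    push_cast; ring

/-- Expand `(v - u)^(-ν-1) = v^(-ν-1) ∑ (ν+1)_k / k! (u/v)^k` and integrate termwise. Odd moments
vanish by symmetry. In the even ones `(ν+1)_(2m)` splits into `4^m ((ν+1)/2)_m (ν/2+1)_m`, and the
moment supplies the remaining denominator `(b+3/2)_m`. -/
lemma stieltjesPower_eq {b : ℝ} (hb : -1 < b) (ν : ℂ) {v : ℝ} (hv : 1 < v) :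
    stieltjesPower b ν v = Real.sqrt Real.pi * Real.Gamma (b + 1) * (v : ℂ) ^ (-ν - 1) *
      Complex.regularizedGaussHGFun (ν / 2 + 1) ((ν + 1) / 2) ((b : ℂ) + 3 / 2)
        ((1 / v ^ 2 : ℝ) : ℂ) := by
  have hv0 : 0 < v := by linarith
  have hvi : |1 / v| < 1 := by
    rw [abs_of_pos (by positivity), div_lt_one hv0]; exact hv
  set c : ℕ → ℂ := fun k => (ascPochhammer ℂ k).eval (ν + 1) / k.factorial with hc
  set F : ℕ → ℝ → ℂ := fun k u => c k * ((1 / v : ℝ) : ℂ) ^ k *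
    ((u : ℂ) ^ k * (rodrigues b 0 u : ℂ)) with hF
  have h0 : ((0 : ℕ) : ℝ) - 1 < b := by simpa using hb
  have hFi : ∀ k, IntervalIntegrable (F k) volume (-1) 1 := fun k =>
    (intervalIntegrable_mul_rodrigues h0 (g := fun u : ℝ => (u : ℂ) ^ k)
      (by fun_prop)).const_mul _
  have hR := intervalIntegrable_ofReal_rodrigues h0
  have hs1 : Summable fun k => ‖c k * ((1 / v : ℝ) : ℂ) ^ k‖ :=
    (hasSum_one_sub_cpow_neg (ν + 1) (x := ((1 / v : ℝ) : ℂ))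
      (by rwa [Complex.norm_real])).summable.norm
  have hsum : Summable fun k => ∫ u in Ioc (-1 : ℝ) 1, ‖F k u‖ := by
    refine Summable.of_nonneg_of_le (fun k => integral_nonneg fun _ => norm_nonneg _) (fun k => ?_)
      (hs1.mul_right (∫ u in Ioc (-1 : ℝ) 1, ‖(rodrigues b 0 u : ℂ)‖))
    rw [← integral_const_mul]
    refine setIntegral_mono_on (hFi k).1.norm (hR.1.norm.const_mul _) measurableSet_Ioc
      fun u hu => ?_
    simp only [hF]
    rw [norm_mul (c k * _), norm_mul ((u : ℂ) ^ k)]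
    gcongr
    have : ‖(u : ℂ) ^ k‖ ≤ 1 := by
      rw [norm_pow, Complex.norm_real]
      exact pow_le_one₀ (norm_nonneg _) (abs_le.mpr ⟨hu.1.le, hu.2⟩)
    nlinarith [norm_nonneg (rodrigues b 0 u : ℂ)]
  have hmain := hasSum_integral_of_summable_integral_norm
    (μ := volume.restrict (Ioc (-1 : ℝ) 1)) (fun k => (hFi k).1) hsum
  have e2 : (v : ℂ) ^ (-ν - 1) * ∫ u in Ioc (-1 : ℝ) 1, ∑' k, F k u = stieltjesPower b ν v := by
    rw [stieltjesPower, intervalIntegral.integral_of_le (by norm_num), ← integral_const_mul]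
    refine setIntegral_congr_fun measurableSet_Ioc fun u hu => ?_
    have hle : |u| ≤ 1 := abs_le.mpr ⟨hu.1.le, hu.2⟩
    have hx : ‖((u / v : ℝ) : ℂ)‖ < 1 := by
      rw [Complex.norm_real, Real.norm_eq_abs, abs_div, abs_of_pos hv0, div_lt_one hv0]
      linarith
    have h := (hasSum_one_sub_cpow_neg (ν + 1) hx).mul_right (rodrigues b 0 u : ℂ)
    have e3 : ((v - u : ℝ) : ℂ) ^ (-ν - 1) =
        (v : ℂ) ^ (-ν - 1) * (1 - ((u / v : ℝ) : ℂ)) ^ (-(ν + 1)) := by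
      have : 0 ≤ 1 - u / v := by
        rw [sub_nonneg, div_le_one hv0]; linarith [hu.2]
      rw [show -(ν + 1) = -ν - 1 by ring, ← Complex.ofReal_one, ← Complex.ofReal_sub,
        ← Complex.mul_cpow_ofReal_nonneg hv0.le this, ← Complex.ofReal_mul]
      congr 2
      field_simp
    rw [e3, mul_assoc, ← h.tsum_eq]
    congr 1
    refine tsum_congr fun k => ?_
    simp only [hF, hc]
    push_cast
    rw [div_pow, div_pow, one_pow]
    ring
  rw [← e2]
  have hodd : ∀ k, k ∉ range (fun m : ℕ => 2 * m) → ∫ u in Ioc (-1 : ℝ) 1, F k u = 0 := by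
    intro k hk
    obtain ⟨m, hm⟩ : Odd k := by
      rw [← Nat.not_even_iff_odd]
      rintro ⟨m, hm⟩
      exact hk ⟨m, by simp only; omega⟩
    rw [← intervalIntegral.integral_of_le (by norm_num)]
    simp only [hF]
    rw [intervalIntegral.integral_const_mul, hm, integral_pow_odd_mul_weight, mul_zero]
  have hinj : Function.Injective (fun m : ℕ => 2 * m) := fun i j h => by simpa using h
  have heven := (hinj.hasSum_iff hodd).mpr hmain
  have hz : ‖((1 / v ^ 2 : ℝ) : ℂ)‖ < 1 := by
    rw [Complex.norm_real, Real.norm_eq_abs, show 1 / v ^ 2 = (1 / v) ^ 2 by field_simp, abs_pow]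
    exact pow_lt_one₀ (abs_nonneg _) hvi two_ne_zero
  have hG := (hasSum_regularizedGaussHGFun (ν / 2 + 1) ((ν + 1) / 2) ((b : ℂ) + 3 / 2) hz).mul_left
    (Real.sqrt Real.pi * Real.Gamma (b + 1) : ℂ)
  have : ∫ u in Ioc (-1 : ℝ) 1, ∑' k, F k u = (Real.sqrt Real.pi * Real.Gamma (b + 1) : ℂ) *
      Complex.regularizedGaussHGFun (ν / 2 + 1) ((ν + 1) / 2) ((b : ℂ) + 3 / 2)
        ((1 / v ^ 2 : ℝ) : ℂ) := by
    refine heven.unique (hG.congr_fun fun m => ?_)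
    simp only [Function.comp, hF, hc]
    rw [← intervalIntegral.integral_of_le (by norm_num), intervalIntegral.integral_const_mul,
      integral_pow_even_mul_weight hb, ascPochhammer_eval_two_mul,
      intervalIntegral.integral_ofReal]
    simp only [rodrigues_zero]
    rw [integral_jacobi_weight hb]
    have hG0 : ∀ k : ℕ, (b : ℂ) + 3 / 2 ≠ -k := by
      intro k h
      have h' : b + 3 / 2 = -k := Complex.ofReal_injective (by push_cast; exact h)
      have : (0 : ℝ) ≤ k := by positivity
      linarith
    have hasc := Complex.Gamma_add_nat_div_Gamma_eq ((b : ℂ) + 3 / 2) hG0 (n := m)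
    have hg : ((Real.Gamma (b + 3 / 2) : ℝ) : ℂ) = Complex.Gamma ((b : ℂ) + 3 / 2) := by
      rw [← Complex.Gamma_ofReal]; push_cast; rfl
    rw [← hasc]
    have g1 := Complex.Gamma_ne_zero hG0
    have g2 : Complex.Gamma ((b : ℂ) + 3 / 2 + m) ≠ 0 :=
      Complex.Gamma_ne_zero_of_re_pos (by
        have : (0 : ℝ) ≤ m := by positivity
        simp; norm_num; linarith)
    have g3 : ((2 * m).factorial : ℂ) ≠ 0 := by exact_mod_cast Nat.factorial_ne_zero _
    have g4 : (m.factorial : ℂ) ≠ 0 := by exact_mod_cast Nat.factorial_ne_zero _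
    simp only [Complex.ofReal_div, Complex.ofReal_mul, hg]
    generalize Complex.Gamma ((b : ℂ) + 3 / 2) = G1 at *
    generalize Complex.Gamma ((b : ℂ) + 3 / 2 + m) = G2 at *
    have a1 : (ν + 1 + 1) / 2 = ν / 2 + 1 := by ring
    have hvc : (v : ℂ) ≠ 0 := by exact_mod_cast hv0.ne'
    rw [a1]
    push_cast
    rw [div_pow, div_pow, one_pow, one_pow, pow_mul]
    generalize (ascPochhammer ℂ m).eval (ν / 2 + 1) = A1
    generalize (ascPochhammer ℂ m).eval ((ν + 1) / 2) = A2
    field_simp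
  rw [this]
  ring

/-- The kernel on `(1, ∞)` as an elementary integral. -/
lemma gegenbauerKernelQ_eq {n : ℕ} {α : ℝ} (hb : -1 < (n : ℝ) + α - 1 / 2) (ν : ℂ)
    {y : ℝ} (hy : 1 < y) :
    gegenbauerKernelQ n α ν y =
      Complex.exp (Complex.I * Real.pi * (1 / 2 - α - n + ν)) * Complex.Gamma (ν + 1) /
        ((2 ^ (n + α + 1 / 2) * Real.Gamma (n + α + 1 / 2) : ℝ) : ℂ) *
        stieltjesPower (n + α - 1 / 2) ν y := by
  have hy0 : 0 < y := by linarith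
  have hp : 0 < y ^ 2 - 1 := by nlinarith
  have hr := Real.sqrt_pos.mpr hp
  have g1 : (Real.Gamma (n + α + 1 / 2) : ℂ) ≠ 0 := by
    exact_mod_cast (Real.Gamma_pos_of_pos (by linarith)).ne'
  rw [gegenbauerKernelQ, legendreQ, stieltjesPower_eq hb ν hy,
    show (n : ℝ) + α - 1 / 2 + 1 = n + α + 1 / 2 by ring]
  -- The degree and the order add up to `ν`, so the parameters of `Q` are those of
  -- `stieltjesPower_eq`.
  have e1 : ((n : ℂ) + α - 1 / 2 + (1 / 2 - α - n + ν) + 1) = ν + 1 := by ring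
  have e2 : ((n : ℂ) + α - 1 / 2 + (1 / 2 - α - n + ν)) = ν := by ring
  have e3 : ((((n : ℝ) + α - 1 / 2 : ℝ) : ℂ) + 3 / 2) = (n : ℂ) + α - 1 / 2 + 3 / 2 := by
    push_cast; ring
  rw [e1, e2, e3]
  set μ : ℂ := 1 / 2 - α - n + ν
  have hs : ((y ^ 2 - 1 : ℝ) : ℂ) ^ (μ / 2) = (Real.sqrt (y ^ 2 - 1) : ℂ) ^ μ := by
    rw [show y ^ 2 - 1 = √(y ^ 2 - 1) * √(y ^ 2 - 1) by rw [Real.mul_self_sqrt hp.le],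
      Complex.ofReal_mul, Complex.mul_cpow_ofReal_nonneg hr.le hr.le,
      ← Complex.cpow_add _ _ (by exact_mod_cast hr.ne'), Real.mul_self_sqrt hp.le]
    congr 1; ring
  have hs0 : (Real.sqrt (y ^ 2 - 1) : ℂ) ^ μ ≠ 0 := by
    rw [Complex.cpow_ne_zero_iff]; left; exact_mod_cast hr.ne'
  have h2 : (2 : ℂ) ^ ((n : ℂ) + α - 1 / 2 + 1) = ((2 ^ (n + α + 1 / 2 : ℝ) : ℝ) : ℂ) := by
    rw [Complex.ofReal_cpow (by norm_num)]; push_cast; congr 1; ring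
  have h20 : ((2 ^ (n + α + 1 / 2 : ℝ) : ℝ) : ℂ) ≠ 0 := by
    have : (2 : ℝ) ^ (n + α + 1 / 2 : ℝ) ≠ 0 := (Real.rpow_pos_of_pos two_pos _).ne'
    exact_mod_cast this
  have hyp : (y : ℂ) ^ (-ν - 1) = ((y : ℂ) ^ (ν + 1))⁻¹ := by
    rw [← Complex.cpow_neg]; congr 1; ring
  have hy0' : (y : ℂ) ^ (ν + 1) ≠ 0 := by
    rw [Complex.cpow_ne_zero_iff]; left; exact_mod_cast hy0.ne'
  rw [hs, h2, hyp, Complex.ofReal_mul]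
  generalize (Real.sqrt (y ^ 2 - 1) : ℂ) ^ μ = S at *
  generalize ((2 ^ (n + α + 1 / 2 : ℝ) : ℝ) : ℂ) = T at *
  generalize (y : ℂ) ^ (ν + 1) = Y at *
  generalize (Real.Gamma (n + α + 1 / 2) : ℂ) = G at *
  generalize Complex.regularizedGaussHGFun _ _ _ _ = H
  field_simp

/-! ### Interchange of the integrations and the three regimes of the kernel. -/

/-- The truncated power `τ_+^{s-1}`. -/
def truncPow (s : ℂ) (τ : ℝ) : ℂ := if 0 < τ then (τ : ℂ) ^ (s - 1) else 0

/-- The (unnormalized) Riemann-Liouville integral of a Rodrigues function. -/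
def rodriguesRiesz (b : ℝ) (n : ℕ) (s : ℂ) (v : ℝ) : ℂ :=
  ∫ u in Ioo (-1 : ℝ) 1, (rodrigues b n u : ℂ) * truncPow s (v - u)

lemma truncPow_mul (s : ℂ) {δ : ℝ} (hδ : 0 < δ) (τ : ℝ) :
    truncPow s (δ * τ) = (δ : ℂ) ^ (s - 1) * truncPow s τ := by
  unfold truncPow
  by_cases h : 0 < τ
  · rw [if_pos h, if_pos (by positivity), Complex.ofReal_mul,
      Complex.mul_cpow_ofReal_nonneg hδ.le h.le]
  · rw [if_neg h, if_neg, mul_zero]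
    intro h'
    exact h (pos_of_mul_pos_right h' hδ.le)

/-- Interchange of the order of integration. -/
lemma integral_rodrigues_weyl {b : ℝ} {n : ℕ} {δ : ℝ} (hδ : 0 < δ) {s : ℂ} {f : ℝ → ℂ} {x : ℝ}
    (hG : Integrable (fun q : ℝ × ℝ => (rodrigues b n q.1 : ℂ) *
      (f (x + δ * q.1 + q.2) * truncPow s q.2)) ((volume.restrict (Ioo (-1) 1)).prod volume)) :
    Integrable (fun v => f (x + δ * v) * rodriguesRiesz b n s v) ∧
      ∫ u in Ioo (-1 : ℝ) 1, (rodrigues b n u : ℂ) *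
        ∫ τ, f (x + δ * u + τ) * truncPow s τ =
      (δ : ℂ) ^ s * ∫ v, f (x + δ * v) * rodriguesRiesz b n s v := by
  set G : ℝ × ℝ → ℂ := fun q => (rodrigues b n q.1 : ℂ) *
      (f (x + δ * q.1 + q.2) * truncPow s q.2) with hGdef
  set m0 : Measure ℝ := volume.restrict (Ioo (-1) 1) with hm0
  -- The shear `τ = z - δu` preserves the product measure and makes the argument of `f` depend on
  -- `z` alone, so that Fubini isolates the kernel. The substitution `z = δv` then brings out the
  -- power of `δ`.
  have hS : MeasurePreserving (fun p : ℝ × ℝ => (p.1, p.2 - δ * p.1)) (m0.prod volume)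
      (m0.prod volume) :=
    MeasurePreserving.skew_product (f := id) (g := fun u z => z - δ * u) (.id m0)
      (by simp only [Function.uncurry_def]; fun_prop)
      (Eventually.of_forall fun u => (measurePreserving_sub_right volume (δ * u)).map_eq)
  have hGS : Integrable (fun p : ℝ × ℝ => G (p.1, p.2 - δ * p.1)) (m0.prod volume) :=
    hS.integrable_comp_of_integrable hG
  have hH : ∀ z, ∫ u, G (u, z - δ * u) ∂m0 = f (x + z) *
      ∫ u in Ioo (-1 : ℝ) 1, (rodrigues b n u : ℂ) * truncPow s (z - δ * u) := by
    intro z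
    rw [← integral_const_mul]
    refine integral_congr_ae (Eventually.of_forall fun u => ?_)
    simp only [hGdef]
    rw [show x + δ * u + (z - δ * u) = x + z by ring]
    ring
  have hH' : ∀ v, ∫ u, G (u, δ * v - δ * u) ∂m0 =
      (δ : ℂ) ^ (s - 1) * (f (x + δ * v) * rodriguesRiesz b n s v) := by
    intro v
    rw [hH, mul_left_comm]
    congr 1
    rw [rodriguesRiesz, ← integral_const_mul]
    refine integral_congr_ae (Eventually.of_forall fun u => ?_)
    simp only
    rw [← mul_sub, truncPow_mul s hδ]
    ring
  have hδc : (δ : ℂ) ≠ 0 := by exact_mod_cast hδ.ne'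
  have hpow : (δ : ℂ) ^ (s - 1) ≠ 0 := by
    rw [Complex.cpow_ne_zero_iff]; exact Or.inl hδc
  have hI := hGS.integral_prod_right.comp_mul_left' hδ.ne'
  simp only [hH'] at hI
  refine ⟨(integrable_const_mul_iff (IsUnit.mk0 _ hpow) _).mp hI, ?_⟩
  have e1 : ∫ u in Ioo (-1 : ℝ) 1, (rodrigues b n u : ℂ) *
      ∫ τ, f (x + δ * u + τ) * truncPow s τ = ∫ u, (∫ z, G (u, z - δ * u)) ∂m0 := by
    refine integral_congr_ae (Eventually.of_forall fun u => ?_)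
    simp only
    rw [integral_sub_right_eq_self (fun τ => G (u, τ)) (δ * u)]
    simp only [hGdef]
    rw [integral_const_mul]
  rw [e1, ← integral_prod (fun p : ℝ × ℝ => G (p.1, p.2 - δ * p.1)) hGS, integral_prod_symm _ hGS]
  have e2 := Measure.integral_comp_mul_left (fun z => ∫ u, G (u, z - δ * u) ∂m0) δ
  simp only [hH'] at e2
  rw [integral_const_mul, abs_of_pos (inv_pos.mpr hδ), Complex.real_smul] at e2
  rw [show (δ : ℂ) ^ s = δ * (δ : ℂ) ^ (s - 1) by
    rw [Complex.cpow_sub _ _ hδc, Complex.cpow_one]; field_simp, mul_assoc, e2]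
  push_cast
  field_simp

/-- Absolute convergence of the double integral, written with the Rodrigues function. -/
lemma approxGegenbauerConverges_iff (n : ℕ) (α δ : ℝ) (ν : ℂ) (f : ℝ → ℂ) (x : ℝ) :
    ApproxGegenbauerConverges n α δ ν f x ↔
    Integrable (fun q : ℝ × ℝ => (rodrigues (n + α - 1 / 2) n q.1 : ℂ) *
      (f (x + δ * q.1 + q.2) * truncPow (n - ν) q.2))
      ((volume.restrict (Ioo (-1) 1)).prod volume) := by
  rw [ApproxGegenbauerConverges, ApproxWeylConverges, gegenbauerMeasure, jacobiMeasure,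
    prod_withDensity_left (measurable_jacobi_density _ _),
    integrable_withDensity_iff_integrable_smul'
      (f := fun z : ℝ × ℝ => ENNReal.ofReal ((1 - z.1) ^ (α - 1 / 2) * (1 + z.1) ^ (α - 1 / 2)))
      ((measurable_jacobi_density _ _).comp measurable_fst) (by simp),
    ← Measure.restrict_univ (μ := volume.restrict (Ioo (-1 : ℝ) 1)), Measure.prod_restrict,
    Measure.restrict_univ]
  -- The restriction to `τ > 0` becomes an indicator, which `truncPow` already contains.
  have hms : MeasurableSet ((univ : Set ℝ) ×ˢ Ioi (0 : ℝ)) := MeasurableSet.univ.prod measurableSet_Ioi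
  change IntegrableOn _ _ _ ↔ _
  rw [← integrable_indicator_iff hms]
  refine integrable_congr ?_
  have hae : ∀ᵐ q : ℝ × ℝ ∂((volume.restrict (Ioo (-1 : ℝ) 1)).prod volume), q.1 ∈ Ioo (-1 : ℝ) 1 :=
    Measure.quasiMeasurePreserving_fst.ae (ae_restrict_mem measurableSet_Ioo)
  filter_upwards [hae] with q hq
  have h1 : 0 < 1 - q.1 := by linarith [hq.2]
  have h2 : 0 < 1 + q.1 := by linarith [hq.1]
  by_cases h : 0 < q.2
  · rw [indicator_of_mem (by simpa using h), ENNReal.toReal_ofReal (by positivity),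
      Complex.real_smul, ← weight_mul_gegenbauerPoly, truncPow, if_pos h]
    push_cast; ring
  · rw [indicator_of_notMem (by simpa using h), truncPow, if_neg h]
    simp

lemma weylIntegral_eq {s : ℂ} (hs : s ≠ 0) (f : ℝ → ℂ) (X : ℝ) :
    weylIntegral s f X = 1 / Complex.Gamma s * ∫ τ, f (X + τ) * truncPow s τ := by
  rw [weylIntegral, if_neg hs, ← integral_indicator measurableSet_Ioi,
    ← integral_add_left_eq_self _ X]
  congr 2
  ext τ
  by_cases h : 0 < τ
  · rw [indicator_of_mem (by simpa using h), truncPow, if_pos h, add_sub_cancel_left]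
  · rw [indicator_of_notMem (by simpa using h), truncPow, if_neg h, mul_zero]

lemma rodriguesRiesz_of_le (b : ℝ) (n : ℕ) (s : ℂ) {v : ℝ} (hv : v ≤ -1) :
    rodriguesRiesz b n s v = 0 := by
  rw [rodriguesRiesz]
  refine setIntegral_eq_zero_of_forall_eq_zero fun u hu => ?_
  rw [truncPow, if_neg (by linarith [hu.1]), mul_zero]

lemma rodriguesRiesz_of_mem (b : ℝ) (n : ℕ) (s : ℂ) {v : ℝ} (hv : v ∈ Ioo (-1 : ℝ) 1) :
    rodriguesRiesz b n s v =
      ∫ u in (-1 : ℝ)..v, (rodrigues b n u : ℂ) * ((v - u : ℝ) : ℂ) ^ (s - 1) := by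
  rw [rodriguesRiesz, intervalIntegral.integral_of_le hv.1.le, integral_Ioc_eq_integral_Ioo,
    ← integral_indicator measurableSet_Ioo, ← integral_indicator measurableSet_Ioo]
  congr 1
  ext u
  by_cases h1 : u ∈ Ioo (-1 : ℝ) v
  · rw [indicator_of_mem h1, indicator_of_mem (show u ∈ Ioo (-1 : ℝ) 1 from ⟨h1.1, h1.2.trans hv.2⟩), truncPow,
      if_pos (by linarith [h1.2])]
  · rw [indicator_of_notMem h1]
    by_cases h2 : u ∈ Ioo (-1 : ℝ) 1
    · rw [indicator_of_mem h2, truncPow, if_neg, mul_zero]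
      exact fun h => h1 ⟨h2.1, by linarith⟩
    · rw [indicator_of_notMem h2]

lemma rodriguesRiesz_of_gt (b : ℝ) (n : ℕ) (s : ℂ) {v : ℝ} (hv : 1 < v) :
    rodriguesRiesz b n s v =
      ∫ u in (-1 : ℝ)..1, ((v - u : ℝ) : ℂ) ^ (s - 1) * (rodrigues b n u : ℂ) := by
  rw [rodriguesRiesz, intervalIntegral.integral_of_le (by norm_num), integral_Ioc_eq_integral_Ioo]
  refine setIntegral_congr_fun measurableSet_Ioo fun u hu => ?_
  rw [truncPow, if_pos (by linarith [hu.2]), mul_comm]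

lemma integral_eq_Ioo_add_Ioi {g : ℝ → ℂ} (hg : Integrable g) (h0 : ∀ v ≤ -1, g v = 0) :
    ∫ v, g v = (∫ v in Ioo (-1 : ℝ) 1, g v) + ∫ v in Ioi (1 : ℝ), g v := by
  have h1 : ∫ v, g v = ∫ v in Ioi (-1 : ℝ), g v := by
    rw [setIntegral_eq_integral_of_forall_compl_eq_zero]
    intro v hv
    exact h0 v (by simpa using hv)
  rw [h1, ← Ioc_union_Ioi_eq_Ioi (show (-1 : ℝ) ≤ 1 by norm_num),
    setIntegral_union (Ioc_disjoint_Ioi le_rfl) measurableSet_Ioi hg.integrableOn hg.integrableOn,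
    integral_Ioc_eq_integral_Ioo]

lemma integral_Ioo_comp_neg (g : ℝ → ℂ) :
    ∫ v in Ioo (-1 : ℝ) 1, g (-v) = ∫ v in Ioo (-1 : ℝ) 1, g v := by
  have := intervalIntegral.integral_comp_neg (a := -1) (b := 1) g
  rw [neg_neg, intervalIntegral.integral_of_le (by norm_num),
    intervalIntegral.integral_of_le (by norm_num), integral_Ioc_eq_integral_Ioo,
    integral_Ioc_eq_integral_Ioo] at this
  exact this

lemma integrableOn_Ioo_comp_neg {g : ℝ → ℂ} (hg : IntegrableOn g (Ioo (-1) 1)) :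
    IntegrableOn (fun v => g (-v)) (Ioo (-1) 1) := by
  have h := (Measure.measurePreserving_neg (volume : Measure ℝ)).restrict_preimage
    (measurableSet_Ioo (a := (-1 : ℝ)) (b := 1))
  have e : (Neg.neg ⁻¹' Ioo (-1 : ℝ) 1) = Ioo (-1) 1 := by
    ext v; simp only [mem_preimage, mem_Ioo]; constructor <;> rintro ⟨h1, h2⟩ <;> constructor <;> linarith
  rw [e] at h
  exact h.integrable_comp_of_integrable hg

lemma intervalIntegral_eq_Ioo (g : ℝ → ℂ) :
    ∫ v in (-1 : ℝ)..1, g v = ∫ v in Ioo (-1 : ℝ) 1, g v := by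
  rw [intervalIntegral.integral_of_le (by norm_num), integral_Ioc_eq_integral_Ioo]

/-! ### Measurability and growth estimates for the integral over `(1, ∞)`. -/

lemma quasiMeasurePreserving_affine (x : ℝ) {δ : ℝ} (hδ : δ ≠ 0) :
    Measure.QuasiMeasurePreserving (fun v : ℝ => x + δ * v) volume volume := by
  have h1 : Measure.QuasiMeasurePreserving (fun v : ℝ => δ * v) volume volume :=
    ⟨by fun_prop, by
      rw [Real.map_volume_mul_left hδ]; exact Measure.smul_absolutelyContinuous⟩
  exact (measurePreserving_add_left volume x).quasiMeasurePreserving.comp h1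

/-- Measurability of `f` is available only on `(a, ∞)`, so `f` is replaced by its indicator there;
on `s` the two compositions agree. -/
lemma aestronglyMeasurable_comp_affine {f : ℝ → ℂ} {a : ℝ} (hf : LocallyIntegrableOn f (Ioi a))
    (x : ℝ) {δ : ℝ} (hδ : δ ≠ 0) {s : Set ℝ} (hs : MeasurableSet s)
    (hsub : ∀ v ∈ s, a < x + δ * v) :
    AEStronglyMeasurable (fun v => f (x + δ * v)) (volume.restrict s) := by
  have h1 : AEStronglyMeasurable ((Ioi a).indicator f) volume :=
    (aestronglyMeasurable_indicator_iff measurableSet_Ioi).mpr hf.aestronglyMeasurable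
  have h2 := (h1.comp_quasiMeasurePreserving (quasiMeasurePreserving_affine x hδ)).restrict (s := s)
  refine h2.congr ?_
  filter_upwards [ae_restrict_mem hs] with v hv
  exact indicator_of_mem (hsub v hv) f

lemma integrableOn_comp_affine {f : ℝ → ℂ} {a : ℝ} (hf : LocallyIntegrableOn f (Ioi a))
    (x : ℝ) {δ : ℝ} (hδ : 0 < δ) {c : ℝ} (hc : a < x + δ * c) (d : ℝ) :
    IntegrableOn (fun v => f (x + δ * v)) (Icc c d) := by
  have h1 : IntegrableOn f (Icc (x + δ * c) (x + δ * d)) :=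
    hf.integrableOn_compact_subset (fun t ht => hc.trans_le ht.1) isCompact_Icc
  have h2 := (((integrable_indicator_iff measurableSet_Icc).mpr h1).comp_add_left x).comp_mul_left'
    hδ.ne'
  refine h2.integrableOn.congr_fun (fun v hv => ?_) measurableSet_Icc
  exact indicator_of_mem (show x + δ * v ∈ Icc (x + δ * c) (x + δ * d) from
    ⟨by have := hv.1; gcongr, by have := hv.2; gcongr⟩) f

lemma measurable_rodrigues (b : ℝ) (j : ℕ) : Measurable (rodrigues b j) := by
  unfold rodrigues
  exact Measurable.mul (by fun_prop) (Polynomial.continuous _).measurable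

lemma stronglyMeasurable_stieltjesPower (b : ℝ) (ν : ℂ) :
    StronglyMeasurable (stieltjesPower b ν) := by
  have h : Measurable fun q : ℝ × ℝ => ((q.1 - q.2 : ℝ) : ℂ) ^ (-ν - 1) * (rodrigues b 0 q.2 : ℂ) := by
    have := measurable_rodrigues b 0
    fun_prop
  unfold stieltjesPower
  simp only [intervalIntegral_eq_Ioo]
  exact h.stronglyMeasurable.integral_prod_right (ν := volume.restrict (Ioo (-1 : ℝ) 1))

lemma rodrigues_zero_nonneg (b : ℝ) {u : ℝ} (hu : u ∈ Icc (-1 : ℝ) 1) : 0 ≤ rodrigues b 0 u := by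
  rw [rodrigues_zero]
  exact mul_nonneg (Real.rpow_nonneg (by linarith [hu.2]) _) (Real.rpow_nonneg (by linarith [hu.1]) _)

lemma norm_sub_cpow_mul_rodrigues (b : ℝ) (ν : ℂ) {y u : ℝ} (hu : u ∈ Icc (-1 : ℝ) 1) (h : u < y) :
    ‖((y - u : ℝ) : ℂ) ^ (-ν - 1) * (rodrigues b 0 u : ℂ)‖ =
      (y - u) ^ (-ν.re - 1) * rodrigues b 0 u := by
  rw [norm_mul, Complex.norm_cpow_eq_rpow_re_of_pos (by linarith), Complex.norm_real,
    Real.norm_of_nonneg (rodrigues_zero_nonneg b hu)]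
  simp

/-- Since `y - u ≥ 1 - u` and the exponent is negative, the value at `y = 1` is a bound. It is
finite because `b - Re ν - 1 > -1`. -/
lemma norm_stieltjesPower_le_of_le {b : ℝ} (hb : -1 < b) {ν : ℂ} (h0 : 0 ≤ ν.re) (h1 : ν.re < b) :
    ∃ C, ∀ y, 1 < y → ‖stieltjesPower b ν y‖ ≤ C := by
  refine ⟨∫ u in (-1 : ℝ)..1, (1 - u) ^ (b - ν.re - 1) * (1 + u) ^ b, fun y hy => ?_⟩
  refine intervalIntegral.norm_integral_le_of_norm_le (by norm_num) ?_
    (intervalIntegrable_jacobi_weight (by linarith) hb)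
  have hne : ∀ᵐ u : ℝ, u ≠ 1 := by simp [ae_iff]
  filter_upwards [hne] with u hu1 hu
  have hu2 : 0 < 1 - u := by
    have := lt_of_le_of_ne hu.2 hu1
    linarith
  have hu3 : 0 < 1 + u := by linarith [hu.1]
  rw [norm_sub_cpow_mul_rodrigues b ν ⟨hu.1.le, hu.2⟩ (by linarith), rodrigues_zero,
    show b - ν.re - 1 = (-ν.re - 1) + b by ring, Real.rpow_add hu2, mul_assoc]
  have : (y - u) ^ (-ν.re - 1) ≤ (1 - u) ^ (-ν.re - 1) :=
    Real.rpow_le_rpow_of_nonpos hu2 (by linarith) (by linarith)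
  gcongr

/-- For `y ≥ 2` and `u ≤ 1` one has `y - u ≥ y/2`. -/
lemma norm_stieltjesPower_le_rpow {b : ℝ} (hb : -1 < b) {ν : ℂ} (h0 : -1 ≤ ν.re) :
    ∃ C, ∀ y, 2 ≤ y → ‖stieltjesPower b ν y‖ ≤ C * y ^ (-ν.re - 1) := by
  refine ⟨(1 / 2) ^ (-ν.re - 1) * ∫ u in (-1 : ℝ)..1, rodrigues b 0 u, fun y hy => ?_⟩
  rw [mul_right_comm, ← Real.mul_rpow (by norm_num) (by linarith),
    ← intervalIntegral.integral_const_mul]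
  refine intervalIntegral.norm_integral_le_of_norm_le (by norm_num) ?_
    ((intervalIntegrable_rodrigues (by simpa using hb)).const_mul _)
  refine Eventually.of_forall fun u hu => ?_
  have hu' : u ∈ Icc (-1 : ℝ) 1 := ⟨hu.1.le, hu.2⟩
  rw [norm_sub_cpow_mul_rodrigues b ν hu' (by linarith [hu.2])]
  have : (y - u) ^ (-ν.re - 1) ≤ (1 / 2 * y) ^ (-ν.re - 1) :=
    Real.rpow_le_rpow_of_nonpos (by linarith) (by linarith [hu.2]) (by linarith)
  have := rodrigues_zero_nonneg b hu'
  gcongr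

/-- Decay of `f`, in the scaled variable. -/
lemma exists_norm_comp_affine_le {f : ℝ → ℂ} {r : ℝ} (hr : r ≤ 0)
    (hdecay : f =O[atTop] fun t : ℝ => t ^ r) (x : ℝ) {δ : ℝ} (hδ : 0 < δ) :
    ∃ C T, 0 ≤ C ∧ 2 ≤ T ∧ ∀ y, T ≤ y → ‖f (x + δ * y)‖ ≤ C * y ^ r := by
  obtain ⟨C, hC, hb⟩ := hdecay.exists_pos
  obtain ⟨T₀, hT₀⟩ := eventually_atTop.mp hb.bound
  refine ⟨C * (δ / 2) ^ r, max 2 (max ((T₀ - x) / δ) (2 * |x| / δ)), by positivity,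
    le_max_left _ _, fun y hy => ?_⟩
  have h1 : 2 ≤ y := (le_max_left _ _).trans hy
  have h2 : (T₀ - x) / δ ≤ y := (le_max_left _ _).trans ((le_max_right _ _).trans hy)
  have h3 : 2 * |x| / δ ≤ y := (le_max_right _ _).trans ((le_max_right _ _).trans hy)
  rw [div_le_iff₀ hδ] at h2 h3
  have h4 : δ / 2 * y ≤ x + δ * y := by
    have := neg_abs_le x
    linarith
  have h5 : 0 < δ / 2 * y := by positivity
  have h6 := hT₀ (x + δ * y) (by linarith)
  rw [Real.norm_of_nonneg (Real.rpow_nonneg (by linarith) _)] at h6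
  rw [mul_assoc, ← Real.mul_rpow (by positivity) (by linarith)]
  refine h6.trans ?_
  have := Real.rpow_le_rpow_of_nonpos h5 h4 hr
  gcongr

/-- This serves the exceptional case in which `(1-s)_n = 0`: absolute convergence of the double
integral then says nothing about `(1, ∞)`. Near `1` the kernel is bounded and `f` is integrable; at
infinity the product is `O(y^(-n-ε-1))`. -/
lemma integrableOn_mul_stieltjesPower {f : ℝ → ℂ} {a : ℝ} (hf : LocallyIntegrableOn f (Ioi a))
    {n : ℕ} {b ε δ x : ℝ} {ν : ℂ} (hε : 0 < ε)
    (hdecay : f =O[atTop] fun t : ℝ => t ^ (ν.re - n - ε)) (hδ : 0 < δ) (hx : a < x - δ)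
    (hb : -1 < b) (h0 : 0 ≤ ν.re) (h1 : ν.re < b) (h2 : ν.re ≤ n) :
    IntegrableOn (fun y => f (x + δ * y) * stieltjesPower b ν y) (Ioi 1) := by
  obtain ⟨C1, hC1⟩ := norm_stieltjesPower_le_of_le hb h0 h1
  obtain ⟨C2, hC2⟩ := norm_stieltjesPower_le_rpow hb (by linarith : -1 ≤ ν.re)
  obtain ⟨C3, T, hC3, hT, hfT⟩ := exists_norm_comp_affine_le (by linarith) hdecay x hδ
  have hmJ := (stronglyMeasurable_stieltjesPower b ν).aestronglyMeasurable (μ := volume)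
  rw [← Ioc_union_Ioi_eq_Ioi (show (1 : ℝ) ≤ T by linarith)]
  refine IntegrableOn.union ?_ ?_
  · have hi := (integrableOn_comp_affine hf x hδ (c := 1) (by linarith) T).mono_set Ioc_subset_Icc_self
    refine (hi.bdd_mul (c := C1) hmJ.restrict ?_).congr
      (Eventually.of_forall fun y => mul_comm _ _)
    filter_upwards [ae_restrict_mem measurableSet_Ioc] with y hy
    exact hC1 y hy.1
  · have hg : IntegrableOn (fun y : ℝ => C3 * C2 * y ^ (-n - ε - 1 : ℝ)) (Ioi T) := by
      refine (integrableOn_Ioi_rpow_of_lt ?_ (by linarith)).const_mul _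
      have : (0 : ℝ) ≤ n := by positivity
      linarith
    refine hg.mono' ?_ ?_
    · exact (aestronglyMeasurable_comp_affine hf x hδ.ne' measurableSet_Ioi
        (fun v hv => by
          have hv' : T < v := hv
          nlinarith)).mul hmJ.restrict
    · filter_upwards [ae_restrict_mem measurableSet_Ioi] with y hy
      have hy' : T < y := hy
      have hy0 : 0 < y := by linarith
      rw [norm_mul]
      calc ‖f (x + δ * y)‖ * ‖stieltjesPower b ν y‖
          ≤ (C3 * y ^ (ν.re - n - ε)) * (C2 * y ^ (-ν.re - 1)) := by
            gcongr
            · exact hfT y hy'.le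
            · exact hC2 y (by linarith)
        _ = C3 * C2 * y ^ (-n - ε - 1 : ℝ) := by
            rw [show (-n - ε - 1 : ℝ) = (ν.re - n - ε) + (-ν.re - 1) by ring, Real.rpow_add hy0]
            ring

/-! ### The explicit formula for `Re ν < n`. -/

/-- With `s = n - ν`, `(1-s)_n = Γ(ν+1) / Γ(1-s)`, and `Γ(s) Γ(1-s) = π / sin(πs)`. -/
lemma ascPochhammer_div_Gamma {n : ℕ} {ν : ℂ} (hν : ∀ k : ℕ, ν ≠ -((k : ℂ) + 1)) (hre : ν.re < n) :
    (-1) ^ n * ((ascPochhammer ℂ n).eval (1 - (n - ν)) / Complex.Gamma (n - ν)) =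
      -(Complex.sin (ν * Real.pi) * Complex.Gamma (ν + 1) / Real.pi) := by
  have hpi : (Real.pi : ℂ) ≠ 0 := by exact_mod_cast Real.pi_ne_zero
  have hs0 : Complex.Gamma (n - ν) ≠ 0 := Complex.Gamma_ne_zero_of_re_pos (by simpa using hre)
  by_cases h : ∀ k : ℕ, (1 : ℂ) - (n - ν) ≠ -k
  · rw [← Complex.Gamma_add_nat_div_Gamma_eq _ h, show 1 - ((n : ℂ) - ν) + n = ν + 1 by ring,
      div_div, mul_comm (Complex.Gamma (1 - _)), Complex.Gamma_mul_Gamma_one_sub]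
    have hcos : Complex.cos (n * Real.pi) = (-1) ^ n := by
      exact_mod_cast congrArg (fun r : ℝ => (r : ℂ)) (Real.cos_nat_mul_pi n)
    have hsin : Complex.sin (Real.pi * ((n : ℂ) - ν)) =
        -((-1) ^ n * Complex.sin (ν * Real.pi)) := by
      rw [show (Real.pi : ℂ) * ((n : ℂ) - ν) = n * Real.pi - ν * Real.pi by ring,
        Complex.sin_sub, Complex.sin_nat_mul_pi, hcos]
      ring
    rw [hsin, div_div_eq_mul_div]
    have : ((-1 : ℂ) ^ n) * (-1) ^ n = 1 := by rw [← mul_pow]; norm_num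
    linear_combination -(Complex.sin (ν * Real.pi) * Complex.Gamma (ν + 1) / Real.pi) * this
  -- Here `1 - s = -k` is a pole of `Γ`. The case `k ≥ n` would make `ν` a negative integer, so `k <
  -- n`; then `(-k)_n = 0` and `sin(νπ) = 0`.
  · push Not at h
    obtain ⟨k, hk⟩ := h
    have hkn : k < n := by
      by_contra hcon
      apply hν (k - n)
      rw [Nat.cast_sub (by omega)]
      linear_combination hk
    have e1 : (ascPochhammer ℂ n).eval (1 - (n - ν)) = 0 := by
      rw [hk, ascPochhammer_eval_neg_coe_nat_of_lt hkn]
    have e2 : Complex.sin (ν * Real.pi) = 0 := by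
      rw [show ν = ((n - k - 1 : ℤ) : ℂ) by push_cast; linear_combination hk,
        Complex.sin_int_mul_pi]
    rw [e1, e2]; simp

/-- The phase in front of the second integral undoes the phase `e^(iπμ)` in `Q` up to a sign, and
this sign cancels the explicit `(-1)^n`. -/
lemma exp_mul_exp_gegenbauer (n : ℕ) (α : ℝ) (ν : ℂ) :
    Complex.exp (Complex.I * Real.pi * (α - 1 / 2 - ν)) *
      Complex.exp (Complex.I * Real.pi * (1 / 2 - α - n + ν)) = (-1) ^ n := by
  rw [← Complex.exp_add, show Complex.I * Real.pi * (α - 1 / 2 - ν) +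
    Complex.I * Real.pi * (1 / 2 - α - n + ν) = n * (-(Real.pi * Complex.I)) by ring,
    Complex.exp_nat_mul, Complex.exp_neg, Complex.exp_pi_mul_I]
  norm_num

/-- The integral over `(1, ∞)`, with its factor, in terms of `stieltjesPower`. -/
lemma gegenbauerFormula_eq {n : ℕ} {α : ℝ} (hb : -1 < (n : ℝ) + α - 1 / 2)
    (δ : ℝ) (ν : ℂ) (f : ℝ → ℂ) (x : ℝ) :
    gegenbauerFormula n α δ ν f x =
      ((2 ^ ((n : ℝ) + α - 1 / 2) * Real.Gamma (n + α + 1) / Real.sqrt Real.pi : ℝ) : ℂ) *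
        (1 / (δ : ℂ) ^ ν) *
        (∫ y in Ioo (-1 : ℝ) 1, f (x - δ * y) * gegenbauerKernelP n α ν y) +
      ((Real.Gamma (n + α + 1) / (Real.sqrt Real.pi * Real.Gamma (n + α + 1 / 2)) : ℝ) : ℂ) *
        (1 / (δ : ℂ) ^ ν) * -(Complex.sin (ν * Real.pi) * Complex.Gamma (ν + 1) / Real.pi) *
        ∫ y in Ioi (1 : ℝ), f (x + δ * y) * stieltjesPower (n + α - 1 / 2) ν y := by
  have e : ∫ y in Ioi (1 : ℝ), f (x + δ * y) * gegenbauerKernelQ n α ν y =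
      (Complex.exp (Complex.I * Real.pi * (1 / 2 - α - n + ν)) * Complex.Gamma (ν + 1) /
        ((2 ^ (n + α + 1 / 2) * Real.Gamma (n + α + 1 / 2) : ℝ) : ℂ)) *
      ∫ y in Ioi (1 : ℝ), f (x + δ * y) * stieltjesPower (n + α - 1 / 2) ν y := by
    rw [← integral_const_mul]
    refine setIntegral_congr_fun measurableSet_Ioi fun y hy => ?_
    rw [gegenbauerKernelQ_eq hb ν hy]
    ring
  rw [gegenbauerFormula, e, sub_eq_add_neg]
  congr 1
  have hexp := exp_mul_exp_gegenbauer n α ν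
  have hsq : ((-1 : ℂ) ^ n) * (-1) ^ n = 1 := by rw [← mul_pow]; norm_num
  have h2 : (2 : ℝ) ^ (n + α + 1 / 2 : ℝ) ≠ 0 := (Real.rpow_pos_of_pos two_pos _).ne'
  have h2c : ((2 ^ (n + α + 1 / 2 : ℝ) : ℝ) : ℂ) ≠ 0 := by exact_mod_cast h2
  have g1 : (Real.Gamma (n + α + 1 / 2) : ℂ) ≠ 0 := by
    exact_mod_cast (Real.Gamma_pos_of_pos (by linarith)).ne'
  have hpi : (Real.pi : ℂ) ≠ 0 := by exact_mod_cast Real.pi_ne_zero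
  have hsp : (Real.sqrt Real.pi : ℂ) ≠ 0 := by
    exact_mod_cast (Real.sqrt_pos.mpr Real.pi_pos).ne'
  simp only [Complex.ofReal_mul, Complex.ofReal_div]
  generalize ((2 ^ (n + α + 1 / 2 : ℝ) : ℝ) : ℂ) = A at *
  generalize (Real.Gamma (n + α + 1 / 2) : ℂ) = G at *
  generalize (Real.Gamma (n + α + 1) : ℂ) = G2 at *
  generalize ∫ y in Ioi (1 : ℝ), f (x + δ * y) * stieltjesPower (n + α - 1 / 2) ν y = I0
  generalize Complex.exp (Complex.I * Real.pi * (α - 1 / 2 - ν)) = E1 at *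
  generalize Complex.exp (Complex.I * Real.pi * (1 / 2 - α - n + ν)) = E2 at *
  generalize Complex.sin (ν * Real.pi) = S
  generalize Complex.Gamma (ν + 1) = H
  generalize (δ : ℂ) ^ ν = D
  generalize (-1 : ℂ) ^ n = P at *
  have : -(P * E1 * (A * G2 / (Real.pi * Real.sqrt Real.pi)) * S * (1 / D) *
      (E2 * H / (A * G) * I0)) =
      (P * (E1 * E2)) * (G2 / (Real.sqrt Real.pi * G) * (1 / D) * -(S * H / Real.pi) * I0) := by
    field_simp
  rw [this, hexp, hsq, one_mul]

lemma integrableOn_mul_gegenbauerKernelQ {n : ℕ} {α : ℝ} (hb : -1 < (n : ℝ) + α - 1 / 2)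
    {δ x : ℝ} {ν : ℂ} {f : ℝ → ℂ}
    (h : IntegrableOn (fun y => f (x + δ * y) * stieltjesPower (n + α - 1 / 2) ν y) (Ioi 1)) :
    IntegrableOn (fun y => f (x + δ * y) * gegenbauerKernelQ n α ν y) (Ioi 1) := by
  set c : ℂ := Complex.exp (Complex.I * Real.pi * (1 / 2 - α - n + ν)) *
    Complex.Gamma (ν + 1) / ((2 ^ (n + α + 1 / 2) * Real.Gamma (n + α + 1 / 2) : ℝ) : ℂ) with hc
  have h2 : IntegrableOn (fun y => c * (f (x + δ * y) * stieltjesPower (n + α - 1 / 2) ν y))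
    (Ioi 1) := h.const_mul c
  refine h2.congr_fun (fun y hy => ?_) measurableSet_Ioi
  rw [gegenbauerKernelQ_eq hb ν hy, ← hc]
  ring

/-- For `Re ν < n`: absolute convergence of both integrals and the explicit formula. -/
theorem gegenbauer_of_converges {n : ℕ} (hn : 1 ≤ n) {δ : ℝ} (hδ : 0 < δ) {ν : ℂ}
    (hν : ν.re < n) (hνneg : ∀ k : ℕ, ν ≠ -((k : ℂ) + 1)) {a : ℝ} {f : ℝ → ℂ}
    (hf : LocallyIntegrableOn f (Ioi a)) {ε : ℝ} (hε : 0 < ε)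
    (hdecay : f =O[atTop] fun t : ℝ => t ^ (ν.re - n - ε)) {x : ℝ} (hx : a < x - δ)
    {α : ℝ} (hα : -1 / 2 < α) (hconv : ApproxGegenbauerConverges n α δ ν f x) :
    IntegrableOn (fun y => f (x - δ * y) * gegenbauerKernelP n α ν y) (Ioo (-1) 1) ∧
    IntegrableOn (fun y => f (x + δ * y) * gegenbauerKernelQ n α ν y) (Ioi 1) ∧
    approxGegenbauerDeriv n α δ ν f x = gegenbauerFormula n α δ ν f x := by
  have hn1 : (1 : ℝ) ≤ n := by exact_mod_cast hn
  have hb : -1 < (n : ℝ) + α - 1 / 2 := by linarith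
  have hbn : (n : ℝ) - 1 < (n : ℝ) + α - 1 / 2 := by linarith
  have hs : 0 < ((n : ℂ) - ν).re := by simpa using hν
  have hs0 : (n : ℂ) - ν ≠ 0 := by
    intro h; rw [h] at hs; simp at hs
  have hΓ : Complex.Gamma (n - ν) ≠ 0 := Complex.Gamma_ne_zero_of_re_pos hs
  have hδc : (δ : ℂ) ≠ 0 := by exact_mod_cast hδ.ne'
  have hgb : Real.Gamma (n + α + 1 / 2) ≠ 0 := (Real.Gamma_pos_of_pos (by linarith)).ne'
  have hf0 : (n.factorial : ℝ) ≠ 0 := by positivity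
  have h2b : (2 : ℝ) ^ ((n : ℝ) + α - 1 / 2) ≠ 0 := (Real.rpow_pos_of_pos two_pos _).ne'
  obtain ⟨hint, heq⟩ := integral_rodrigues_weyl hδ
    ((approxGegenbauerConverges_iff n α δ ν f x).mp hconv)
  set cP : ℝ := 1 / ((-2) ^ n * n.factorial) * 2 ^ ((n : ℝ) + α - 1 / 2) *
    Real.Gamma (n + α + 1 / 2) with hcP
  have hcP0 : cP ≠ 0 := by
    rw [hcP]
    have : ((-2 : ℝ)) ^ n ≠ 0 := pow_ne_zero _ (by norm_num)
    positivity
  have hKP : ∀ v ∈ Ioo (-1 : ℝ) 1, f (x + δ * v) * rodriguesRiesz (n + α - 1 / 2) n (n - ν) v =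
      (Complex.Gamma (n - ν) * cP) * (f (x - δ * -v) * gegenbauerKernelP n α ν (-v)) := by
    intro v hv
    rw [rodriguesRiesz_of_mem _ _ _ hv, integral_rodrigues_mul_cpow hα hs hv, ← hcP, sub_sub_cancel,
      mul_neg, sub_neg_eq_add]
    ring
  have hKQ : ∀ v ∈ Ioi (1 : ℝ), f (x + δ * v) * rodriguesRiesz (n + α - 1 / 2) n (n - ν) v =
      ((ascPochhammer ℂ n).eval (1 - (n - ν)) / (2 ^ n * n.factorial)) *
        (f (x + δ * v) * stieltjesPower (n + α - 1 / 2) ν v) := by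
    intro v hv
    rw [rodriguesRiesz_of_gt _ _ _ hv, integral_sub_cpow_mul_rodrigues hbn _ hv, sub_sub_cancel]
    ring
  have hcu : IsUnit (Complex.Gamma (n - ν) * (cP : ℂ)) :=
    IsUnit.mk0 _ (mul_ne_zero hΓ (by exact_mod_cast hcP0))
  refine ⟨?_, integrableOn_mul_gegenbauerKernelQ hb ?_, ?_⟩
  -- On `(-1, 1)` the proportionality factor `Γ(s) cP` never vanishes, so integrability is inherited
  -- from Fubini.
  · have h1 : IntegrableOn (fun v => (Complex.Gamma (n - ν) * cP) *
        (f (x - δ * -v) * gegenbauerKernelP n α ν (-v))) (Ioo (-1) 1) :=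
      hint.integrableOn.congr_fun hKP measurableSet_Ioo
    have h2 := integrableOn_Ioo_comp_neg ((integrable_const_mul_iff hcu _).mp h1)
    simpa only [neg_neg] using h2
  -- If the factor `(1-s)_n` vanishes, then `ν` is one of `0, …, n - 1`, hence `0 ≤ Re ν < b` and
  -- the direct estimate applies. Otherwise integrability is again inherited.
  · by_cases h : (ascPochhammer ℂ n).eval (1 - (n - ν)) = 0
    · obtain ⟨k, hk, hke⟩ := (ascPochhammer_eval_eq_zero_iff n _).mp h
      have hνk : ν = ((n - k - 1 : ℝ) : ℂ) := by
        push_cast; linear_combination hke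
      have hre : ν.re = n - k - 1 := by rw [hνk, Complex.ofReal_re]
      have hk' : (k : ℝ) + 1 ≤ n := by exact_mod_cast hk
      have hk0 : (0 : ℝ) ≤ k := by positivity
      exact integrableOn_mul_stieltjesPower hf hε hdecay hδ hx hb (by linarith) (by linarith)
        (by linarith)
    · have h1 := hint.integrableOn.congr_fun hKQ measurableSet_Ioi
      refine (integrable_const_mul_iff (IsUnit.mk0 _ (div_ne_zero h ?_)) _).mp h1
      exact mul_ne_zero (pow_ne_zero _ two_ne_zero) (by exact_mod_cast n.factorial_ne_zero)
  · have hweyl : ∫ u in (-1 : ℝ)..1, weylIntegral (n - ν) f (x + δ * u) *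
        (rodrigues (n + α - 1 / 2) n u : ℂ) = 1 / Complex.Gamma (n - ν) *
        ((δ : ℂ) ^ ((n : ℂ) - ν) *
          ∫ v, f (x + δ * v) * rodriguesRiesz (n + α - 1 / 2) n (n - ν) v) := by
      rw [← heq, intervalIntegral_eq_Ioo, ← integral_const_mul]
      refine integral_congr_ae (Eventually.of_forall fun u => ?_)
      simp only
      rw [weylIntegral_eq hs0]
      ring
    rw [approxGegenbauerDeriv, approxWeylDeriv, orthDeriv, gegenbauer_normalization hn hα,
      integral_gegenbauerMeasure, hweyl, integral_eq_Ioo_add_Ioi hint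
        (fun v hv => by rw [rodriguesRiesz_of_le _ _ _ hv, mul_zero]),
      setIntegral_congr_fun measurableSet_Ioo hKP, setIntegral_congr_fun measurableSet_Ioi hKQ,
      integral_const_mul, integral_const_mul,
      integral_Ioo_comp_neg (fun y => f (x - δ * y) * gegenbauerKernelP n α ν y),
      gegenbauerFormula_eq hb, ← ascPochhammer_div_Gamma hνneg hν, hcP]
    have hpow : (δ : ℂ) ^ ((n : ℂ) - ν) = (δ : ℂ) ^ n / (δ : ℂ) ^ ν := by
      rw [Complex.cpow_sub _ _ hδc, Complex.cpow_natCast]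
    have hδn : (δ : ℂ) ^ n ≠ 0 := pow_ne_zero _ hδc
    have hδν : (δ : ℂ) ^ ν ≠ 0 := by rw [Complex.cpow_ne_zero_iff]; exact Or.inl hδc
    have hsp : (Real.sqrt Real.pi : ℂ) ≠ 0 := by
      exact_mod_cast (Real.sqrt_pos.mpr Real.pi_pos).ne'
    have hgbc : (Real.Gamma (n + α + 1 / 2) : ℂ) ≠ 0 := by exact_mod_cast hgb
    have hf0c : (n.factorial : ℂ) ≠ 0 := by exact_mod_cast hf0
    have hsgn : ((-2 : ℝ)) ^ n = (-1) ^ n * 2 ^ n := by rw [← mul_pow]; norm_num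
    have hsq : ((-1 : ℂ) ^ n) * (-1) ^ n = 1 := by rw [← mul_pow]; norm_num
    have hP0 : ((-1 : ℂ) ^ n) ≠ 0 := pow_ne_zero _ (by norm_num)
    rw [hpow, hsgn]
    simp only [Complex.ofReal_mul, Complex.ofReal_div, Complex.ofReal_pow, Complex.ofReal_neg,
      Complex.ofReal_one, Complex.ofReal_ofNat, Complex.ofReal_natCast]
    generalize (Real.Gamma (n + α + 1 / 2) : ℂ) = G at *
    generalize (Real.Gamma (n + α + 1) : ℂ) = G2 at *
    generalize ∫ y in Ioi (1 : ℝ), f (x + δ * y) * stieltjesPower (n + α - 1 / 2) ν y = I1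
    generalize ∫ y in Ioo (-1 : ℝ) 1, f (x - δ * y) * gegenbauerKernelP n α ν y = I2
    generalize Complex.Gamma (n - ν) = H at *
    generalize (δ : ℂ) ^ ν = D at *
    generalize (δ : ℂ) ^ n = D' at *
    generalize (-1 : ℂ) ^ n = P at *
    generalize ((2 ^ ((n : ℝ) + α - 1 / 2) : ℝ) : ℂ) = B
    generalize (ascPochhammer ℂ n).eval (1 - (n - ν)) = A
    field_simp

/-! ### Absolute convergence for locally bounded functions. -/

lemma LocallyBoundedOnIoi.exists_norm_le {f : ℝ → ℂ} {a : ℝ} (hb : LocallyBoundedOnIoi f a)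
    {r : ℝ} (hr : r ≤ 0) (hdecay : f =O[atTop] fun t : ℝ => t ^ r) {x₀ : ℝ} (hx : a < x₀) :
    ∃ C, 0 ≤ C ∧ ∀ t, x₀ ≤ t → ‖f t‖ ≤ C * (1 + (t - x₀)) ^ r := by
  obtain ⟨C₀, hC₀, hbd⟩ := hdecay.exists_pos
  obtain ⟨T₀, hT₀⟩ := eventually_atTop.mp hbd.bound
  -- For `t ≥ |x₀| + 1` one has `t ≥ (1 + t - x₀)/2`, which transfers the decay to the shifted
  -- variable and explains the factor `(1/2)^r`. Below `T` compactness gives the bound.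
  set T := max T₀ (|x₀| + 1) with hT
  obtain ⟨C₁, hC₁⟩ := hb (Icc x₀ T) (fun t ht => hx.trans_le ht.1) isCompact_Icc
  have hxT : x₀ ≤ T := by
    have := le_max_right T₀ (|x₀| + 1)
    have := le_abs_self x₀
    linarith
  have hC1 : 0 ≤ C₁ := (norm_nonneg _).trans (hC₁ x₀ ⟨le_rfl, hxT⟩)
  have hpos : 0 < (1 + (T - x₀)) ^ r := Real.rpow_pos_of_pos (by linarith) _
  refine ⟨C₁ / (1 + (T - x₀)) ^ r + C₀ * (1 / 2) ^ r, by positivity, fun t ht => ?_⟩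
  have ht1 : 0 < 1 + (t - x₀) := by linarith
  have hp := Real.rpow_pos_of_pos ht1 r
  have h2 : (0 : ℝ) < (1 / 2) ^ r := Real.rpow_pos_of_pos (by norm_num) _
  rw [add_mul]
  rcases le_total t T with h | h
  · have h3 : C₁ ≤ C₁ / (1 + (T - x₀)) ^ r * (1 + (t - x₀)) ^ r := by
      rw [div_mul_eq_mul_div, le_div_iff₀ hpos]
      have := Real.rpow_le_rpow_of_nonpos ht1 (by linarith : 1 + (t - x₀) ≤ 1 + (T - x₀)) hr
      gcongr
    have h4 : 0 ≤ C₀ * (1 / 2) ^ r * (1 + (t - x₀)) ^ r := by positivity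
    exact (hC₁ t ⟨ht, h⟩).trans (h3.trans (by linarith))
  · have h4 : 0 ≤ C₁ / (1 + (T - x₀)) ^ r * (1 + (t - x₀)) ^ r := by positivity
    have h5 : |x₀| + 1 ≤ t := (le_max_right _ _).trans h
    have h6 := hT₀ t ((le_max_left _ _).trans h)
    have h7 : 0 < t := by have := abs_nonneg x₀; linarith
    rw [Real.norm_of_nonneg (Real.rpow_nonneg h7.le _)] at h6
    have h8 : t ^ r ≤ (1 / 2 * (1 + (t - x₀))) ^ r :=
      Real.rpow_le_rpow_of_nonpos (by positivity)
        (by have := neg_abs_le x₀; linarith) hr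
    rw [Real.mul_rpow (by norm_num) ht1.le] at h8
    have h9 : C₀ * t ^ r ≤ C₀ * ((1 / 2) ^ r * (1 + (t - x₀)) ^ r) := by gcongr
    linarith

lemma integrableOn_one_add_rpow_mul_rpow {r p : ℝ} (hp : 0 < p) (hr : r ≤ 0) (h : r + p < 0) :
    IntegrableOn (fun τ : ℝ => (1 + τ) ^ r * τ ^ (p - 1)) (Ioi 0) := by
  have hm : Measurable fun τ : ℝ => (1 + τ) ^ r * τ ^ (p - 1) := by fun_prop
  rw [← Ioc_union_Ioi_eq_Ioi (zero_le_one' ℝ)]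
  refine IntegrableOn.union ?_ ?_
  · have h1 : IntegrableOn (fun τ : ℝ => τ ^ (p - 1)) (Ioc 0 1) :=
      (intervalIntegral.intervalIntegrable_rpow' (a := 0) (b := 1) (by linarith)).1
    refine h1.mono' hm.aestronglyMeasurable ?_
    filter_upwards [ae_restrict_mem measurableSet_Ioc] with τ hτ
    have h0 : 0 ≤ τ ^ (p - 1) := Real.rpow_nonneg hτ.1.le _
    have h2 : (1 + τ) ^ r ≤ 1 := Real.rpow_le_one_of_one_le_of_nonpos (by linarith [hτ.1]) hr
    have h3 : 0 ≤ (1 + τ) ^ r := Real.rpow_nonneg (by linarith [hτ.1]) _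
    rw [Real.norm_of_nonneg (by positivity)]
    nlinarith
  · have h1 : IntegrableOn (fun τ : ℝ => τ ^ (r + (p - 1))) (Ioi 1) :=
      integrableOn_Ioi_rpow_of_lt (by linarith) one_pos
    refine h1.mono' hm.aestronglyMeasurable ?_
    filter_upwards [ae_restrict_mem measurableSet_Ioi] with τ hτ
    have hτ0 : 0 < τ := one_pos.trans hτ
    have h0 : 0 ≤ τ ^ (p - 1) := Real.rpow_nonneg hτ0.le _
    have h2 : (1 + τ) ^ r ≤ τ ^ r := Real.rpow_le_rpow_of_nonpos hτ0 (by linarith) hr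
    have h3 : 0 ≤ (1 + τ) ^ r := Real.rpow_nonneg (by linarith) _
    rw [Real.norm_of_nonneg (by positivity), Real.rpow_add hτ0]
    gcongr

lemma norm_truncPow (s : ℂ) {τ : ℝ} (h : 0 < τ) : ‖truncPow s τ‖ = τ ^ (s.re - 1) := by
  rw [truncPow, if_pos h, Complex.norm_cpow_eq_rpow_re_of_pos h]
  simp

lemma measurable_truncPow (s : ℂ) : Measurable (truncPow s) := by
  unfold truncPow
  exact Measurable.ite measurableSet_Ioi (by fun_prop) measurable_const

/-- The double integral converges absolutely if `f` is bounded on compact sets. -/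
theorem LocallyBoundedOnIoi.approxGegenbauerConverges {n : ℕ} {δ : ℝ}
    (hδ : 0 < δ) {ν : ℂ} (hν : ν.re < n) {a : ℝ} {f : ℝ → ℂ}
    (hf : LocallyIntegrableOn f (Ioi a)) {ε : ℝ} (hε : 0 < ε)
    (hdecay : f =O[atTop] fun t : ℝ => t ^ (ν.re - n - ε)) {x : ℝ} (hx : a < x - δ)
    {α : ℝ} (hα : -1 / 2 < α) (hb : LocallyBoundedOnIoi f a) :
    ApproxGegenbauerConverges n α δ ν f x := by
  rw [approxGegenbauerConverges_iff]
  obtain ⟨C, hC, hbd⟩ := hb.exists_norm_le (by linarith) hdecay hx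
  set m0 : Measure ℝ := volume.restrict (Ioo (-1) 1) with hm0
  have hae : ∀ᵐ q : ℝ × ℝ ∂(m0.prod volume), q.1 ∈ Ioo (-1 : ℝ) 1 :=
    Measure.quasiMeasurePreserving_fst.ae (ae_restrict_mem measurableSet_Ioo)
  have hlow : ∀ q : ℝ × ℝ, q.1 ∈ Ioo (-1 : ℝ) 1 → x - δ + q.2 ≤ x + δ * q.1 + q.2 := by
    intro q hq
    nlinarith [hq.1]
  have hR : Integrable (fun u => |rodrigues (n + α - 1 / 2) n u|) m0 := by
    have := (intervalIntegrable_rodrigues (b := n + α - 1 / 2) (j := n) (by linarith)).1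
    exact (this.mono_set Ioo_subset_Ioc_self).abs
  have hg : Integrable ((Ioi (0 : ℝ)).indicator fun τ =>
      C * ((1 + τ) ^ (ν.re - n - ε) * τ ^ ((n - ν.re) - 1))) :=
    (integrable_indicator_iff measurableSet_Ioi).mpr
      ((integrableOn_one_add_rpow_mul_rpow (by linarith) (by linarith) (by linarith)).const_mul C)
  -- As `x + δu + τ ≥ x - δ + τ`, the integrand is dominated by a product of a function of `u` and a
  -- function of `τ`. The latter decays like `τ^(-ε-1)`.
  refine (hR.mul_prod hg).mono' ?_ ?_
  · have h1 : AEStronglyMeasurable ((Ioi a).indicator f) volume :=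
      (aestronglyMeasurable_indicator_iff measurableSet_Ioi).mpr hf.aestronglyMeasurable
    have hS : MeasurePreserving (fun p : ℝ × ℝ => (p.1, (x + δ * p.1) + p.2)) (m0.prod volume)
        (m0.prod volume) :=
      MeasurePreserving.skew_product (f := id) (g := fun u z => (x + δ * u) + z) (.id m0)
        (by simp only [Function.uncurry_def]; fun_prop)
        (Eventually.of_forall fun u => (measurePreserving_add_left volume (x + δ * u)).map_eq)
    have h2 := h1.comp_quasiMeasurePreserving
      (Measure.quasiMeasurePreserving_snd.comp hS.quasiMeasurePreserving)
    have h3 : AEStronglyMeasurable (fun q : ℝ × ℝ => (rodrigues (n + α - 1 / 2) n q.1 : ℂ) *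
        ((Ioi a).indicator f (x + δ * q.1 + q.2) * truncPow (n - ν) q.2)) (m0.prod volume) := by
      refine AEStronglyMeasurable.mul ?_ (h2.mul ?_)
      · exact (Complex.measurable_ofReal.comp
          ((measurable_rodrigues _ _).comp measurable_fst)).aestronglyMeasurable
      · exact ((measurable_truncPow _).comp measurable_snd).aestronglyMeasurable
    refine h3.congr ?_
    filter_upwards [hae] with q hq
    by_cases h : 0 < q.2
    · rw [indicator_of_mem (mem_Ioi.mpr (show a < x + δ * q.1 + q.2 by linarith [hlow q hq]))]
    · rw [truncPow, if_neg h]; simp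
  · filter_upwards [hae] with q hq
    by_cases h : 0 < q.2
    · rw [indicator_of_mem (show q.2 ∈ Ioi (0 : ℝ) from h), norm_mul, norm_mul, norm_truncPow _ h,
        Complex.norm_real, Real.norm_eq_abs, ← mul_assoc C]
      have h1 := hbd (x + δ * q.1 + q.2) (by linarith [hlow q hq])
      have h2 : (1 + (x + δ * q.1 + q.2 - (x - δ))) ^ (ν.re - n - ε) ≤
          (1 + q.2) ^ (ν.re - n - ε) :=
        Real.rpow_le_rpow_of_nonpos (by linarith) (by linarith [hlow q hq]) (by linarith)
      have h3 : ((n : ℂ) - ν).re = n - ν.re := by simp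
      rw [h3]
      have h4 : 0 ≤ q.2 ^ (n - ν.re - 1) := Real.rpow_nonneg h.le _
      gcongr
      exact h1.trans (by gcongr)
    · rw [indicator_of_notMem (show q.2 ∉ Ioi (0 : ℝ) from h), truncPow, if_neg h]; simp

/-! ### The limit `Re ν = n` -/

/-- Comparison of two positive sequences through their ratios. -/
lemma exists_le_const_mul_of_ratio_le {d e p q : ℕ → ℝ} (hd : ∀ k, 0 ≤ d k) (he : ∀ k, 0 < e k)
    (hds : ∀ k, d (k + 1) = d k * p k) (hes : ∀ k, e (k + 1) = e k * q k)
    (hpq : ∀ᶠ k in atTop, p k ≤ q k) : ∃ C, 0 ≤ C ∧ ∀ k, d k ≤ C * e k := by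
  obtain ⟨K, hK⟩ := eventually_atTop.mp hpq
  set C := ∑ i ∈ Finset.range (K + 1), d i / e i with hC
  have hC0 : 0 ≤ C := Finset.sum_nonneg fun i _ => div_nonneg (hd i) (he i).le
  have hle : ∀ k ≤ K, d k ≤ C * e k := by
    intro k hk
    rw [← div_le_iff₀ (he k)]
    exact Finset.single_le_sum (f := fun i => d i / e i)
      (fun i _ => div_nonneg (hd i) (he i).le) (by simpa [Nat.lt_succ_iff] using hk)
  refine ⟨C, hC0, fun k => ?_⟩
  rcases le_total k K with h | h
  · exact hle k h
  · induction k, h using Nat.le_induction with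
    | base => exact hle K le_rfl
    | succ k hk ih =>
      have h1 : 0 ≤ q k := by
        have := he (k + 1)
        rw [hes] at this
        exact (pos_of_mul_pos_right this (he k).le).le
      rw [hds, hes, ← mul_assoc]
      calc d k * p k ≤ d k * q k := mul_le_mul_of_nonneg_left (hK k hk) (hd k)
        _ ≤ C * e k * q k := mul_le_mul_of_nonneg_right ih h1

/-- Majorant of the coefficients of `F(b + 1, -b; c; z)` for `β ≤ Re c`. -/
def hypergeometricMajorant (b β : ℝ) (k : ℕ) : ℝ :=
  |(ascPochhammer ℝ k).eval (-b)| * (ascPochhammer ℝ k).eval (b + 1) /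
    (k.factorial * (ascPochhammer ℝ k).eval β)

/-- Compare ratios of consecutive terms: `(k - b)(k + b + 1) ≤ (k + γ)(k + β)` for `k ≥ b`, because
`1 ≤ γ + β`. The right side consists of the coefficients of `(1 - z)^(-γ)`. -/
lemma exists_hypergeometricMajorant_le {b β γ : ℝ} (hb : 0 ≤ b) (hβ : 0 < β) (hγ : 0 < γ)
    (h : 1 ≤ γ + β) : ∃ C, 0 ≤ C ∧ ∀ k, hypergeometricMajorant b β k ≤
      C * ((ascPochhammer ℝ k).eval γ / k.factorial) := by
  refine exists_le_const_mul_of_ratio_le (p := fun k => |-b + k| * (b + 1 + k) / ((k + 1) * (β + k)))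
    (q := fun k => (γ + k) / (k + 1)) (fun k => ?_) (fun k => ?_) (fun k => ?_) (fun k => ?_) ?_
  · have h1 := ascPochhammer_pos k (b + 1) (by linarith)
    have h2 := ascPochhammer_pos k β hβ
    rw [hypergeometricMajorant]; positivity
  · have h1 := ascPochhammer_pos k γ hγ
    positivity
  · have h2 := ascPochhammer_pos k β hβ
    have h3 : 0 < β + k := by positivity
    rw [hypergeometricMajorant, hypergeometricMajorant, ascPochhammer_succ_eval,
      ascPochhammer_succ_eval, ascPochhammer_succ_eval, abs_mul, Nat.factorial_succ]
    push_cast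
    field_simp
  · rw [ascPochhammer_succ_eval, Nat.factorial_succ]
    push_cast
    field_simp
  · filter_upwards [eventually_ge_atTop ⌈b⌉₊] with k hk
    have hk' : b ≤ k := Nat.ceil_le.mp hk
    have h3 : 0 < β + k := by positivity
    rw [abs_of_nonneg (by linarith), div_le_div_iff₀ (by positivity) (by positivity)]
    have : (-b + k) * (b + 1 + k) ≤ (γ + k) * (β + k) := by
      have hk0 : (0 : ℝ) ≤ k := by positivity
      nlinarith [mul_pos hγ hβ, mul_nonneg hb hb, mul_nonneg (sub_nonneg.mpr h) hk0]
    nlinarith [mul_le_mul_of_nonneg_right this (by positivity : (0 : ℝ) ≤ k + 1)]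

lemma ascPochhammer_le_norm {β : ℝ} (hβ : 0 < β) {c : ℂ} (hc : β ≤ c.re) (k : ℕ) :
    (ascPochhammer ℝ k).eval β ≤ ‖(ascPochhammer ℂ k).eval c‖ := by
  induction k with
  | zero => simp
  | succ k ih =>
    rw [ascPochhammer_succ_eval, ascPochhammer_succ_eval, norm_mul]
    have h1 : β + k ≤ ‖c + k‖ := by
      refine le_trans ?_ (Complex.re_le_norm _)
      simpa using hc
    have := (ascPochhammer_pos k β hβ).le
    gcongr

/-- Write `Γ(c+k) = Γ(c) (c)_k` and use `|(c)_k| ≥ (β)_k`. The dependence on `c` is confined to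
`1/Γ(c)`, which is continuous. -/
lemma norm_hypergeometric_coeff_le {b β : ℝ} (hb : 0 ≤ b) (hβ : 0 < β) {c : ℂ} (hc : β ≤ c.re)
    (k : ℕ) :
    ‖(ascPochhammer ℂ k).eval ((b : ℂ) + 1) * (ascPochhammer ℂ k).eval (-(b : ℂ)) /
      (k.factorial * Complex.Gamma (c + k))‖ ≤
      ‖(Complex.Gamma c)⁻¹‖ * hypergeometricMajorant b β k := by
  have hc0 : ∀ k : ℕ, c ≠ -k := by
    intro k h
    rw [h] at hc
    have : (0 : ℝ) ≤ k := by positivity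
    simp at hc
    linarith
  have hG := Complex.Gamma_add_nat_div_Gamma_eq c hc0 (n := k)
  rw [div_eq_iff (Complex.Gamma_ne_zero hc0)] at hG
  have e1 : (ascPochhammer ℂ k).eval ((b : ℂ) + 1) = (((ascPochhammer ℝ k).eval (b + 1) : ℝ) : ℂ) := by
    rw [ofReal_ascPochhammer_eval]; push_cast; rfl
  have e2 : (ascPochhammer ℂ k).eval (-(b : ℂ)) = (((ascPochhammer ℝ k).eval (-b) : ℝ) : ℂ) := by
    rw [ofReal_ascPochhammer_eval]; push_cast; rfl
  have h1 := ascPochhammer_pos k (b + 1) (by linarith)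
  have h2 := ascPochhammer_pos k β hβ
  have h3 := ascPochhammer_le_norm hβ hc k
  have hg : 0 < ‖Complex.Gamma c‖ := norm_pos_iff.mpr (Complex.Gamma_ne_zero hc0)
  rw [hG, e1, e2, norm_div, norm_mul, norm_mul, norm_mul, Complex.norm_real, Complex.norm_real,
    Complex.norm_natCast, Real.norm_of_nonneg h1.le, Real.norm_eq_abs, norm_inv,
    hypergeometricMajorant, inv_mul_eq_div, div_div, mul_comm |_|]
  refine div_le_div_of_nonneg_left (by positivity) (by positivity) ?_
  rw [mul_comm ‖(ascPochhammer ℂ k).eval c‖, ← mul_assoc, mul_assoc, mul_assoc]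
  rw [mul_left_comm, mul_comm _ ‖Complex.Gamma c‖]
  nlinarith [mul_le_mul_of_nonneg_left h3 (by positivity : 0 ≤ ‖Complex.Gamma c‖ * (k.factorial : ℝ))]

lemma continuousOn_regularizedGaussHGFun (a b c : ℂ) :
    ContinuousOn (Complex.regularizedGaussHGFun a b c) {z | ‖z‖ < 1} := by
  have hr := Complex.radius_regularizedGaussHGFunSeries_ge_one a b c
  have h := (FormalMultilinearSeries.hasFPowerSeriesOnBall _ (one_pos.trans_le hr)).continuousOn
  refine h.mono fun z hz => lt_of_lt_of_le ?_ hr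
  rw [edist_zero_right, ← ofReal_norm, ← ENNReal.ofReal_one]
  exact (ENNReal.ofReal_lt_ofReal_iff one_pos).mpr hz

lemma aestronglyMeasurable_gegenbauerKernelP (n : ℕ) (α : ℝ) (ν : ℂ) :
    AEStronglyMeasurable (gegenbauerKernelP n α ν) (volume.restrict (Ioo (-1) 1)) := by
  have h : AEStronglyMeasurable (fun y : ℝ => ((1 - y : ℝ) : ℂ) ^ ((n + α - 1 / 2 : ℝ) - ν) *
      Complex.regularizedGaussHGFun ((n + α - 1 / 2 : ℝ) + 1) (-(n + α - 1 / 2 : ℝ))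
        ((n + α - 1 / 2 : ℝ) + 1 - ν) (((1 - y) / 2 : ℝ) : ℂ)) (volume.restrict (Ioo (-1) 1)) := by
    refine AEStronglyMeasurable.mul (Measurable.aestronglyMeasurable (by fun_prop)) ?_
    refine ContinuousOn.aestronglyMeasurable ?_ measurableSet_Ioo
    refine (continuousOn_regularizedGaussHGFun _ _ _).comp (by fun_prop) fun y hy => ?_
    simp only [Set.mem_ofPred_eq]
    rw [Complex.norm_real, Real.norm_eq_abs, abs_of_pos (by linarith [hy.2])]
    linarith [hy.1]
  refine h.congr ?_
  filter_upwards [ae_restrict_mem measurableSet_Ioo] with y hy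
  exact (gegenbauerKernelP_eq n α ν hy).symm

/-- Uniform bound for the kernel on `(-1, 1)`. -/
lemma exists_norm_gegenbauerKernelP_le {n : ℕ} (hn : 1 ≤ n) {α : ℝ} (hα : -1 / 2 < α) :
    ∃ D γ : ℝ, 0 ≤ D ∧ γ < 1 ∧ ∀ ν : ℂ, (n : ℝ) - 1 ≤ ν.re → ν.re ≤ n → ∀ y ∈ Ioo (-1 : ℝ) 1,
      ‖gegenbauerKernelP n α ν y‖ ≤
        ‖(Complex.Gamma ((n + α - 1 / 2 : ℝ) + 1 - ν))⁻¹‖ *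
          (D * ((1 - y) ^ (α - 1 / 2) * (1 + y) ^ (-γ))) := by
  set b : ℝ := n + α - 1 / 2 with hbdef
  have hn1 : (1 : ℝ) ≤ n := by exact_mod_cast hn
  have hb : 0 ≤ b := by rw [hbdef]; linarith
  set β : ℝ := α + 1 / 2 with hβdef
  have hβ : 0 < β := by rw [hβdef]; linarith
  -- `β` is the least value of `Re (b + 1 - ν)` for `Re ν ≤ n`. The comparison needs `γ ≥ 1 - β` and
  -- `γ > 0`, while `γ < 1` keeps `(1 + y)^(-γ)` integrable at `-1`; `1/2` is an arbitrary positive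
  -- choice.
  set γ : ℝ := max (1 - β) (1 / 2) with hγdef
  have hγ0 : 0 < γ := lt_of_lt_of_le (by norm_num) (le_max_right _ _)
  have hγ1 : γ < 1 := max_lt (by linarith) (by norm_num)
  have hγβ : 1 ≤ γ + β := by have := le_max_left (1 - β) (1 / 2); linarith
  obtain ⟨C, hC, hmaj⟩ := exists_hypergeometricMajorant_le hb hβ hγ0 hγβ
  refine ⟨2 * C * (1 / 2) ^ (-γ), γ, by positivity, hγ1, fun ν h1 h2 y hy => ?_⟩
  have hy1 : 0 < 1 - y := by linarith [hy.2]
  have hy2 : 0 < 1 + y := by linarith [hy.1]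
  set z : ℝ := (1 - y) / 2 with hz
  have hz0 : 0 < z := by positivity
  have hz1 : |z| < 1 := by rw [abs_of_pos hz0]; linarith
  have hzc : ‖(z : ℂ)‖ < 1 := by rwa [Complex.norm_real]
  have hc : β ≤ ((b : ℂ) + 1 - ν).re := by
    simp; rw [hβdef, hbdef]; linarith
  have hS := hasSum_one_sub_rpow (-γ) hz1
  rw [neg_neg] at hS
  have hsum : ‖Complex.regularizedGaussHGFun ((b : ℂ) + 1) (-(b : ℂ)) ((b : ℂ) + 1 - ν) (z : ℂ)‖ ≤
      ‖(Complex.Gamma ((b : ℂ) + 1 - ν))⁻¹‖ * C * (1 - z) ^ (-γ) := by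
    rw [← (hasSum_regularizedGaussHGFun _ _ _ hzc).tsum_eq]
    refine tsum_of_norm_bounded (hS.mul_left _) fun k => ?_
    rw [norm_mul, norm_pow, Complex.norm_real, Real.norm_of_nonneg hz0.le, mul_assoc, ← mul_assoc C,
      ← mul_assoc]
    refine mul_le_mul_of_nonneg_right ?_ (by positivity)
    refine (norm_hypergeometric_coeff_le hb hβ hc k).trans ?_
    exact mul_le_mul_of_nonneg_left (hmaj k) (norm_nonneg _)
  have hpow : ‖((1 - y : ℝ) : ℂ) ^ ((b : ℂ) - ν)‖ ≤ 2 * (1 - y) ^ (α - 1 / 2) := by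
    rw [Complex.norm_cpow_eq_rpow_re_of_pos hy1]
    have e : ((b : ℂ) - ν).re = (n - ν.re) + (α - 1 / 2) := by
      simp; rw [hbdef]; ring
    rw [e, Real.rpow_add hy1]
    have h3 : (1 - y) ^ (n - ν.re) ≤ 2 := by
      calc (1 - y) ^ (n - ν.re) ≤ 2 ^ (n - ν.re) :=
            Real.rpow_le_rpow hy1.le (by linarith) (by linarith)
        _ ≤ 2 ^ (1 : ℝ) := Real.rpow_le_rpow_of_exponent_le (by norm_num) (by linarith)
        _ = 2 := Real.rpow_one 2
    gcongr
  rw [gegenbauerKernelP_eq n α ν hy, ← hbdef, norm_mul]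
  have e1 : (1 - z) ^ (-γ) = (1 / 2) ^ (-γ) * (1 + y) ^ (-γ) := by
    rw [← Real.mul_rpow (by norm_num) hy2.le]; congr 1; rw [hz]; ring
  rw [e1] at hsum
  calc _ ≤ (2 * (1 - y) ^ (α - 1 / 2)) *
        (‖(Complex.Gamma ((b : ℂ) + 1 - ν))⁻¹‖ * C * ((1 / 2) ^ (-γ) * (1 + y) ^ (-γ))) := by
        gcongr
    _ = _ := by ring

lemma tendsto_gegenbauerKernelP {n : ℕ} (hn : 1 ≤ n) {α : ℝ} (hα : -1 / 2 < α) {ν : ℂ}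
    {y : ℝ} (hy : y ∈ Ioo (-1 : ℝ) 1) :
    Tendsto (fun s => gegenbauerKernelP n α s y) (𝓝[{s : ℂ | s.re ≤ n}] ν)
      (𝓝 (gegenbauerKernelP n α ν y)) := by
  set b : ℝ := n + α - 1 / 2 with hbdef
  have hn1 : (1 : ℝ) ≤ n := by exact_mod_cast hn
  have hb : 0 ≤ b := by rw [hbdef]; linarith
  set β : ℝ := α + 1 / 2 with hβdef
  have hβ : 0 < β := by rw [hβdef]; linarith
  -- For a fixed `y` the geometric comparison `γ = 1` suffices. The terms are continuous in `s`
  -- because `1/Γ` is entire.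
  obtain ⟨C, hC, hmaj⟩ := exists_hypergeometricMajorant_le hb hβ one_pos (by linarith : 1 ≤ 1 + β)
  have hy1 : 0 < 1 - y := by linarith [hy.2]
  set z : ℝ := (1 - y) / 2 with hz
  have hz0 : 0 < z := by positivity
  have hz1 : |z| < 1 := by rw [abs_of_pos hz0]; linarith [hy.1]
  have hzc : ‖(z : ℂ)‖ < 1 := by rwa [Complex.norm_real]
  have hS := hasSum_one_sub_rpow (-1) hz1
  rw [neg_neg] at hS
  have hgc : Continuous fun s : ℂ => (Complex.Gamma s)⁻¹ :=
    Complex.differentiable_one_div_Gamma.continuous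
  simp only [gegenbauerKernelP_eq n α _ hy]
  rw [← hbdef, ← hz]
  refine Tendsto.mul ?_ ?_
  · have : Continuous fun s : ℂ => ((1 - y : ℝ) : ℂ) ^ ((b : ℂ) - s) :=
      Continuous.const_cpow (by fun_prop) (Or.inl (by exact_mod_cast hy1.ne'))
    exact this.continuousAt.tendsto.mono_left nhdsWithin_le_nhds
  · simp only [← (hasSum_regularizedGaussHGFun _ _ _ hzc).tsum_eq]
    have hM : ∀ᶠ s in 𝓝 ν, ‖(Complex.Gamma ((b : ℂ) + 1 - s))⁻¹‖ <
        ‖(Complex.Gamma ((b : ℂ) + 1 - ν))⁻¹‖ + 1 := by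
      have : Continuous fun s : ℂ => ‖(Complex.Gamma ((b : ℂ) + 1 - s))⁻¹‖ :=
        (hgc.comp (by fun_prop : Continuous fun s : ℂ => (b : ℂ) + 1 - s)).norm
      exact this.continuousAt.eventually_lt continuousAt_const (lt_add_one _)
    refine tendsto_tsum_of_dominated_convergence
      ((hS.mul_left ((‖(Complex.Gamma ((b : ℂ) + 1 - ν))⁻¹‖ + 1) * C)).summable) (fun k => ?_) ?_
    · simp only [div_eq_mul_inv, mul_inv]
      have : Continuous fun s : ℂ => (Complex.Gamma ((b : ℂ) + 1 - s + k))⁻¹ :=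
        hgc.comp (by fun_prop : Continuous fun s : ℂ => (b : ℂ) + 1 - s + k)
      refine Tendsto.mono_left (Continuous.tendsto ?_ _) nhdsWithin_le_nhds
      fun_prop
    · filter_upwards [self_mem_nhdsWithin, nhdsWithin_le_nhds hM] with s hs hMs k
      have hs' : s.re ≤ n := hs
      have hc : β ≤ ((b : ℂ) + 1 - s).re := by
        simp; rw [hβdef, hbdef]; linarith
      rw [norm_mul, norm_pow, Complex.norm_real, Real.norm_of_nonneg hz0.le, mul_assoc,
        ← mul_assoc C, ← mul_assoc]
      refine mul_le_mul_of_nonneg_right ?_ (by positivity)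
      have h2 := ascPochhammer_pos k (1 : ℝ) one_pos
      refine (norm_hypergeometric_coeff_le hb hβ hc k).trans ?_
      exact mul_le_mul hMs.le (hmaj k)
        (by
          have h1 := ascPochhammer_pos k (b + 1) (by linarith)
          have h2 := ascPochhammer_pos k β hβ
          rw [hypergeometricMajorant]; positivity) (by positivity)

/-- The integral over `(-1, 1)` is continuous in `ν` up to `Re ν = n` for bounded `f`. -/
lemma tendsto_integral_gegenbauerKernelP {n : ℕ} (hn : 1 ≤ n) {α : ℝ} (hα : -1 / 2 < α) {ν : ℂ}
    (hν : ν.re = n) {g : ℝ → ℂ} (hg : AEStronglyMeasurable g (volume.restrict (Ioo (-1) 1))) {C : ℝ}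
    (hC : ∀ y ∈ Ioo (-1 : ℝ) 1, ‖g y‖ ≤ C) :
    IntegrableOn (fun y => g y * gegenbauerKernelP n α ν y) (Ioo (-1) 1) ∧
    Tendsto (fun s => ∫ y in Ioo (-1 : ℝ) 1, g y * gegenbauerKernelP n α s y)
      (𝓝[{s : ℂ | s.re ≤ n}] ν) (𝓝 (∫ y in Ioo (-1 : ℝ) 1, g y * gegenbauerKernelP n α ν y)) := by
  obtain ⟨D, γ, hD, hγ, hbd⟩ := exists_norm_gegenbauerKernelP_le hn hα
  have hC0 : 0 ≤ C := (norm_nonneg _).trans (hC 0 (by norm_num))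
  set b : ℝ := n + α - 1 / 2 with hbdef
  have hint : IntegrableOn (fun y : ℝ => C * ((‖(Complex.Gamma ((b : ℂ) + 1 - ν))⁻¹‖ + 1) *
      (D * ((1 - y) ^ (α - 1 / 2) * (1 + y) ^ (-γ))))) (Ioo (-1) 1) := by
    have := (intervalIntegrable_jacobi_weight (c := α - 1 / 2) (d := -γ) (by linarith)
      (by linarith)).1.mono_set Ioo_subset_Ioc_self
    exact ((this.const_mul D).const_mul _).const_mul C
  have hmeas : ∀ s, AEStronglyMeasurable (fun y => g y * gegenbauerKernelP n α s y)
      (volume.restrict (Ioo (-1) 1)) := fun s =>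
    hg.mul (aestronglyMeasurable_gegenbauerKernelP n α s)
  have hle : ∀ s : ℂ, (n : ℝ) - 1 ≤ s.re → s.re ≤ n →
      ‖(Complex.Gamma ((b : ℂ) + 1 - s))⁻¹‖ ≤ ‖(Complex.Gamma ((b : ℂ) + 1 - ν))⁻¹‖ + 1 →
      ∀ᵐ y ∂(volume.restrict (Ioo (-1 : ℝ) 1)), ‖g y * gegenbauerKernelP n α s y‖ ≤
        C * ((‖(Complex.Gamma ((b : ℂ) + 1 - ν))⁻¹‖ + 1) *
          (D * ((1 - y) ^ (α - 1 / 2) * (1 + y) ^ (-γ)))) := by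
    intro s h1 h2 h3
    filter_upwards [ae_restrict_mem measurableSet_Ioo] with y hy
    rw [norm_mul]
    have hy1 : 0 < 1 - y := by linarith [hy.2]
    have hy2 : 0 < 1 + y := by linarith [hy.1]
    refine mul_le_mul (hC y hy) ((hbd s h1 h2 y hy).trans ?_) (norm_nonneg _) hC0
    gcongr
  refine ⟨hint.mono' (hmeas ν) (hle ν (by linarith) hν.le (by linarith)), ?_⟩
  have hgc : Continuous fun s : ℂ => ‖(Complex.Gamma ((b : ℂ) + 1 - s))⁻¹‖ :=
    (Complex.differentiable_one_div_Gamma.continuous.comp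
      (by fun_prop : Continuous fun s : ℂ => (b : ℂ) + 1 - s)).norm
  have hM : ∀ᶠ s in 𝓝 ν, ‖(Complex.Gamma ((b : ℂ) + 1 - s))⁻¹‖ <
      ‖(Complex.Gamma ((b : ℂ) + 1 - ν))⁻¹‖ + 1 :=
    hgc.continuousAt.eventually_lt continuousAt_const (lt_add_one _)
  have hre : ∀ᶠ s : ℂ in 𝓝 ν, (n : ℝ) - 1 < s.re :=
    continuousAt_const.eventually_lt Complex.continuous_re.continuousAt (by rw [hν]; linarith)
  refine tendsto_integral_filter_of_dominated_convergence _
    (Eventually.of_forall hmeas) ?_ hint ?_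
  · filter_upwards [self_mem_nhdsWithin, nhdsWithin_le_nhds hM, nhdsWithin_le_nhds hre] with s h1 h2 h3
    exact hle s h3.le h1 h2.le
  · filter_upwards [ae_restrict_mem measurableSet_Ioo] with y hy
    exact (tendsto_gegenbauerKernelP hn hα hy).const_mul _

lemma integral_Ioi_sub_rpow {p : ℝ} (hp : 1 < p) {u : ℝ} (hu : u < 1) :
    IntegrableOn (fun y : ℝ => (y - u) ^ (-p)) (Ioi 1) ∧
      ∫ y in Ioi (1 : ℝ), (y - u) ^ (-p) = (1 - u) ^ (1 - p) / (p - 1) := by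
  have h0 : 0 < 1 - u := by linarith
  have h1 : IntegrableOn (fun y : ℝ => y ^ (-p)) (Ioi (1 - u)) :=
    integrableOn_Ioi_rpow_of_lt (by linarith) h0
  have h2 := integral_Ioi_rpow_of_lt (by linarith : -p < -1) h0
  have e : (Ioi (1 : ℝ)) = (fun y => y - u) ⁻¹' Ioi (1 - u) := by
    ext y; simp
  constructor
  · rw [e]
    exact ((measurePreserving_sub_right volume u).integrableOn_comp_preimage
      (measurableEmbedding_subRight u)).mpr h1
  · rw [e, (measurePreserving_sub_right volume u).setIntegral_preimage_emb
      (measurableEmbedding_subRight u) (fun y => y ^ (-p)) (Ioi (1 - u)), h2,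
      show 1 - p = -(p - 1) by ring, show -p + 1 = -(p - 1) by ring, neg_div_neg_eq]

/-- Integrating over `y` first leaves `(1 - u)^(b+1-p) (1 + u)^b`, integrable exactly because `p < b
+ 2`. For `p = n + 1` this is the condition `b > n - 1`, that is `α > -1/2`. -/
lemma integrable_rodrigues_mul_sub_rpow {b p : ℝ} (hb : -1 < b) (hp : 1 < p) (hbp : p < b + 2) :
    Integrable (fun q : ℝ × ℝ => rodrigues b 0 q.1 * (q.2 - q.1) ^ (-p))
      ((volume.restrict (Ioo (-1 : ℝ) 1)).prod (volume.restrict (Ioi (1 : ℝ)))) := by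
  have hm : Measurable fun q : ℝ × ℝ => rodrigues b 0 q.1 * (q.2 - q.1) ^ (-p) := by
    have := measurable_rodrigues b 0
    fun_prop
  rw [integrable_prod_iff hm.aestronglyMeasurable]
  constructor
  · filter_upwards [ae_restrict_mem measurableSet_Ioo] with u hu
    exact (integral_Ioi_sub_rpow hp hu.2).1.const_mul _
  · have h := ((intervalIntegrable_jacobi_weight (c := b + (1 - p)) (d := b) (by linarith)
      hb).1.mono_set Ioo_subset_Ioc_self).const_mul (1 / (p - 1))
    refine Integrable.congr h ?_
    filter_upwards [ae_restrict_mem measurableSet_Ioo] with u hu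
    have hu1 : 0 < 1 - u := by linarith [hu.2]
    have hR := rodrigues_zero_nonneg b ⟨hu.1.le, hu.2.le⟩
    have : ∫ y in Ioi (1 : ℝ), ‖rodrigues b 0 u * (y - u) ^ (-p)‖ =
        ∫ y in Ioi (1 : ℝ), rodrigues b 0 u * (y - u) ^ (-p) := by
      refine setIntegral_congr_fun measurableSet_Ioi fun y hy => ?_
      have hy' : 1 < y := hy
      exact Real.norm_of_nonneg (mul_nonneg hR (Real.rpow_nonneg (by linarith [hu.2]) _))
    rw [this, integral_const_mul, (integral_Ioi_sub_rpow hp hu.2).2, rodrigues_zero,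
      Real.rpow_add hu1]
    ring

/-- The integral over `(1, ∞)` is continuous in `ν` up to `Re ν = n` for bounded `f`. -/
lemma tendsto_integral_stieltjesPower {n : ℕ} (hn : 1 ≤ n) {b : ℝ} (hb : (n : ℝ) - 1 < b) {ν : ℂ}
    (hν : ν.re = n) {g : ℝ → ℂ} (hg : AEStronglyMeasurable g (volume.restrict (Ioi 1))) {C : ℝ}
    (hC : ∀ y ∈ Ioi (1 : ℝ), ‖g y‖ ≤ C) :
    IntegrableOn (fun y => g y * stieltjesPower b ν y) (Ioi 1) ∧
    Tendsto (fun s => ∫ y in Ioi (1 : ℝ), g y * stieltjesPower b s y)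
      (𝓝[{s : ℂ | s.re ≤ n}] ν) (𝓝 (∫ y in Ioi (1 : ℝ), g y * stieltjesPower b ν y)) := by
  have hn1 : (1 : ℝ) ≤ n := by exact_mod_cast hn
  have hC0 : 0 ≤ C := (norm_nonneg _).trans (hC 2 (by norm_num))
  set μ : Measure (ℝ × ℝ) :=
    (volume.restrict (Ioo (-1 : ℝ) 1)).prod (volume.restrict (Ioi (1 : ℝ))) with hμ
  -- For `Re ν = n` it may happen that `b ≤ n`, so the uniform bound for the kernel near `y = 1` is
  -- unavailable. Dominated convergence is therefore applied to the double integral in `(u, y)`.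
  set Ψ : ℂ → ℝ × ℝ → ℂ := fun s q =>
    g q.2 * (((q.2 - q.1 : ℝ) : ℂ) ^ (-s - 1) * (rodrigues b 0 q.1 : ℂ)) with hΨ
  -- The two exponents bracket `Re s + 1` for `n - 1/2 ≤ Re s ≤ n`: the first dominates where `y - u
  -- ≤ 1`, the second where `y - u ≥ 1`.
  set M : ℝ × ℝ → ℝ := fun q => C * (rodrigues b 0 q.1 * (q.2 - q.1) ^ (-(n + 1 : ℝ)) +
    rodrigues b 0 q.1 * (q.2 - q.1) ^ (-(n + 1 / 2 : ℝ))) with hM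
  have hMint : Integrable M μ :=
    ((integrable_rodrigues_mul_sub_rpow (by linarith) (by linarith) (by linarith)).add
      (integrable_rodrigues_mul_sub_rpow (by linarith) (by linarith) (by linarith))).const_mul C
  have hmem : ∀ᵐ q ∂μ, q.1 ∈ Ioo (-1 : ℝ) 1 ∧ q.2 ∈ Ioi (1 : ℝ) := by
    filter_upwards [Measure.quasiMeasurePreserving_fst.ae (ae_restrict_mem measurableSet_Ioo),
      Measure.quasiMeasurePreserving_snd.ae (ae_restrict_mem measurableSet_Ioi)] with q h1 h2
    exact ⟨h1, h2⟩
  have hmeas : ∀ s, AEStronglyMeasurable (Ψ s) μ := fun s => by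
    refine (hg.comp_quasiMeasurePreserving Measure.quasiMeasurePreserving_snd).mul ?_
    have := measurable_rodrigues b 0
    exact Measurable.aestronglyMeasurable (by fun_prop)
  have hle : ∀ s : ℂ, (n : ℝ) - 1 / 2 ≤ s.re → s.re ≤ n → ∀ᵐ q ∂μ, ‖Ψ s q‖ ≤ M q := by
    intro s h1 h2
    filter_upwards [hmem] with q ⟨hu, hy⟩
    have hy' : 1 < q.2 := hy
    have huy : 0 < q.2 - q.1 := by linarith [hu.2]
    have hR := rodrigues_zero_nonneg b ⟨hu.1.le, hu.2.le⟩
    simp only [hΨ, hM]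
    rw [norm_mul, norm_sub_cpow_mul_rodrigues b s ⟨hu.1.le, hu.2.le⟩ (by linarith)]
    have h3 : (q.2 - q.1) ^ (-s.re - 1) ≤
        (q.2 - q.1) ^ (-(n + 1 : ℝ)) + (q.2 - q.1) ^ (-(n + 1 / 2 : ℝ)) := by
      have ha := Real.rpow_nonneg huy.le (-(n + 1 : ℝ))
      have hb := Real.rpow_nonneg huy.le (-(n + 1 / 2 : ℝ))
      rcases le_total (q.2 - q.1) 1 with h | h
      · have := Real.rpow_le_rpow_of_exponent_ge huy h (by linarith : -(n + 1 : ℝ) ≤ -s.re - 1)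
        linarith
      · have := Real.rpow_le_rpow_of_exponent_le h (by linarith : -s.re - 1 ≤ -(n + 1 / 2 : ℝ))
        linarith
    rw [← mul_add, mul_comm (_ ^ _) (rodrigues b 0 q.1)]
    exact mul_le_mul (hC _ hy) (mul_le_mul_of_nonneg_left h3 hR)
      (mul_nonneg hR (Real.rpow_nonneg huy.le _)) hC0
  have hint : ∀ s : ℂ, (n : ℝ) - 1 / 2 ≤ s.re → s.re ≤ n → Integrable (Ψ s) μ := fun s h1 h2 =>
    hMint.mono' (hmeas s) (hle s h1 h2)
  have hinner : ∀ s y, ∫ u in Ioo (-1 : ℝ) 1, Ψ s (u, y) = g y * stieltjesPower b s y := by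
    intro s y
    rw [stieltjesPower, intervalIntegral_eq_Ioo, ← integral_const_mul]
  have heq : ∀ s : ℂ, (n : ℝ) - 1 / 2 ≤ s.re → s.re ≤ n →
      ∫ q, Ψ s q ∂μ = ∫ y in Ioi (1 : ℝ), g y * stieltjesPower b s y := by
    intro s h1 h2
    rw [integral_prod_symm _ (hint s h1 h2)]
    simp only [hinner]
  constructor
  · have := (hint ν (by linarith) hν.le).integral_prod_right
    simp only [hinner] at this
    exact this
  · have hre : ∀ᶠ s : ℂ in 𝓝 ν, (n : ℝ) - 1 / 2 < s.re :=
      continuousAt_const.eventually_lt Complex.continuous_re.continuousAt (by rw [hν]; linarith)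
    rw [← heq ν (by linarith) hν.le]
    have hlim : Tendsto (fun s => ∫ q, Ψ s q ∂μ) (𝓝[{s : ℂ | s.re ≤ n}] ν)
        (𝓝 (∫ q, Ψ ν q ∂μ)) := by
      refine tendsto_integral_filter_of_dominated_convergence M
        (Eventually.of_forall hmeas) ?_ hMint ?_
      · filter_upwards [self_mem_nhdsWithin, nhdsWithin_le_nhds hre] with s h1 h2
        exact hle s h2.le h1
      · filter_upwards [hmem] with q ⟨hu, hy⟩
        have hy' : 1 < q.2 := hy
        have huy : (q.2 - q.1 : ℝ) ≠ 0 := by linarith [hu.2]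
        have hc : Continuous fun s : ℂ => ((q.2 - q.1 : ℝ) : ℂ) ^ (-s - 1) :=
          Continuous.const_cpow (by fun_prop) (Or.inl (by exact_mod_cast huy))
        exact (((hc.mul continuous_const).const_mul _).tendsto ν).mono_left nhdsWithin_le_nhds
    refine hlim.congr' ?_
    filter_upwards [self_mem_nhdsWithin, nhdsWithin_le_nhds hre] with s h1 h2
    exact heq s h2.le h1

/-- Once both integrals converge, only the prefactors remain; `Γ(s + 1)` is continuous at `ν`
because `Re ν + 1 > 0`. -/
lemma tendsto_gegenbauerFormula {n : ℕ} (hn : 1 ≤ n) {δ : ℝ} (hδ : 0 < δ) {ν : ℂ}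
    (hν : ν.re = n) {a : ℝ} {f : ℝ → ℂ} (hf : LocallyIntegrableOn f (Ioi a)) {x : ℝ}
    (hx : a < x - δ) {α : ℝ} (hα : -1 / 2 < α) {C : ℝ} (hC : ∀ t, x - δ ≤ t → ‖f t‖ ≤ C) :
    IntegrableOn (fun y => f (x - δ * y) * gegenbauerKernelP n α ν y) (Ioo (-1) 1) ∧
    IntegrableOn (fun y => f (x + δ * y) * gegenbauerKernelQ n α ν y) (Ioi 1) ∧
    Tendsto (fun s => gegenbauerFormula n α δ s f x) (𝓝[{s : ℂ | s.re ≤ n}] ν)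
      (𝓝 (gegenbauerFormula n α δ ν f x)) := by
  have hn1 : (1 : ℝ) ≤ n := by exact_mod_cast hn
  have hb : -1 < (n : ℝ) + α - 1 / 2 := by linarith
  have hgP : AEStronglyMeasurable (fun y => f (x - δ * y)) (volume.restrict (Ioo (-1) 1)) := by
    have := aestronglyMeasurable_comp_affine hf x (neg_ne_zero.mpr hδ.ne') measurableSet_Ioo
      (s := Ioo (-1) 1) (fun v hv => by nlinarith [hv.2])
    simpa only [neg_mul, ← sub_eq_add_neg] using this
  have hgQ : AEStronglyMeasurable (fun y => f (x + δ * y)) (volume.restrict (Ioi 1)) :=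
    aestronglyMeasurable_comp_affine hf x hδ.ne' measurableSet_Ioi
      (fun v hv => by nlinarith [mem_Ioi.mp hv])
  obtain ⟨hP1, hP2⟩ := tendsto_integral_gegenbauerKernelP hn hα hν hgP
    (fun y hy => hC _ (by nlinarith [hy.2]))
  obtain ⟨hQ1, hQ2⟩ := tendsto_integral_stieltjesPower hn
    (by linarith : (n : ℝ) - 1 < n + α - 1 / 2) hν hgQ
    (fun y hy => hC _ (by nlinarith [mem_Ioi.mp hy]))
  refine ⟨hP1, integrableOn_mul_gegenbauerKernelQ hb hQ1, ?_⟩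
  simp only [gegenbauerFormula_eq hb]
  have hδc : (δ : ℂ) ≠ 0 := by exact_mod_cast hδ.ne'
  have hD : Tendsto (fun s : ℂ => 1 / (δ : ℂ) ^ s) (𝓝[{s : ℂ | s.re ≤ n}] ν)
      (𝓝 (1 / (δ : ℂ) ^ ν)) := by
    have h1 : Continuous fun s : ℂ => (δ : ℂ) ^ s :=
      Continuous.const_cpow continuous_id (Or.inl hδc)
    refine Tendsto.div tendsto_const_nhds ((h1.tendsto ν).mono_left nhdsWithin_le_nhds) ?_
    rw [Complex.cpow_ne_zero_iff]; exact Or.inl hδc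
  have hS : Tendsto (fun s : ℂ => -(Complex.sin (s * Real.pi) * Complex.Gamma (s + 1) / Real.pi))
      (𝓝[{s : ℂ | s.re ≤ n}] ν)
      (𝓝 (-(Complex.sin (ν * Real.pi) * Complex.Gamma (ν + 1) / Real.pi))) := by
    have h1 : ContinuousAt (fun s : ℂ => Complex.Gamma (s + 1)) ν := by
      refine ContinuousAt.comp' (f := fun s : ℂ => s + 1) ?_ (by fun_prop)
      refine (Complex.differentiableAt_Gamma _ fun m h => ?_).continuousAt
      have := congrArg Complex.re h
      simp [hν] at this
      have h0 : (0 : ℝ) ≤ m := by positivity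
      linarith
    have h2 : ContinuousAt (fun s : ℂ => -(Complex.sin (s * Real.pi) * Complex.Gamma (s + 1) /
        Real.pi)) ν := by
      refine ContinuousAt.neg (ContinuousAt.div_const (ContinuousAt.mul ?_ h1) _)
      fun_prop
    exact h2.tendsto.mono_left nhdsWithin_le_nhds
  exact ((hD.const_mul _).mul hP2).add (((hD.const_mul _).mul hS).mul hQ2)

/-- The boundary case `Re ν = n`, by continuity. -/
theorem gegenbauer_of_locallyBounded {n : ℕ} (hn : 1 ≤ n) {δ : ℝ} (hδ : 0 < δ) {ν : ℂ}
    (hν : ν.re = n) {a : ℝ} {f : ℝ → ℂ}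
    (hf : LocallyIntegrableOn f (Ioi a)) {ε : ℝ} (hε : 0 < ε)
    (hdecay : f =O[atTop] fun t : ℝ => t ^ (ν.re - n - ε)) {x : ℝ} (hx : a < x - δ)
    {α : ℝ} (hα : -1 / 2 < α) (hb : LocallyBoundedOnIoi f a) :
    IntegrableOn (fun y => f (x - δ * y) * gegenbauerKernelP n α ν y) (Ioo (-1) 1) ∧
    IntegrableOn (fun y => f (x + δ * y) * gegenbauerKernelQ n α ν y) (Ioi 1) ∧
    Tendsto (fun s : ℂ => approxGegenbauerDeriv n α δ s f x)
      (𝓝[{s : ℂ | s.re < n}] ν) (𝓝 (gegenbauerFormula n α δ ν f x)) := by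
  have hn1 : (1 : ℝ) ≤ n := by exact_mod_cast hn
  obtain ⟨C, hC, hbd⟩ := hb.exists_norm_le (by linarith) hdecay hx
  have hC' : ∀ t, x - δ ≤ t → ‖f t‖ ≤ C := fun t ht => (hbd t ht).trans
    (mul_le_of_le_one_right hC
      (Real.rpow_le_one_of_one_le_of_nonpos (by linarith) (by linarith)))
  obtain ⟨h1, h2, h3⟩ := tendsto_gegenbauerFormula hn hδ hν hf hx hα hC'
  have hsub : {s : ℂ | s.re < n} ⊆ {s : ℂ | s.re ≤ n} := fun s (hs : s.re < n) => hs.le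
  refine ⟨h1, h2, (h3.mono_left (nhdsWithin_mono ν hsub)).congr' ?_⟩
  -- For `Re s > n - ε/2` the decay `t^(-ε)` of `f` implies the decay required at `s` with `ε/2` in
  -- place of `ε`. The bound `Re s > 0` keeps `s` away from the negative integers.
  have hre : ∀ᶠ s : ℂ in 𝓝 ν, max 0 ((n : ℝ) - ε / 2) < s.re :=
    continuousAt_const.eventually_lt Complex.continuous_re.continuousAt
      (by rw [hν]; exact max_lt (by linarith) (by linarith))
  filter_upwards [self_mem_nhdsWithin, nhdsWithin_le_nhds hre] with s hs hs2
  have hs1 : s.re < n := hs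
  obtain ⟨hs3, hs4⟩ := max_lt_iff.mp hs2
  have hdec : f =O[atTop] fun t : ℝ => t ^ (s.re - n - ε / 2) := by
    refine hdecay.trans (IsBigO.of_bound 1 ?_)
    filter_upwards [eventually_ge_atTop 1] with t ht
    rw [one_mul, Real.norm_of_nonneg (Real.rpow_nonneg (by linarith) _),
      Real.norm_of_nonneg (Real.rpow_nonneg (by linarith) _)]
    exact Real.rpow_le_rpow_of_exponent_le ht (by linarith)
  have hneg : ∀ k : ℕ, s ≠ -((k : ℂ) + 1) := by
    intro k h
    rw [h] at hs3
    simp at hs3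
    have : (0 : ℝ) ≤ k := by positivity
    linarith
  exact (gegenbauer_of_converges hn hδ hs1 hneg hf (half_pos hε) hdec hx hα
    (hb.approxGegenbauerConverges hδ hs1 hf (half_pos hε) hdec hx hα)).2.2.symm

/-- The formula for `ν = n`. -/
theorem approxGegenbauerDeriv_natCast {n : ℕ} (hn : 1 ≤ n) {δ : ℝ} (hδ : 0 < δ) (f : ℝ → ℂ)
    (x : ℝ) {α : ℝ} (hα : -1 / 2 < α) :
    approxGegenbauerDeriv n α δ n f x = gegenbauerFormula n α δ n f x := by
  have hn1 : (1 : ℝ) ≤ n := by exact_mod_cast hn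
  have hb : -1 < (n : ℝ) + α - 1 / 2 := by linarith
  have hgb : Real.Gamma (n + α + 1 / 2) ≠ 0 := (Real.Gamma_pos_of_pos (by linarith)).ne'
  set cP : ℝ := 1 / ((-2) ^ n * n.factorial) * 2 ^ ((n : ℝ) + α - 1 / 2) *
    Real.Gamma (n + α + 1 / 2) with hcP
  have hKP : ∀ v ∈ Ioo (-1 : ℝ) 1, weylIntegral (n - n) f (x + δ * v) *
      (rodrigues (n + α - 1 / 2) n v : ℂ) =
      cP * (f (x - δ * -v) * gegenbauerKernelP n α n (-v)) := by
    intro v hv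
    rw [rodrigues_eq_gegenbauerKernelP hα hv, ← hcP, weylIntegral, if_pos (sub_self _), mul_neg,
      sub_neg_eq_add]
    ring
  -- Here the Weyl integral is the identity and `sin(nπ) = 0` removes the integral over `(1, ∞)`.
  -- Both sides are multiples of the same integral, so no integrability is involved.
  rw [approxGegenbauerDeriv, approxWeylDeriv, orthDeriv, gegenbauer_normalization hn hα,
    integral_gegenbauerMeasure, intervalIntegral_eq_Ioo, setIntegral_congr_fun measurableSet_Ioo hKP,
    integral_const_mul, integral_Ioo_comp_neg (fun y => f (x - δ * y) * gegenbauerKernelP n α n y),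
    gegenbauerFormula_eq hb, Complex.sin_nat_mul_pi, Complex.cpow_natCast, hcP]
  have hδn : (δ : ℂ) ^ n ≠ 0 := pow_ne_zero _ (by exact_mod_cast hδ.ne')
  have hsp : (Real.sqrt Real.pi : ℂ) ≠ 0 := by
    exact_mod_cast (Real.sqrt_pos.mpr Real.pi_pos).ne'
  have hgbc : (Real.Gamma (n + α + 1 / 2) : ℂ) ≠ 0 := by exact_mod_cast hgb
  have hf0c : (n.factorial : ℂ) ≠ 0 := by exact_mod_cast n.factorial_ne_zero
  have hsgn : ((-2 : ℝ)) ^ n = (-1) ^ n * 2 ^ n := by rw [← mul_pow]; norm_num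
  have hP0 : ((-1 : ℂ) ^ n) ≠ 0 := pow_ne_zero _ (by norm_num)
  rw [hsgn]
  simp only [Complex.ofReal_mul, Complex.ofReal_div, Complex.ofReal_pow, Complex.ofReal_neg,
    Complex.ofReal_one, Complex.ofReal_ofNat, Complex.ofReal_natCast]
  generalize (Real.Gamma (n + α + 1 / 2) : ℂ) = G at *
  generalize (Real.Gamma (n + α + 1) : ℂ) = G2 at *
  generalize ∫ y in Ioo (-1 : ℝ) 1, f (x - δ * y) * gegenbauerKernelP n α n y = I2
  generalize (δ : ℂ) ^ n = D' at *
  generalize (-1 : ℂ) ^ n = P at *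
  generalize ((2 ^ ((n : ℝ) + α - 1 / 2) : ℝ) : ℂ) = B
  field_simp
  ring

/-! ### The Legendre case -/

lemma legendreKernelP_eq (n : ℕ) (ν : ℂ) : legendreKernelP n ν = gegenbauerKernelP n (1 / 2) ν := by
  funext y
  rw [legendreKernelP, gegenbauerKernelP,
    show (1 : ℂ) / 2 - ((1 / 2 : ℝ) : ℂ) - n + ν = ν - n by push_cast; ring,
    show (n : ℂ) + ((1 / 2 : ℝ) : ℂ) - 1 / 2 = n by push_cast; ring]

lemma legendreKernelQ_eq (n : ℕ) (ν : ℂ) : legendreKernelQ n ν = gegenbauerKernelQ n (1 / 2) ν := by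
  funext y
  rw [legendreKernelQ, gegenbauerKernelQ,
    show (1 : ℂ) / 2 - ((1 / 2 : ℝ) : ℂ) - n + ν = ν - n by push_cast; ring,
    show (n : ℂ) + ((1 / 2 : ℝ) : ℂ) - 1 / 2 = n by push_cast; ring]

lemma legendreFormula_eq (n : ℕ) (δ : ℝ) (ν : ℂ) (f : ℝ → ℂ) (x : ℝ) :
    legendreFormula n δ ν f x = gegenbauerFormula n (1 / 2) δ ν f x := by
  rw [legendreFormula, gegenbauerFormula, legendreKernelP_eq, legendreKernelQ_eq,
    show (n : ℝ) + 1 / 2 - 1 / 2 = n by ring, show (n : ℝ) + 1 / 2 + 1 / 2 = (n + 1 : ℕ) by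
      push_cast; ring, show (n : ℝ) + 1 / 2 + 1 = n + 3 / 2 by ring, Real.rpow_natCast,
    Real.rpow_natCast, div_mul_eq_mul_div, div_mul_eq_mul_div,
    show Complex.I * Real.pi * (((1 / 2 : ℝ) : ℂ) - 1 / 2 - ν) = -(Complex.I * Real.pi * ν) by
      push_cast; ring]

end

theorem mainTheorem9 (n : ℕ) (hn : 1 ≤ n) (δ : ℝ) (hδ : 0 < δ)
    (ν : ℂ) (hν : ν.re ≤ n) (hνneg : ∀ k : ℕ, ν ≠ -((k : ℂ) + 1))
    (a : ℝ) (f : ℝ → ℂ) (hf : LocallyIntegrableOn f (Ioi a))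
    (ε : ℝ) (hε : 0 < ε) (hdecay : f =O[atTop] fun t : ℝ => t ^ (ν.re - n - ε))
    (x : ℝ) (hx : a < x - δ) :
    -- the Gegenbauer case
    (∀ α : ℝ, -1 / 2 < α →
      (ν.re < n → ApproxGegenbauerConverges n α δ ν f x →
        IntegrableOn (fun y => f (x - δ * y) * gegenbauerKernelP n α ν y) (Ioo (-1) 1) ∧
        IntegrableOn (fun y => f (x + δ * y) * gegenbauerKernelQ n α ν y) (Ioi 1) ∧
        approxGegenbauerDeriv n α δ ν f x = gegenbauerFormula n α δ ν f x) ∧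
      (LocallyBoundedOnIoi f a →
        (ν.re < n → ApproxGegenbauerConverges n α δ ν f x) ∧
        (ν.re = n →
          IntegrableOn (fun y => f (x - δ * y) * gegenbauerKernelP n α ν y) (Ioo (-1) 1) ∧
          IntegrableOn (fun y => f (x + δ * y) * gegenbauerKernelQ n α ν y) (Ioi 1) ∧
          Tendsto (fun s : ℂ => approxGegenbauerDeriv n α δ s f x)
            (𝓝[{s : ℂ | s.re < n}] ν) (𝓝 (gegenbauerFormula n α δ ν f x))) ∧
        (ν = n → approxGegenbauerDeriv n α δ ν f x = gegenbauerFormula n α δ ν f x))) ∧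
    -- the Legendre case
    ((ν.re < n → ApproxGegenbauerConverges n (1 / 2) δ ν f x →
        IntegrableOn (fun y => f (x - δ * y) * legendreKernelP n ν y) (Ioo (-1) 1) ∧
        IntegrableOn (fun y => f (x + δ * y) * legendreKernelQ n ν y) (Ioi 1) ∧
        approxLegendreDeriv n δ ν f x = legendreFormula n δ ν f x) ∧
      (LocallyBoundedOnIoi f a →
        (ν.re = n →
          IntegrableOn (fun y => f (x - δ * y) * legendreKernelP n ν y) (Ioo (-1) 1) ∧
          IntegrableOn (fun y => f (x + δ * y) * legendreKernelQ n ν y) (Ioi 1) ∧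
          Tendsto (fun s : ℂ => approxLegendreDeriv n δ s f x)
            (𝓝[{s : ℂ | s.re < n}] ν) (𝓝 (legendreFormula n δ ν f x))) ∧
        (ν = n → approxLegendreDeriv n δ ν f x = legendreFormula n δ ν f x))) := by
  have hG : ∀ α : ℝ, -1 / 2 < α →
      (ν.re < n → ApproxGegenbauerConverges n α δ ν f x →
        IntegrableOn (fun y => f (x - δ * y) * gegenbauerKernelP n α ν y) (Ioo (-1) 1) ∧
        IntegrableOn (fun y => f (x + δ * y) * gegenbauerKernelQ n α ν y) (Ioi 1) ∧
        approxGegenbauerDeriv n α δ ν f x = gegenbauerFormula n α δ ν f x) ∧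
      (LocallyBoundedOnIoi f a →
        (ν.re < n → ApproxGegenbauerConverges n α δ ν f x) ∧
        (ν.re = n →
          IntegrableOn (fun y => f (x - δ * y) * gegenbauerKernelP n α ν y) (Ioo (-1) 1) ∧
          IntegrableOn (fun y => f (x + δ * y) * gegenbauerKernelQ n α ν y) (Ioi 1) ∧
          Tendsto (fun s : ℂ => approxGegenbauerDeriv n α δ s f x)
            (𝓝[{s : ℂ | s.re < n}] ν) (𝓝 (gegenbauerFormula n α δ ν f x))) ∧
        (ν = n → approxGegenbauerDeriv n α δ ν f x = gegenbauerFormula n α δ ν f x)) :=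
    fun α hα =>
      ⟨fun h hconv => gegenbauer_of_converges hn hδ h hνneg hf hε hdecay hx hα hconv,
        fun hb => ⟨fun h => hb.approxGegenbauerConverges hδ h hf hε hdecay hx hα,
          fun h => gegenbauer_of_locallyBounded hn hδ h hf hε hdecay hx hα hb,
          fun h => by rw [h]; exact approxGegenbauerDeriv_natCast hn hδ f x hα⟩⟩
  refine ⟨hG, ?_⟩
  obtain ⟨h1, h2⟩ := hG (1 / 2) (by norm_num)
  simp only [approxLegendreDeriv, legendreFormula_eq, legendreKernelP_eq, legendreKernelQ_eq]
  exact ⟨h1, fun hb => (h2 hb).2⟩
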